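/- Let $\Bbbk$ be an algebraically closed field of characteristic zero and let $q\in\Bbbk^*$ be not a root of unity. Let $D_q$ be the Heisenberg double of the quantum Euclidean group, i.e. the $\Bbbk$-algebra generated by $a,a^{-1},b,c,K,K^{-1},E,F$ with defining relations $$ab=qba,\quad ac=qca,\quad bc=cb,\quad aa^{-1}=a^{-1}a=1,\quad KE=q^2EK,\quad KF=q^{-2}FK,\quad EF=FE,\quad KK^{-1}=K^{-1}K=1,$$ $$Ka=q^{-1}aK,\quad Kb=qbK,\quad Kc=q^{-1}cK,\quad Ea=aE,\quad Eb=bE,\quad Ec=cE+a^{-1}K,\quad Fa=qaF,\quad Fb=q^{-1}bF+a,\quad Fc=qcF.$$ Put $\phi=(1-q^2)Fb+q^2a$ and $\psi=(1-q^{-2})Ec+q^{-2}a^{-1}K$, and write $(s,t,\dots)$ for the two-sided ideal of $D_q$ generated by $s,t,\dots$. For an $n\times n$ matrix $Q=(q_{ij})$ over $\Bbbk^*$ with $q_{ii}=q_{ij}q_{ji}=1$ and $0\le r\le n$, the quantum polynomial algebra $\Bbbk_Q[X_1^{\pm1},\dots,X_r^{\pm1},X_{r+1},\dots,X_n]$ is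 the $\Bbbk$-algebra generated by $X_1,\dots,X_n,X_1^{-1},\dots,X_r^{-1}$ with defining relations $X_iX_j=q_{ij}X_jX_i$ and $X_iX_i^{-1}=X_i^{-1}X_i=1$ ($i\le r$); it is called a quantum torus if $r=n$. Let $Q=(q^{d_{ij}})$ be the $6\times6$ matrix, with rows and columns indexed by $a,b,c,K,\psi,\phi$ in this order, whose exponents are $$(d_{ij})=\begin{pmatrix}0&1&1&1&1&0\\-1&0&0&-1&0&1\\-1&0&0&1&0&-1\\-1&1&-1&0&1&-1\\-1&0&0&-1&0&-1\\0&-1&1&1&1&0\end{pmatrix},$$ and let $Q_I$ be obtained from $Q$ by deleting the rows and columns with index in $I$ (so $Q_{36}$ has rows and columns $3$ and $6$ deleted). For a $\Bbbk$-algebra $R$ with endomorphisms $\sigma,\tau$ and an element $\mathtt a\in R$ such that $\tau\sigma(\mathtt a)=\mathtt a$, $\mathtt a r=\tau\sigma(r)\mathtt a$ and $\sigma(\mathtt a)r=\sigma\tau(r)\sigma(\mathtt a)$ for all $r\in R$, the GGWA (generalized generalized Weyl algebra) $R[x,y;\sigma,\tau,\mathtt a]$ is the algebra generated by $R$, $x$,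 $y$ with defining relations $xr=\sigma(r)x$, $yr=\tau(r)y$ ($r\in R$), $yx=\mathtt a$, $xy=\sigma(\mathtt a)$. In the following, each isomorphism is one of $\Bbbk$-algebras that sends the class of each generator $a,b,c,K,E,F,\phi,\psi$ that appears on the right-hand side to the element of the same name, and each $\sigma,\tau,\mathtt a$ satisfies the above conditions. 1. $(\phi)=D_q\phi$, and $D_q/(\phi)$ is a domain with $$D_q/(\phi)\simeq\Bbbk_{Q_{36}}[a^{\pm1},b^{\pm1},K^{\pm1},\psi][E,c;\sigma,\tau,\mathtt a],\qquad\mathtt a=(1-q^{-2})^{-1}(\psi-a^{-1}K),$$ where $\sigma,\tau$ are the automorphisms of the base ring with $\sigma(a)=a$, $\sigma(b)=b$, $\sigma(K)=q^{-2}K$, $\sigma(\psi)=\psi$ and $\tau(a)=q^{-1}a$, $\tau(b)=b$, $\tau(K)=qK$, $\tau(\psi)=\psi$. The element $b$ is invertible in $D_q/(\phi)$, and the centre of $D_q/(\phi)$ is the polynomial algebra $\Bbbk[\Theta]$ in one variable $\Theta=\psi b^{-1}$. 2. $(\psi)=D_q\psi$, and $D_q/(\psi)$ is a domain with $$D_q/(\psi)\simeq\Bbbk_{Q_{25}}[a^{\pm1},c^{\pm1},K^{\pm1},\phi][F,b;\sigma,\tau,\mathtt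 a],\qquad\mathtt a=(q^{-1}-q)^{-1}(\phi-a),$$ where $\sigma,\tau$ are the automorphisms of the base ring with $\sigma(a)=qa$, $\sigma(c)=qc$, $\sigma(K)=q^2K$, $\sigma(\phi)=q^{-1}\phi$ and $\tau(a)=q^{-1}a$, $\tau(c)=c$, $\tau(K)=q^{-1}K$, $\tau(\phi)=q\phi$. The element $c$ is invertible in $D_q/(\psi)$, and the centre of $D_q/(\psi)$ is the polynomial algebra $\Bbbk[\Omega]$ in one variable $\Omega=\phi Kc^{-1}$. 3. For every $\alpha\in\Bbbk$, the algebra $D_q/(\phi,\psi-\alpha b)$ is a simple domain with $$D_q/(\phi,\psi-\alpha b)\simeq\Bbbk_{Q_{356}}[a^{\pm1},b^{\pm1},K^{\pm1}][E,c;\sigma,\tau,\mathtt a],\qquad\mathtt a=(1-q^{-2})^{-1}(\alpha b-a^{-1}K),$$ where $\sigma,\tau$ are the automorphisms of the base ring with $\sigma(a)=a$, $\sigma(b)=b$, $\sigma(K)=q^{-2}K$ and $\tau(a)=q^{-1}a$, $\tau(b)=b$, $\tau(K)=qK$. In particular (the case $\alpha=0$), $(\phi,\psi)=D_q\phi+D_q\psi$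 and $D_q/(\phi,\psi)$ is a simple quantum torus $$D_q/(\phi,\psi)\simeq\Bbbk_{Q_{56}}[a^{\pm1},b^{\pm1},c^{\pm1},K^{\pm1}].$$ 4. For every $\beta\in\Bbbk$, the algebra $D_q/(\phi-\beta cK^{-1},\psi)$ is a simple domain with $$D_q/(\phi-\beta cK^{-1},\psi)\simeq\Bbbk_{Q_{256}}[a^{\pm1},c^{\pm1},K^{\pm1}][F,b;\sigma,\tau,\mathtt a],\qquad\mathtt a=(q^{-1}-q)^{-1}(\beta cK^{-1}-a),$$ where $\sigma,\tau$ are the automorphisms of the base ring with $\sigma(a)=qa$, $\sigma(c)=qc$, $\sigma(K)=q^2K$ and $\tau(a)=q^{-1}a$, $\tau(c)=c$, $\tau(K)=q^{-1}K$. -/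

import Mathlib

/-! ### Quantum polynomial algebras -/

/-- The defining relations of `k_Q[X₁^{±1}, …, X_r^{±1}, X_{r+1}, …, X_n]`. The generator `Sum.inl i`
is `X_i`, the generator `Sum.inr i` (for an index `i` among the first `r`) is `X_i⁻¹`. -/
inductive QuantumPolynomial.Rel {k : Type*} [Field k] {n : ℕ} (Q : Matrix (Fin n) (Fin n) k)
    (r : ℕ) :
    FreeAlgebra k (Fin n ⊕ {i : Fin n // i.val < r}) →
      FreeAlgebra k (Fin n ⊕ {i : Fin n // i.val < r}) → Prop
  | comm (i j : Fin n) : QuantumPolynomial.Rel Q r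
      (FreeAlgebra.ι k (Sum.inl i) * FreeAlgebra.ι k (Sum.inl j))
      (Q i j • (FreeAlgebra.ι k (Sum.inl j) * FreeAlgebra.ι k (Sum.inl i)))
  | mul_inv (i : {i : Fin n // i.val < r}) : QuantumPolynomial.Rel Q r
      (FreeAlgebra.ι k (Sum.inl i.1) * FreeAlgebra.ι k (Sum.inr i)) 1
  | inv_mul (i : {i : Fin n // i.val < r}) : QuantumPolynomial.Rel Q r
      (FreeAlgebra.ι k (Sum.inr i) * FreeAlgebra.ι k (Sum.inl i.1)) 1

/-- The quantum polynomial algebra `k_Q[X₁^{±1}, …, X_r^{±1}, X_{r+1}, …, X_n]`, for a matrix `Q`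
with `Q i i = 1` and `Q i j * Q j i = 1`. It is a quantum torus if `r = n`. -/
def QuantumPolynomial {k : Type*} [Field k] {n : ℕ} (Q : Matrix (Fin n) (Fin n) k) (r : ℕ) :=
  RingQuot (QuantumPolynomial.Rel Q r)

namespace QuantumPolynomial

variable {k : Type*} [Field k] {n : ℕ} (Q : Matrix (Fin n) (Fin n) k) (r : ℕ)

instance : Ring (QuantumPolynomial Q r) := inferInstanceAs (Ring (RingQuot (Rel Q r)))

instance : Algebra k (QuantumPolynomial Q r) := inferInstanceAs (Algebra k (RingQuot (Rel Q r)))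

/-- The indeterminate `X_i` (indices start at `0`). -/
def X (i : Fin n) : QuantumPolynomial Q r :=
  RingQuot.mkAlgHom k (Rel Q r) (FreeAlgebra.ι k (Sum.inl i))

/-- The inverse `X_i⁻¹` of one of the first `r` indeterminates. -/
def Xinv (i : Fin n) (hi : i.val < r) : QuantumPolynomial Q r :=
  RingQuot.mkAlgHom k (Rel Q r) (FreeAlgebra.ι k (Sum.inr ⟨i, hi⟩))

end QuantumPolynomial

/-! ### Generalized generalized Weyl algebras -/

/-- The conditions on `σ`, `τ`, `a` under which the GGWA `R[x, y; σ, τ, a]` is formed. -/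
structure IsGGWADatum {k R : Type*} [CommRing k] [Ring R] [Algebra k R]
    (σ τ : R →ₐ[k] R) (a : R) : Prop where
  apply_eq : τ (σ a) = a
  mul_eq : ∀ r : R, a * r = τ (σ r) * a
  map_mul_eq : ∀ r : R, σ a * r = σ (τ r) * σ a

/-- The defining relations of the GGWA `R[x, y; σ, τ, a]`. The generators are the elements of `R`
(`Sum.inl r`), `x` (`Sum.inr false`) and `y` (`Sum.inr true`); the first three families of
relations say that `R` maps to the quotient by a homomorphism of `k`-algebras. -/
inductive GGWA.Rel {k R : Type*} [CommRing k] [Ring R] [Algebra k R]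
    (σ τ : R →ₐ[k] R) (a : R) : FreeAlgebra k (R ⊕ Bool) → FreeAlgebra k (R ⊕ Bool) → Prop
  | of_scalar (t : k) : GGWA.Rel σ τ a
      (FreeAlgebra.ι k (Sum.inl (algebraMap k R t))) (algebraMap k _ t)
  | of_add (r s : R) : GGWA.Rel σ τ a
      (FreeAlgebra.ι k (Sum.inl (r + s)))
      (FreeAlgebra.ι k (Sum.inl r) + FreeAlgebra.ι k (Sum.inl s))
  | of_mul (r s : R) : GGWA.Rel σ τ a
      (FreeAlgebra.ι k (Sum.inl (r * s)))
      (FreeAlgebra.ι k (Sum.inl r) * FreeAlgebra.ι k (Sum.inl s))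
  | x_mul (r : R) : GGWA.Rel σ τ a
      (FreeAlgebra.ι k (Sum.inr false) * FreeAlgebra.ι k (Sum.inl r))
      (FreeAlgebra.ι k (Sum.inl (σ r)) * FreeAlgebra.ι k (Sum.inr false))
  | y_mul (r : R) : GGWA.Rel σ τ a
      (FreeAlgebra.ι k (Sum.inr true) * FreeAlgebra.ι k (Sum.inl r))
      (FreeAlgebra.ι k (Sum.inl (τ r)) * FreeAlgebra.ι k (Sum.inr true))
  | y_mul_x : GGWA.Rel σ τ a
      (FreeAlgebra.ι k (Sum.inr true) * FreeAlgebra.ι k (Sum.inr false))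
      (FreeAlgebra.ι k (Sum.inl a))
  | x_mul_y : GGWA.Rel σ τ a
      (FreeAlgebra.ι k (Sum.inr false) * FreeAlgebra.ι k (Sum.inr true))
      (FreeAlgebra.ι k (Sum.inl (σ a)))

/-- The GGWA `R[x, y; σ, τ, a]`: the algebra generated by `R`, `x`, `y` with defining relations
`x r = σ(r) x`, `y r = τ(r) y`, `y x = a`, `x y = σ(a)`. -/
def GGWA {k R : Type*} [CommRing k] [Ring R] [Algebra k R] (σ τ : R →ₐ[k] R) (a : R) :=
  RingQuot (GGWA.Rel σ τ a)

namespace GGWA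

variable {k R : Type*} [CommRing k] [Ring R] [Algebra k R] (σ τ : R →ₐ[k] R) (a : R)

instance : Ring (GGWA σ τ a) := inferInstanceAs (Ring (RingQuot (Rel σ τ a)))

instance : Algebra k (GGWA σ τ a) := inferInstanceAs (Algebra k (RingQuot (Rel σ τ a)))

/-- The image of an element of the base ring. -/
def of (r : R) : GGWA σ τ a := RingQuot.mkAlgHom k (Rel σ τ a) (FreeAlgebra.ι k (Sum.inl r))

/-- The generator `x`. -/
def x : GGWA σ τ a := RingQuot.mkAlgHom k (Rel σ τ a) (FreeAlgebra.ι k (Sum.inr false))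

/-- The generator `y`. -/
def y : GGWA σ τ a := RingQuot.mkAlgHom k (Rel σ τ a) (FreeAlgebra.ι k (Sum.inr true))

end GGWA

/-! ### The Heisenberg double of the quantum Euclidean group -/

/-- The generators of `D_q`. -/
inductive Dq.Gen : Type
  | a | ainv | b | c | K | Kinv | E | F

/-- The free algebra generator belonging to a generator of `D_q`. -/
abbrev Dq.gen (k : Type*) [Field k] (g : Dq.Gen) : FreeAlgebra k Dq.Gen := FreeAlgebra.ι k g

/-- The defining relations of `D_q`. -/
inductive Dq.Rel {k : Type*} [Field k] (q : k) :
    FreeAlgebra k Dq.Gen → FreeAlgebra k Dq.Gen → Prop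
  | ab : Dq.Rel q (gen k .a * gen k .b) (q • (gen k .b * gen k .a))
  | ac : Dq.Rel q (gen k .a * gen k .c) (q • (gen k .c * gen k .a))
  | bc : Dq.Rel q (gen k .b * gen k .c) (gen k .c * gen k .b)
  | a_ainv : Dq.Rel q (gen k .a * gen k .ainv) 1
  | ainv_a : Dq.Rel q (gen k .ainv * gen k .a) 1
  | KE : Dq.Rel q (gen k .K * gen k .E) (q ^ 2 • (gen k .E * gen k .K))
  | KF : Dq.Rel q (gen k .K * gen k .F) (q ^ (-2 : ℤ) • (gen k .F * gen k .K))
  | EF : Dq.Rel q (gen k .E * gen k .F) (gen k .F * gen k .E)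
  | K_Kinv : Dq.Rel q (gen k .K * gen k .Kinv) 1
  | Kinv_K : Dq.Rel q (gen k .Kinv * gen k .K) 1
  | Ka : Dq.Rel q (gen k .K * gen k .a) (q⁻¹ • (gen k .a * gen k .K))
  | Kb : Dq.Rel q (gen k .K * gen k .b) (q • (gen k .b * gen k .K))
  | Kc : Dq.Rel q (gen k .K * gen k .c) (q⁻¹ • (gen k .c * gen k .K))
  | Ea : Dq.Rel q (gen k .E * gen k .a) (gen k .a * gen k .E)
  | Eb : Dq.Rel q (gen k .E * gen k .b) (gen k .b * gen k .E)
  | Ec : Dq.Rel q (gen k .E * gen k .c) (gen k .c * gen k .E + gen k .ainv * gen k .K)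
  | Fa : Dq.Rel q (gen k .F * gen k .a) (q • (gen k .a * gen k .F))
  | Fb : Dq.Rel q (gen k .F * gen k .b) (q⁻¹ • (gen k .b * gen k .F) + gen k .a)
  | Fc : Dq.Rel q (gen k .F * gen k .c) (q • (gen k .c * gen k .F))

/-- The Heisenberg double `D_q = D_q(E₂)` of the quantum Euclidean group. -/
def Dq {k : Type*} [Field k] (q : k) := RingQuot (Dq.Rel q)

namespace Dq

variable {k : Type*} [Field k] (q : k)

instance : Ring (Dq q) := inferInstanceAs (Ring (RingQuot (Rel q)))

instance : Algebra k (Dq q) := inferInstanceAs (Algebra k (RingQuot (Rel q)))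

/-- The element of `D_q` given by a generator. -/
def of (g : Gen) : Dq q := RingQuot.mkAlgHom k (Rel q) (gen k g)

/-- The generator `a` of `D_q`. -/
abbrev a : Dq q := of q .a

/-- The generator `a⁻¹` of `D_q`. -/
abbrev ainv : Dq q := of q .ainv

/-- The generator `b` of `D_q`. -/
abbrev b : Dq q := of q .b

/-- The generator `c` of `D_q`. -/
abbrev c : Dq q := of q .c

/-- The generator `K` of `D_q`. -/
abbrev K : Dq q := of q .K

/-- The generator `K⁻¹` of `D_q`. -/
abbrev Kinv : Dq q := of q .Kinv

/-- The generator `E` of `D_q`. -/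
abbrev E : Dq q := of q .E

/-- The generator `F` of `D_q`. -/
abbrev F : Dq q := of q .F

/-- `φ = (1 - q²) F b + q² a`. -/
def phi : Dq q := (1 - q ^ 2) • (F q * b q) + q ^ 2 • a q

/-- `ψ = (1 - q⁻²) E c + q⁻² a⁻¹ K`. -/
def psi : Dq q :=
  (1 - q ^ (-2 : ℤ)) • (E q * c q) + q ^ (-2 : ℤ) • (ainv q * K q)

/-- The factor algebra of `D_q` by the two-sided ideal generated by a set. -/
abbrev Factor {q : k} (s : Set (Dq q)) := (TwoSidedIdeal.span s).ringCon.Quotient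

/-- The image of an element of `D_q` in a factor algebra. -/
def cl {q : k} (s : Set (Dq q)) (z : Dq q) : Factor s := (TwoSidedIdeal.span s).ringCon.mk' z

/-- The exponents `d_{ij}`, for the variables in the order `a, b, c, K, ψ, φ`. -/
def expMatrix : Matrix (Fin 6) (Fin 6) ℤ :=
  !![0, 1, 1, 1, 1, 0;
    -1, 0, 0, -1, 0, 1;
    -1, 0, 0, 1, 0, -1;
    -1, 1, -1, 0, 1, -1;
    -1, 0, 0, -1, 0, -1;
    0, -1, 1, 1, 1, 0]

/-- The matrix `Q = (q^{d_{ij}})`, for the variables in the order `a, b, c, K, ψ, φ`. -/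
def qMatrix : Matrix (Fin 6) (Fin 6) k := Matrix.of fun i j => q ^ expMatrix i j

/-- The quantum polynomial algebra on those of the variables `a, b, c, K, ψ, φ` (numbered from
`0` to `5`) that `v` lists; the first `r` of the listed variables are invertible. -/
abbrev QPoly {n : ℕ} (v : Fin n → Fin 6) (r : ℕ) :=
  QuantumPolynomial ((qMatrix q).submatrix v v) r

/-- `k_{Q₃₆}[a^{±1}, b^{±1}, K^{±1}, ψ]`. -/
abbrev R36 := QPoly q ![0, 1, 3, 4] 3

/-- `k_{Q₂₅}[a^{±1}, c^{±1}, K^{±1}, φ]`. -/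
abbrev R25 := QPoly q ![0, 2, 3, 5] 3

/-- `k_{Q₃₅₆}[a^{±1}, b^{±1}, K^{±1}]`. -/
abbrev R356 := QPoly q ![0, 1, 3] 3

/-- `k_{Q₂₅₆}[a^{±1}, c^{±1}, K^{±1}]`. -/
abbrev R256 := QPoly q ![0, 2, 3] 3

/-- The quantum torus `k_{Q₅₆}[a^{±1}, b^{±1}, c^{±1}, K^{±1}]`. -/
abbrev T := QPoly q ![0, 1, 2, 3] 4

namespace R36

/-- The variable `a`. -/
abbrev a : R36 q := QuantumPolynomial.X _ _ 0
/-- The variable `b`. -/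
abbrev b : R36 q := QuantumPolynomial.X _ _ 1
/-- The variable `K`. -/
abbrev K : R36 q := QuantumPolynomial.X _ _ 2
/-- The variable `ψ`. -/
abbrev psi : R36 q := QuantumPolynomial.X _ _ 3
/-- The inverse of `a`. -/
abbrev ainv : R36 q := QuantumPolynomial.Xinv _ _ 0 (by decide)
/-- `(1 - q⁻²)⁻¹ (ψ - a⁻¹ K)`. -/
def elt : R36 q := (1 - q ^ (-2 : ℤ))⁻¹ • (psi q - ainv q * K q)

end R36

namespace R25

/-- The variable `a`. -/
abbrev a : R25 q := QuantumPolynomial.X _ _ 0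
/-- The variable `c`. -/
abbrev c : R25 q := QuantumPolynomial.X _ _ 1
/-- The variable `K`. -/
abbrev K : R25 q := QuantumPolynomial.X _ _ 2
/-- The variable `φ`. -/
abbrev phi : R25 q := QuantumPolynomial.X _ _ 3
/-- `(q⁻¹ - q)⁻¹ (φ - a)`. -/
def elt : R25 q := (q⁻¹ - q)⁻¹ • (phi q - a q)

end R25

namespace R356

/-- The variable `a`. -/
abbrev a : R356 q := QuantumPolynomial.X _ _ 0
/-- The variable `b`. -/
abbrev b : R356 q := QuantumPolynomial.X _ _ 1
/-- The variable `K`. -/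
abbrev K : R356 q := QuantumPolynomial.X _ _ 2
/-- The inverse of `a`. -/
abbrev ainv : R356 q := QuantumPolynomial.Xinv _ _ 0 (by decide)
/-- `(1 - q⁻²)⁻¹ (α b - a⁻¹ K)`. -/
def elt (α : k) : R356 q := (1 - q ^ (-2 : ℤ))⁻¹ • (α • b q - ainv q * K q)

end R356

namespace R256

/-- The variable `a`. -/
abbrev a : R256 q := QuantumPolynomial.X _ _ 0
/-- The variable `c`. -/
abbrev c : R256 q := QuantumPolynomial.X _ _ 1
/-- The variable `K`. -/
abbrev K : R256 q := QuantumPolynomial.X _ _ 2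
/-- The inverse of `K`. -/
abbrev Kinv : R256 q := QuantumPolynomial.Xinv _ _ 2 (by decide)
/-- `(q⁻¹ - q)⁻¹ (β c K⁻¹ - a)`. -/
def elt (β : k) : R256 q := (q⁻¹ - q)⁻¹ • (β • (c q * Kinv q) - a q)

end R256

namespace T

/-- The variable `a`. -/
abbrev a : T q := QuantumPolynomial.X _ _ 0
/-- The variable `b`. -/
abbrev b : T q := QuantumPolynomial.X _ _ 1
/-- The variable `c`. -/
abbrev c : T q := QuantumPolynomial.X _ _ 2
/-- The variable `K`. -/
abbrev K : T q := QuantumPolynomial.X _ _ 3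

end T

end Dq

/-!
Modulo `φ` the relations `φ = (q⁻¹ - q) b F + a = (1 - q²) F b + q² a` make `b` left and right
invertible and express `F` through `a` and `b`; modulo `ψ` the same happens to `c` and `E`. So a
factor algebra is generated by a quantum polynomial algebra `R` on some of `a, b, c, K, ψ, φ` and
one pair `x, y` (`E, c` or `F, b`) that satisfies the relations of a generalized generalized Weyl
algebra over `R`, and the elements `r y ^ n` and `r x ^ n` span it. It is mapped to the algebra
twisted by a bicharacter of the monoid `ℤ⁴` or `ℤ⁴ × ℕ` of exponents, in which `E` and `F` are
given by the equations that define `ψ` and `φ`. There the images of the spanning elements of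
different degrees are independent, which proves both that the map is injective, so that the factor
algebra is a domain, and that the presentation by `R, x, y` is correct.

An element that commutes with four independent monomials is supported where the bicharacter is
trivial, which gives the centre since the determinant of the exponent matrix is not zero. For the
same reason a nonzero ideal contains a monomial, hence a power of `y`; a relation
`x y = s y x + u` with a unit `u` that `q`-commutes with `y` lowers that power down to `1`.
-/

/-! ### Twisted monoid algebras -/

/-- The monoid algebra of `G` twisted by the bicharacter `χ`: its basis vectors `e g` multiply by
`e g * e h = χ g h • e (g + h)`. For `G = ℤⁿ` this is a quantum torus. -/
def TwistedMonoidAlgebra {k G : Type*} [Field k] [AddCommMonoid G]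
    (_χ : G →+ G →+ Additive kˣ) := G →₀ k

namespace TwistedMonoidAlgebra

section AddCommMonoid

variable {k G : Type*} [Field k] [AddCommMonoid G] {χ : G →+ G →+ Additive kˣ}

noncomputable instance : AddCommGroup (TwistedMonoidAlgebra χ) :=
  inferInstanceAs (AddCommGroup (G →₀ k))

noncomputable instance : Module k (TwistedMonoidAlgebra χ) :=
  inferInstanceAs (Module k (G →₀ k))

/-- The family of coefficients of an element. -/
noncomputable def coeff : TwistedMonoidAlgebra χ ≃ₗ[k] G →₀ k := LinearEquiv.refl k (G →₀ k)

/-- The monomial with exponent `g` and coefficient `t`. -/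
noncomputable def single (g : G) (t : k) : TwistedMonoidAlgebra χ :=
  coeff.symm (Finsupp.single g t)

@[simp]
theorem coeff_single (g : G) (t : k) :
    coeff (single g t : TwistedMonoidAlgebra χ) = Finsupp.single g t := rfl

theorem smul_single (s : k) (g : G) (t : k) :
    s • (single g t : TwistedMonoidAlgebra χ) = single g (s * t) :=
  Finsupp.smul_single s g t

theorem single_ne_zero {g : G} {t : k} (ht : t ≠ 0) :
    (single g t : TwistedMonoidAlgebra χ) ≠ 0 :=
  Finsupp.single_ne_zero.2 ht

theorem linearIndependent_single :
    LinearIndependent k fun g => (single g 1 : TwistedMonoidAlgebra χ) :=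
  Finsupp.linearIndependent_single_one k G

theorem eq_sum_single (x : TwistedMonoidAlgebra χ) :
    x = ∑ g ∈ (coeff x).support, single g (coeff x g) :=
  (Finsupp.sum_single (coeff x)).symm

@[elab_as_elim]
theorem induction {p : TwistedMonoidAlgebra χ → Prop} (x : TwistedMonoidAlgebra χ) (zero : p 0)
    (add : ∀ x y, p x → p y → p (x + y)) (single : ∀ g t, p (single g t)) : p x :=
  Finsupp.induction_linear x zero add single

/-- Multiplication as a bilinear map. -/
noncomputable def mulHom (χ : G →+ G →+ Additive kˣ) : (G →₀ k) →ₗ[k] (G →₀ k) →ₗ[k] (G →₀ k) :=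
  Finsupp.lift ((G →₀ k) →ₗ[k] (G →₀ k)) k G fun g =>
    Finsupp.lift (G →₀ k) k G fun h => Finsupp.single (g + h) ((χ g h).toMul : k)

noncomputable instance : Mul (TwistedMonoidAlgebra χ) := ⟨fun x y => mulHom χ x y⟩

noncomputable instance : One (TwistedMonoidAlgebra χ) := ⟨single 0 1⟩

theorem one_def : (1 : TwistedMonoidAlgebra χ) = single 0 1 := rfl

theorem single_mul_single (g h : G) (s t : k) :
    (single g s * single h t : TwistedMonoidAlgebra χ) =
      single (g + h) (s * t * (χ g h).toMul) := by
  change mulHom χ (Finsupp.single g s) (Finsupp.single h t) = Finsupp.single _ _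
  rw [mulHom, Finsupp.lift_apply, Finsupp.sum_single_index (by simp), LinearMap.smul_apply,
    Finsupp.lift_apply, Finsupp.sum_single_index (by simp), Finsupp.smul_single,
    Finsupp.smul_single, smul_eq_mul, smul_eq_mul, mul_assoc]

noncomputable instance : NonUnitalNonAssocRing (TwistedMonoidAlgebra χ) where
  left_distrib x y z := map_add (mulHom χ x) y z
  right_distrib := LinearMap.map_add₂ (mulHom χ)
  zero_mul := LinearMap.map_zero₂ (mulHom χ)
  mul_zero x := map_zero (mulHom χ x)

noncomputable instance : Ring (TwistedMonoidAlgebra χ) where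
  mul_assoc x y z := by
    induction x using induction with
    | zero => simp only [zero_mul]
    | add x x' hx hx' => simp only [add_mul, hx, hx']
    | single g s =>
    induction y using induction with
    | zero => simp only [zero_mul, mul_zero]
    | add y y' hy hy' => simp only [add_mul, mul_add, hy, hy']
    | single h t =>
    induction z using induction with
    | zero => simp only [mul_zero]
    | add z z' hz hz' => simp only [mul_add, hz, hz']
    | single l u =>
      simp only [single_mul_single, map_add, AddMonoidHom.add_apply, toMul_add, Units.val_mul,
        add_assoc]
      congr 1
      ring
  one_mul x := by
    induction x using induction with
    | zero => rw [mul_zero]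
    | add x x' hx hx' => rw [mul_add, hx, hx']
    | single g s => simp [one_def, single_mul_single]
  mul_one x := by
    induction x using induction with
    | zero => rw [zero_mul]
    | add x x' hx hx' => rw [add_mul, hx, hx']
    | single g s => simp [one_def, single_mul_single]

noncomputable instance : Algebra k (TwistedMonoidAlgebra χ) :=
  Algebra.ofModule (fun r x y => LinearMap.map_smul₂ (mulHom χ) r x y)
    (fun r x y => map_smul (mulHom χ x) r y)

instance : Nontrivial (TwistedMonoidAlgebra χ) := ⟨1, 0, single_ne_zero one_ne_zero⟩

theorem coeff_mul_of_uniqueAdd {x y : TwistedMonoidAlgebra χ} {g h : G}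
    (hg : g ∈ (coeff x).support) (hh : h ∈ (coeff y).support)
    (H : UniqueAdd (coeff x).support (coeff y).support g h) :
    coeff (x * y) (g + h) = coeff x g * coeff y h * (χ g h).toMul := by
  conv_lhs => rw [eq_sum_single x, eq_sum_single y, Finset.sum_mul_sum]
  simp only [map_sum, Finsupp.coe_finsetSum, Finset.sum_apply, single_mul_single, coeff_single]
  rw [Finset.sum_eq_single_of_mem g hg, Finset.sum_eq_single_of_mem h hh, Finsupp.single_eq_same]
  · exact fun h' hh' hne => Finsupp.single_eq_of_ne' fun e => hne (H hg hh' e).2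
  · exact fun g' hg' hne => Finset.sum_eq_zero fun h' hh' =>
      Finsupp.single_eq_of_ne' fun e => hne (H hg' hh' e).1

instance [UniqueSums G] : NoZeroDivisors (TwistedMonoidAlgebra χ) where
  eq_zero_or_eq_zero_of_mul_eq_zero {x y} hxy := by
    contrapose! hxy
    obtain ⟨g, hg, h, hh, H⟩ := UniqueSums.uniqueAdd_of_nonempty
      (Finsupp.support_nonempty_iff.2 (coeff.map_ne_zero_iff.2 hxy.1))
      (Finsupp.support_nonempty_iff.2 (coeff.map_ne_zero_iff.2 hxy.2))
    have hgh := coeff_mul_of_uniqueAdd hg hh H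
    intro h0
    rw [h0, map_zero, Finsupp.zero_apply] at hgh
    exact mul_ne_zero (mul_ne_zero (Finsupp.mem_support_iff.1 hg) (Finsupp.mem_support_iff.1 hh))
      (Units.ne_zero _) hgh.symm

instance [UniqueSums G] : IsDomain (TwistedMonoidAlgebra χ) := NoZeroDivisors.to_isDomain _

/-- The elements supported on the exponents of degree `d`. -/
noncomputable def homogeneousSubmodule (χ : G →+ G →+ Additive kˣ) (δ : G →+ ℤ) (d : ℤ) :
    Submodule k (TwistedMonoidAlgebra χ) :=
  (Finsupp.supported k k {g | δ g = d}).comap (coeff (χ := χ) : _ →ₗ[k] G →₀ k)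

theorem single_mem_homogeneousSubmodule (δ : G →+ ℤ) (g : G) (t : k) :
    single g t ∈ homogeneousSubmodule χ δ (δ g) :=
  Finsupp.single_mem_supported k t rfl

instance (δ : G →+ ℤ) : SetLike.GradedMonoid (homogeneousSubmodule χ δ) where
  one_mem := by simpa [one_def] using single_mem_homogeneousSubmodule (χ := χ) δ 0 1
  mul_mem d e x y hx hy := by
    rw [eq_sum_single x, eq_sum_single y, Finset.sum_mul_sum]
    refine sum_mem fun g hg => sum_mem fun h hh => ?_
    rw [single_mul_single, ← show δ g = d from hx hg, ← show δ h = e from hy hh, ← map_add]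
    exact single_mem_homogeneousSubmodule δ _ _

theorem iSupIndep_homogeneousSubmodule (δ : G →+ ℤ) : iSupIndep (homogeneousSubmodule χ δ) := by
  have h : iSupIndep fun d : ℤ => Finsupp.supported k k {g | δ g = d} := by
    intro d
    refine Disjoint.mono_right
      (iSup₂_le fun e (he : e ≠ d) => Finsupp.supported_mono (t := {g | δ g ≠ d}) ?_) ?_
    · rintro g rfl
      exact he
    · exact Finsupp.disjoint_supported_supported disjoint_compl_right
  exact h

end AddCommMonoid

section AddCancelCommMonoid

variable {k G : Type*} [Field k] [AddCancelCommMonoid G] {χ : G →+ G →+ Additive kˣ}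

theorem coeff_single_mul (v g : G) (x : TwistedMonoidAlgebra χ) :
    coeff (single v 1 * x) (v + g) = (χ v g).toMul * coeff x g := by
  induction x using induction with
  | zero => simp
  | add x y hx hy => simp [mul_add, hx, hy]
  | single l t => by_cases h : l = g <;> simp [single_mul_single, h, mul_comm]

theorem coeff_mul_single (v g : G) (x : TwistedMonoidAlgebra χ) :
    coeff (x * single v 1) (v + g) = (χ g v).toMul * coeff x g := by
  induction x using induction with
  | zero => simp
  | add x y hx hy => simp [mul_add, add_mul, hx, hy]
  | single l t => by_cases h : l = g <;> simp [single_mul_single, h, add_comm v g, mul_comm]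

theorem bicharacter_comm_of_commute_single {v : G} {x : TwistedMonoidAlgebra χ}
    (hx : Commute (single v 1) x) {g : G} (hg : coeff x g ≠ 0) : χ v g = χ g v := by
  have h := coeff_single_mul v g x
  rw [hx.eq, coeff_mul_single] at h
  exact (Additive.toMul.injective (Units.ext (mul_right_cancel₀ hg h))).symm

theorem coeff_twisted_commutator (s : kˣ) (v g : G) (x : TwistedMonoidAlgebra χ) :
    coeff (single v 1 * x - (s : k) • (x * single v 1)) (v + g) =
      ((χ v g).toMul - (s * (χ g v).toMul : kˣ)) * coeff x g := by
  simp [coeff_single_mul, coeff_mul_single, sub_mul, mul_assoc]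

end AddCancelCommMonoid

section AddCommGroup

variable {k G : Type*} [Field k] [AddCommGroup G] {χ : G →+ G →+ Additive kˣ}

/- A twisted commutator with a monomial multiplies the coefficients by scalars, one of which
can be made to vanish. -/
theorem exists_single_mem {J : Submodule k (TwistedMonoidAlgebra χ)} {V : Set G}
    (hleft : ∀ v ∈ V, ∀ x ∈ J, single v 1 * x ∈ J) (hright : ∀ v ∈ V, ∀ x ∈ J, x * single v 1 ∈ J)
    (hV : ∀ g, (∀ v ∈ V, χ v g = χ g v) → g = 0) {x : TwistedMonoidAlgebra χ} (hx : x ∈ J)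
    (hx0 : x ≠ 0) : ∃ g, single g 1 ∈ J := by
  induction hn : (coeff x).support.card using Nat.strong_induction_on generalizing x with
  | _ n ih =>
  obtain ⟨g, hg⟩ := Finsupp.support_nonempty_iff.2 (coeff.map_ne_zero_iff.2 hx0)
  by_cases hs : ∀ h ∈ (coeff x).support, h = g
  · have hxg : x = single g (coeff x g) :=
      (eq_sum_single x).trans <| Finset.sum_eq_single_of_mem g hg fun h hh hne =>
        absurd (hs h hh) hne
    have := J.smul_mem (coeff x g)⁻¹ hx
    rw [hxg, smul_single, coeff_single, Finsupp.single_eq_same,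
      inv_mul_cancel₀ (Finsupp.mem_support_iff.1 hg)] at this
    exact ⟨g, this⟩
  · push Not at hs
    obtain ⟨h, hh, hne⟩ := hs
    obtain ⟨v, hv, hvne⟩ : ∃ v ∈ V, χ v (h - g) ≠ χ (h - g) v := by
      by_contra! hcon
      exact hne (sub_eq_zero.1 (hV _ hcon))
    set s := (χ v g - χ g v).toMul with hs
    refine ih _ ?_ (J.sub_mem (hleft v hv x hx) (J.smul_mem (s : k) (hright v hv x hx))) ?_ rfl
    · rw [← hn, ← Finset.card_map (addLeftEmbedding v) (s := (coeff x).support)]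
      refine Finset.card_lt_card
        ((Finset.ssubset_iff_of_subset fun l hl => ?_).2 ⟨v + g, ?_, ?_⟩)
      · obtain ⟨l, rfl⟩ : ∃ l', l = v + l' := ⟨l - v, (add_sub_cancel v l).symm⟩
        rw [Finsupp.mem_support_iff, coeff_twisted_commutator] at hl
        exact Finset.mem_map_of_mem _ (Finsupp.mem_support_iff.2 (right_ne_zero_of_mul hl))
      · exact Finset.mem_map_of_mem _ hg
      · rw [Finsupp.notMem_support_iff, coeff_twisted_commutator, hs, ← toMul_add,
          sub_add_cancel, sub_self, zero_mul]
    · intro hzero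
      have e := coeff_twisted_commutator s v h x
      rw [hzero, map_zero, Finsupp.zero_apply, zero_eq_mul, sub_eq_zero, hs, ← toMul_add] at e
      have e' := Additive.toMul.injective
        (Units.ext (e.resolve_right (Finsupp.mem_support_iff.1 hh)))
      refine hvne ?_
      rw [map_sub, e', map_sub, AddMonoidHom.sub_apply]
      abel

end AddCommGroup

end TwistedMonoidAlgebra

/-! ### Commutation up to a scalar -/

/-- The elements `x` and `y` commute up to the scalar `s`: `x * y = s • (y * x)`. -/
def QComm {k A : Type*} [Field k] [Ring A] [Algebra k A] (s : k) (x y : A) : Prop :=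
  x * y = s • (y * x)

namespace QComm

variable {k A B : Type*} [Field k] [Ring A] [Algebra k A] [Ring B] [Algebra k B] {s t : k}
  {x y z x' y' : A}

theorem eq (h : QComm s x y) : x * y = s • (y * x) := h

theorem congr (h : QComm s x y) (e : s = t) : QComm t x y := e ▸ h

theorem refl (x : A) : QComm (1 : k) x x := (one_smul k _).symm

theorem of_commute (h : Commute x y) : QComm (1 : k) x y := by rw [QComm, one_smul, h.eq]

theorem map (f : A →ₐ[k] B) (h : QComm s x y) : QComm s (f x) (f y) := by
  rw [QComm, ← map_mul, h.eq, map_smul, map_mul]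

theorem symm (hs : s ≠ 0) (h : QComm s x y) : QComm s⁻¹ y x := by
  rw [QComm, h.eq, smul_smul, inv_mul_cancel₀ hs, one_smul]

theorem mul_left (hx : QComm s x z) (hy : QComm t y z) : QComm (s * t) (x * y) z := by
  rw [QComm, mul_assoc, hy.eq, mul_smul_comm, ← mul_assoc, hx.eq, smul_mul_assoc, smul_smul,
    mul_comm t s, mul_assoc]

theorem mul_right (hy : QComm s x y) (hz : QComm t x z) : QComm (s * t) x (y * z) := by
  rw [QComm, ← mul_assoc, hy.eq, smul_mul_assoc, mul_assoc, hz.eq, mul_smul_comm, smul_smul,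
    ← mul_assoc]

theorem inv_left (hs : s ≠ 0) (h : x * x' = 1) (h' : x' * x = 1) (hxy : QComm s x y) :
    QComm s⁻¹ x' y :=
  calc x' * y = x' * (y * x) * x' := by rw [mul_assoc, mul_assoc y, h, mul_one]
    _ = s⁻¹ • (y * x') := by
      rw [(hxy.symm hs).eq, mul_smul_comm, smul_mul_assoc, ← mul_assoc, h', one_mul]

theorem inv_right (hs : s ≠ 0) (h : y * y' = 1) (h' : y' * y = 1) (hxy : QComm s x y) :
    QComm s⁻¹ x y' := by
  simpa using ((hxy.symm hs).inv_left (inv_ne_zero hs) h h').symm (inv_ne_zero (inv_ne_zero hs))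

theorem smul_left (r : k) (h : QComm s x y) : QComm s (r • x) y := by
  rw [QComm, smul_mul_assoc, h.eq, mul_smul_comm, smul_comm]

theorem smul_right (r : k) (h : QComm s x y) : QComm s x (r • y) := by
  rw [QComm, smul_mul_assoc, mul_smul_comm, h.eq, smul_comm]

theorem add_left (hx : QComm s x z) (hy : QComm s y z) : QComm s (x + y) z := by
  rw [QComm, add_mul, mul_add, hx.eq, hy.eq, smul_add]

theorem sub_left (hx : QComm s x z) (hy : QComm s y z) : QComm s (x - y) z := by
  rw [sub_eq_add_neg, ← neg_one_smul k y]
  exact hx.add_left (hy.smul_left _)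

theorem add_right (hy : QComm s x y) (hz : QComm s x z) : QComm s x (y + z) := by
  rw [QComm, add_mul, mul_add, hy.eq, hz.eq, smul_add]

end QComm

/-! ### Quantum polynomial algebras and quantum tori -/

namespace QuantumPolynomial

variable {k : Type*} [Field k] {n : ℕ} {Q : Matrix (Fin n) (Fin n) k} {r : ℕ}
  {A : Type*} [Ring A] [Algebra k A]

/-- The projection from the free algebra. -/
def mk (Q : Matrix (Fin n) (Fin n) k) (r : ℕ) :
    FreeAlgebra k (Fin n ⊕ {i : Fin n // i.val < r}) →ₐ[k] QuantumPolynomial Q r :=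
  RingQuot.mkAlgHom k (Rel Q r)

theorem mk_rel {x y : FreeAlgebra k (Fin n ⊕ {i : Fin n // i.val < r})} (h : Rel Q r x y) :
    mk Q r x = mk Q r y := RingQuot.mkAlgHom_rel k h

theorem qcomm_X (i j : Fin n) : QComm (Q i j) (X Q r i) (X Q r j) := by
  have := mk_rel (Rel.comm (Q := Q) (r := r) i j)
  rwa [map_mul, map_smul, map_mul] at this

theorem X_mul_Xinv (i : Fin n) (hi : i.val < r) : X Q r i * Xinv Q r i hi = 1 := by
  have := mk_rel (Rel.mul_inv (Q := Q) (r := r) ⟨i, hi⟩)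
  rwa [map_mul, map_one] at this

theorem Xinv_mul_X (i : Fin n) (hi : i.val < r) : Xinv Q r i hi * X Q r i = 1 := by
  have := mk_rel (Rel.inv_mul (Q := Q) (r := r) ⟨i, hi⟩)
  rwa [map_mul, map_one] at this

theorem isUnit_X (i : Fin n) (hi : i.val < r) : IsUnit (X Q r i) :=
  ⟨⟨_, _, X_mul_Xinv i hi, Xinv_mul_X i hi⟩, rfl⟩

theorem isUnit_Xinv (i : Fin n) (hi : i.val < r) : IsUnit (Xinv Q r i hi) :=
  isUnit_iff_exists.2 ⟨X Q r i, Xinv_mul_X i hi, X_mul_Xinv i hi⟩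

/-- The universal property of a quantum polynomial algebra. -/
noncomputable def lift (t : Fin n → A) (comm : ∀ i j, QComm (Q i j) (t i) (t j))
    (unit : ∀ i, i.val < r → IsUnit (t i)) : QuantumPolynomial Q r →ₐ[k] A :=
  RingQuot.liftAlgHom k ⟨FreeAlgebra.lift k (Sum.elim t fun i => Ring.inverse (t i.1)), by
    intro x y hxy
    cases hxy with
    | comm i j => simpa using (comm i j).eq
    | mul_inv i => simpa using Ring.mul_inverse_cancel _ (unit i.1 i.2)
    | inv_mul i => simpa using Ring.inverse_mul_cancel _ (unit i.1 i.2)⟩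

@[simp]
theorem lift_X (t : Fin n → A) (comm : ∀ i j, QComm (Q i j) (t i) (t j))
    (unit : ∀ i, i.val < r → IsUnit (t i)) (i : Fin n) : lift t comm unit (X Q r i) = t i :=
  (RingQuot.liftAlgHom_mkAlgHom_apply k _ _ _).trans (FreeAlgebra.lift_ι_apply _ _)

theorem map_Xinv (f : QuantumPolynomial Q r →ₐ[k] A) {i : Fin n} (hi : i.val < r) {z : A}
    (hz : z * f (X Q r i) = 1) : f (Xinv Q r i hi) = z :=
  (left_inv_eq_right_inv hz (by rw [← map_mul, X_mul_Xinv, map_one])).symm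

@[elab_as_elim]
theorem induction {p : QuantumPolynomial Q r → Prop} (x : QuantumPolynomial Q r)
    (algebraMap : ∀ s, p (algebraMap k _ s)) (X : ∀ i, p (X Q r i))
    (Xinv : ∀ i hi, p (Xinv Q r i hi)) (add : ∀ x y, p x → p y → p (x + y))
    (mul : ∀ x y, p x → p y → p (x * y)) : p x := by
  obtain ⟨y, rfl⟩ : ∃ y, mk Q r y = x := RingQuot.mkAlgHom_surjective k (Rel Q r) x
  induction y using FreeAlgebra.induction with
  | grade0 s => rw [AlgHom.commutes]; exact algebraMap s
  | grade1 g =>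
    rcases g with i | ⟨i, hi⟩
    · exact X i
    · exact Xinv i hi
  | mul x y hx hy => rw [map_mul]; exact mul _ _ hx hy
  | add x y hx hy => rw [map_add]; exact add _ _ hx hy

theorem semiconj_of_X {f g : QuantumPolynomial Q r →ₐ[k] A} {z : A}
    (h : ∀ i, z * f (X Q r i) = g (X Q r i) * z) (x : QuantumPolynomial Q r) :
    z * f x = g x * z := by
  induction x using induction with
  | algebraMap s => rw [AlgHom.commutes, AlgHom.commutes, Algebra.commutes]
  | X i => exact h i
  | Xinv i hi =>
    calc z * f (Xinv Q r i hi)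
        = g (Xinv Q r i hi) * (g (X Q r i) * z) * f (Xinv Q r i hi) := by
          rw [← mul_assoc (g _), ← map_mul, Xinv_mul_X, map_one, one_mul]
      _ = g (Xinv Q r i hi) * z := by
          rw [← h, mul_assoc, mul_assoc, ← map_mul, X_mul_Xinv, map_one, mul_one]
  | add x y hx hy => rw [map_add, map_add, mul_add, add_mul, hx, hy]
  | mul x y hx hy => rw [map_mul, map_mul, ← mul_assoc, hx, mul_assoc, hy, mul_assoc]

theorem algHom_ext {f g : QuantumPolynomial Q r →ₐ[k] A}
    (h : ∀ i, f (X Q r i) = g (X Q r i)) : f = g :=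
  AlgHom.ext fun x => by
    simpa using semiconj_of_X (f := f) (g := g) (z := 1) (fun i => by rw [h, one_mul, mul_one]) x

/-- The homomorphism that multiplies the indeterminates by scalars. -/
noncomputable def scaleHom (w : Fin n → kˣ) : QuantumPolynomial Q r →ₐ[k] QuantumPolynomial Q r :=
  lift (fun i => (w i : k) • X Q r i) (fun i j => ((qcomm_X i j).smul_left _).smul_right _)
    fun i hi => (isUnit_X i hi).smul (w i)

/-- The automorphism that multiplies the indeterminates by scalars. -/
noncomputable def scale (w : Fin n → kˣ) : QuantumPolynomial Q r ≃ₐ[k] QuantumPolynomial Q r :=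
  AlgEquiv.ofAlgHom (scaleHom w) (scaleHom w⁻¹)
    (algHom_ext fun i => by simp [scaleHom, smul_smul])
    (algHom_ext fun i => by simp [scaleHom, smul_smul])

@[simp]
theorem scale_X (w : Fin n → kˣ) (i : Fin n) : scale w (X Q r i) = (w i : k) • X Q r i :=
  lift_X _ _ _ i

theorem scale_Xinv (w : Fin n → kˣ) {i : Fin n} (hi : i.val < r) :
    scale w (Xinv Q r i hi) = (w i : k)⁻¹ • Xinv Q r i hi :=
  map_Xinv (scaleHom w) hi <| by
    rw [scaleHom, lift_X, smul_mul_smul_comm, Xinv_mul_X, inv_mul_cancel₀ (Units.ne_zero _),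
      one_smul]

/-- The generators of a quantum polynomial algebra, as symbols. -/
inductive Letter (n r : ℕ) : Type
  | X (i : Fin n) : Letter n r
  | Xinv (i : Fin n) (hi : i.val < r) : Letter n r
  deriving DecidableEq

/-- The generator that a symbol stands for. -/
def letter (Q : Matrix (Fin n) (Fin n) k) : Letter n r → QuantumPolynomial Q r
  | .X i => X Q r i
  | .Xinv i hi => Xinv Q r i hi

/-- The product of a list of generators. -/
def word (Q : Matrix (Fin n) (Fin n) k) (l : List (Letter n r)) : QuantumPolynomial Q r :=
  (l.map (letter Q)).prod

theorem word_cons (z : Letter n r) (l : List (Letter n r)) :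
    word Q (z :: l) = letter Q z * word Q l := List.prod_cons

theorem word_append (l l' : List (Letter n r)) : word Q (l ++ l') = word Q l * word Q l' := by
  simp [word]

/-- The multidegree of a generator. -/
def letterDegree : Letter n r → Fin n → ℤ
  | .X i => Pi.single i 1
  | .Xinv i _ => -Pi.single i 1

/-- The multidegree of a word. -/
def wordDegree (l : List (Letter n r)) : Fin n → ℤ := (l.map letterDegree).sum

theorem wordDegree_cons (z : Letter n r) (l : List (Letter n r)) :
    wordDegree (z :: l) = letterDegree z + wordDegree l := List.sum_cons

theorem adjoin_range_letter : Algebra.adjoin k (Set.range (letter (r := r) Q)) = ⊤ := by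
  rw [eq_top_iff]
  rintro x -
  induction x using induction with
  | algebraMap s => exact Subalgebra.algebraMap_mem _ s
  | X i => exact Algebra.subset_adjoin ⟨.X i, rfl⟩
  | Xinv i hi => exact Algebra.subset_adjoin ⟨.Xinv i hi, rfl⟩
  | add x y hx hy => exact add_mem hx hy
  | mul x y hx hy => exact mul_mem hx hy

theorem span_range_word : Submodule.span k (Set.range (word (r := r) Q)) = ⊤ := by
  rw [← Algebra.top_toSubmodule, ← adjoin_range_letter, Algebra.adjoin_eq_span]
  congr 1
  ext x
  refine ⟨?_, fun hx => ?_⟩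
  · rintro ⟨l, rfl⟩
    refine list_prod_mem fun y hy => ?_
    obtain ⟨z, -, rfl⟩ := List.mem_map.1 hy
    exact Submonoid.subset_closure ⟨z, rfl⟩
  · induction hx using Submonoid.closure_induction_left with
    | one => exact ⟨[], rfl⟩
    | mul_left y hy x _ ih =>
      obtain ⟨z, rfl⟩ := hy
      obtain ⟨l, rfl⟩ := ih
      exact ⟨z :: l, word_cons z l⟩

theorem exists_qcomm_letter (hQ : ∀ i j, Q i j ≠ 0) (z z' : Letter n r) :
    ∃ s : kˣ, QComm (s : k) (letter Q z) (letter Q z') := by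
  have hX (i j : Fin n) := qcomm_X (Q := Q) (r := r) i j
  rcases z with i | ⟨i, hi⟩ <;> rcases z' with j | ⟨j, hj⟩
  · exact ⟨Units.mk0 _ (hQ i j), hX i j⟩
  · exact ⟨Units.mk0 _ (inv_ne_zero (hQ i j)),
      (hX i j).inv_right (hQ i j) (X_mul_Xinv j hj) (Xinv_mul_X j hj)⟩
  · exact ⟨Units.mk0 _ (inv_ne_zero (hQ i j)),
      (hX i j).inv_left (hQ i j) (X_mul_Xinv i hi) (Xinv_mul_X i hi)⟩
  · exact ⟨Units.mk0 _ (inv_ne_zero (inv_ne_zero (hQ i j))),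
      ((hX i j).inv_left (hQ i j) (X_mul_Xinv i hi) (Xinv_mul_X i hi)).inv_right
        (inv_ne_zero (hQ i j)) (X_mul_Xinv j hj) (Xinv_mul_X j hj)⟩

theorem exists_word_eq_smul_of_perm (hQ : ∀ i j, Q i j ≠ 0) {l l' : List (Letter n r)}
    (h : l.Perm l') : ∃ s : kˣ, word Q l = s • word Q l' := by
  induction h with
  | nil => exact ⟨1, (one_smul _ _).symm⟩
  | cons z _ ih =>
    obtain ⟨s, hs⟩ := ih
    exact ⟨s, by rw [word_cons, hs, mul_smul_comm, word_cons]⟩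
  | swap z z' l =>
    obtain ⟨s, hs⟩ := exists_qcomm_letter hQ z' z
    refine ⟨s, ?_⟩
    simp only [word_cons, ← mul_assoc, hs.eq, smul_mul_assoc, Units.smul_def]
  | trans _ _ ih ih' =>
    obtain ⟨s, hs⟩ := ih
    obtain ⟨s', hs'⟩ := ih'
    exact ⟨s * s', by rw [hs, hs', mul_smul]⟩

/-- The word with a factor `X i * (X i)⁻¹` for each letter `(X i)⁻¹` of a given word. -/
def cancellingWord (l : List (Letter n r)) : List (Letter n r) :=
  l.flatMap fun
    | .X _ => []
    | .Xinv i hi => [.X i, .Xinv i hi]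

theorem word_cancellingWord (l : List (Letter n r)) : word Q (cancellingWord l) = 1 := by
  induction l with
  | nil => rfl
  | cons z l ih =>
    rw [cancellingWord, List.flatMap_cons, word_append, ← cancellingWord, ih, mul_one]
    rcases z with i | ⟨i, hi⟩
    · rfl
    · simp [word, letter, X_mul_Xinv]

theorem count_X_sub_count_cancellingWord (l : List (Letter n r)) (i : Fin n) :
    (l.count (.X i) : ℤ) - (cancellingWord l).count (.X i) = wordDegree l i := by
  induction l with
  | nil => rfl
  | cons z l ih =>
    rw [wordDegree_cons, Pi.add_apply, ← ih]
    rcases z with j | ⟨j, hj⟩ <;>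
      simp [cancellingWord, letterDegree, List.count_cons, Pi.single_apply, eq_comm (a := i)] <;>
      ring

theorem count_Xinv_cancellingWord (l : List (Letter n r)) (i : Fin n) (hi : i.val < r) :
    (cancellingWord l).count (.Xinv i hi) = l.count (.Xinv i hi) := by
  induction l with
  | nil => rfl
  | cons z l ih =>
    rw [cancellingWord, List.flatMap_cons, List.count_append, ← cancellingWord, ih]
    rcases z with j | ⟨j, hj⟩ <;> simp [List.count_cons, add_comm]

/- Completed by the cancelling word of the other, two words of equal degree are permutations of
each other. -/
theorem exists_word_eq_smul_of_wordDegree_eq (hQ : ∀ i j, Q i j ≠ 0) {l l' : List (Letter n r)}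
    (h : wordDegree l = wordDegree l') : ∃ s : kˣ, word Q l = s • word Q l' := by
  have hperm : (l ++ cancellingWord l').Perm (l' ++ cancellingWord l) := by
    refine List.perm_iff_count.2 fun z => ?_
    rw [List.count_append, List.count_append]
    rcases z with i | ⟨i, hi⟩
    · have hl := count_X_sub_count_cancellingWord l i
      have hl' := count_X_sub_count_cancellingWord l' i
      rw [h] at hl
      omega
    · rw [count_Xinv_cancellingWord, count_Xinv_cancellingWord, add_comm]
  simpa only [word_append, word_cancellingWord, mul_one] using
    exists_word_eq_smul_of_perm hQ hperm

variable {G : Type*} [AddCommMonoid G] {χ : G →+ G →+ Additive kˣ}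
  {f : QuantumPolynomial Q r →ₐ[k] TwistedMonoidAlgebra χ} {v : Fin n → G} {D : G →+ Fin n → ℤ}

theorem map_Xinv_eq_single (hf : ∀ i, f (X Q r i) = .single (v i) 1) {i : Fin n}
    (hi : i.val < r) {u : AddUnits G} (hu : u = v i) : f (Xinv Q r i hi) =
      .single (-u : AddUnits G) ((χ (-u : AddUnits G) u).toMul⁻¹ : kˣ) :=
  map_Xinv f hi <| by
    rw [hf, TwistedMonoidAlgebra.single_mul_single, ← hu, AddUnits.neg_add, mul_one,
      Units.inv_mul, TwistedMonoidAlgebra.one_def]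

theorem map_mem_homogeneousSubmodule_zero (hf : ∀ i, f (X Q r i) = .single (v i) 1)
    (hv : ∀ i, i.val < r → IsAddUnit (v i)) {δ : G →+ ℤ} (hδ : ∀ i, δ (v i) = 0)
    (x : QuantumPolynomial Q r) : f x ∈ TwistedMonoidAlgebra.homogeneousSubmodule χ δ 0 := by
  have hmem {g : G} (t : k) (hg : δ g = 0) :
      .single g t ∈ TwistedMonoidAlgebra.homogeneousSubmodule χ δ 0 :=
    hg ▸ TwistedMonoidAlgebra.single_mem_homogeneousSubmodule δ g t
  induction x using induction with
  | algebraMap s =>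
    rw [AlgHom.commutes, Algebra.algebraMap_eq_smul_one]
    exact Submodule.smul_mem _ s (SetLike.GradedOne.one_mem)
  | X i => exact hf i ▸ hmem 1 (hδ i)
  | Xinv i hi =>
    obtain ⟨u, hu⟩ := hv i hi
    rw [map_Xinv_eq_single hf hi hu]
    have hneg := map_add δ (-u : AddUnits G).val u.val
    rw [AddUnits.neg_add, hu, hδ, add_zero, map_zero] at hneg
    exact hmem _ hneg.symm
  | add x y hx hy => exact map_add f x y ▸ add_mem hx hy
  | mul x y hx hy =>
    simpa only [map_mul, add_zero] using SetLike.mul_mem_graded hx hy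

theorem exists_map_letter_eq_single (hf : ∀ i, f (X Q r i) = .single (v i) 1)
    (hv : ∀ i, i.val < r → IsAddUnit (v i)) (hD : ∀ i, D (v i) = Pi.single i 1)
    (z : Letter n r) :
    ∃ (g : G) (s : kˣ), f (letter Q z) = .single g (s : k) ∧ D g = letterDegree z := by
  rcases z with i | ⟨i, hi⟩
  · exact ⟨v i, 1, hf i, hD i⟩
  · obtain ⟨u, hu⟩ := hv i hi
    refine ⟨(-u : AddUnits G), (χ (-u : AddUnits G) u).toMul⁻¹, map_Xinv_eq_single hf hi hu, ?_⟩
    refine eq_neg_of_add_eq_zero_left ?_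
    rw [← hD, ← map_add, ← hu, AddUnits.neg_add, map_zero]

theorem exists_map_word_eq_single (hf : ∀ i, f (X Q r i) = .single (v i) 1)
    (hv : ∀ i, i.val < r → IsAddUnit (v i)) (hD : ∀ i, D (v i) = Pi.single i 1)
    (l : List (Letter n r)) :
    ∃ (g : G) (s : kˣ), f (word Q l) = .single g (s : k) ∧ D g = wordDegree l := by
  induction l with
  | nil => exact ⟨0, 1, map_one f, map_zero D⟩
  | cons z l ih =>
    obtain ⟨g, s, hg, hDg⟩ := exists_map_letter_eq_single hf hv hD z
    obtain ⟨h, t, hh, hDh⟩ := ih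
    refine ⟨g + h, s * t * (χ g h).toMul, ?_, ?_⟩
    · rw [word_cons, map_mul, hg, hh, TwistedMonoidAlgebra.single_mul_single, Units.val_mul,
        Units.val_mul]
    · rw [map_add, hDg, hDh, wordDegree_cons]

/- One word for each degree suffices to span, and `f` maps these words to multiples of distinct
monomials. -/
theorem injective_of_map_X_eq_single (hQ : ∀ i j, Q i j ≠ 0)
    (hf : ∀ i, f (X Q r i) = .single (v i) 1) (hv : ∀ i, i.val < r → IsAddUnit (v i))
    (hD : ∀ i, D (v i) = Pi.single i 1) : Function.Injective f := by
  choose g s hg hDg using exists_map_word_eq_single hf hv hD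
  choose l hl using fun d : Set.range (wordDegree (n := n) (r := r)) => d.2
  have hspan : Submodule.span k (Set.range fun d => word Q (l d)) = ⊤ := by
    rw [eq_top_iff, ← span_range_word, Submodule.span_le]
    rintro _ ⟨l', rfl⟩
    obtain ⟨t, ht⟩ := exists_word_eq_smul_of_wordDegree_eq hQ (hl ⟨wordDegree l', l', rfl⟩).symm
    rw [SetLike.mem_coe, ht, Units.smul_def]
    exact Submodule.smul_mem _ _ (Submodule.subset_span ⟨_, rfl⟩)
  have hindep : LinearIndependent k fun d => f (word Q (l d)) := by
    have hinj : Function.Injective fun d => g (l d) := fun d e hde =>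
      Subtype.ext (by rw [← hl d, ← hl e, ← hDg, ← hDg]; exact congrArg D hde)
    have heq : (fun d => f (word Q (l d))) =
        (fun d => s (l d)) • fun d => (.single (g (l d)) 1 : TwistedMonoidAlgebra χ) :=
      funext fun d => by
        rw [hg, Pi.smul_apply', Units.smul_def, TwistedMonoidAlgebra.smul_single, mul_one]
    rw [heq]
    exact (TwistedMonoidAlgebra.linearIndependent_single.comp _ hinj).units_smul _
  refine (injective_iff_map_eq_zero f).2 fun x hx => ?_
  obtain ⟨c, rfl⟩ := (Finsupp.mem_span_range_iff_exists_finsupp).1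
    (hspan.symm ▸ Submodule.mem_top : x ∈ Submodule.span k (Set.range fun d => word Q (l d)))
  have hc : Finsupp.linearCombination k (fun d => f (word Q (l d))) c = 0 := by
    simpa [Finsupp.linearCombination_apply, Finsupp.sum] using hx
  rw [linearIndependent_iff.1 hindep c hc, Finsupp.sum_zero_index]

end QuantumPolynomial

/-! ### Generalized generalized Weyl algebras -/

theorem injective_of_iSup_eq_top_of_iSupIndep {ι k M N : Type*} [Ring k] [AddCommGroup M]
    [Module k M] [AddCommGroup N] [Module k N] {p : ι → Submodule k M} {p' : ι → Submodule k N}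
    (hp : ⨆ i, p i = ⊤) (hp' : iSupIndep p') (f : M →ₗ[k] N)
    (hf : ∀ i, ∀ x ∈ p i, f x ∈ p' i) (hinj : ∀ i, ∀ x ∈ p i, f x = 0 → x = 0) :
    Function.Injective f := by
  refine (injective_iff_map_eq_zero f).2 fun x hx => ?_
  obtain ⟨y, hy, rfl⟩ := (Submodule.mem_iSup_iff_exists_finsupp p x).1 (hp ▸ Submodule.mem_top)
  rw [Finsupp.sum, map_sum] at hx
  have hzero := (iSupIndep_iff_finsetSum_eq_zero_imp_eq_zero p').1 hp' y.support (fun i => f (y i))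
    (fun i _ => hf i _ (hy i)) hx
  exact Finset.sum_eq_zero fun i hi => hinj i _ (hy i) (hzero i hi)

namespace GGWA

variable {k R A S : Type*} [CommRing k] [Ring R] [Algebra k R] [Ring A] [Algebra k A] [Ring S]
  [Algebra k S]

/-- The defining relations of a GGWA, for elements `X` and `Y` of an algebra to which the base ring
maps by `g`. -/
structure IsRealization (σ τ : R →ₐ[k] R) (a : R) (g : R →ₐ[k] A) (X Y : A) : Prop where
  x_mul : ∀ r, X * g r = g (σ r) * X
  y_mul : ∀ r, Y * g r = g (τ r) * Y
  y_mul_x : Y * X = g a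
  x_mul_y : X * Y = g (σ a)

variable {σ τ : R →ₐ[k] R} {a : R}

theorem IsRealization.isGGWADatum [NoZeroDivisors A] {g : R →ₐ[k] A} {X Y : A}
    (h : IsRealization σ τ a g X Y) (hg : Function.Injective g) (hY : Y ≠ 0) :
    IsGGWADatum σ τ a where
  apply_eq := hg <| mul_right_cancel₀ hY <| by
    rw [← h.y_mul, ← h.x_mul_y, ← h.y_mul_x, mul_assoc]
  mul_eq r := hg <| by
    rw [map_mul, map_mul, ← h.y_mul_x, mul_assoc, h.x_mul, ← mul_assoc, h.y_mul, mul_assoc]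
  map_mul_eq r := hg <| by
    rw [map_mul, map_mul, ← h.x_mul_y, mul_assoc, h.y_mul, ← mul_assoc, h.x_mul, mul_assoc]

/-- The projection from the free algebra. -/
def mk (σ τ : R →ₐ[k] R) (a : R) : FreeAlgebra k (R ⊕ Bool) →ₐ[k] GGWA σ τ a :=
  RingQuot.mkAlgHom k (Rel σ τ a)

theorem mk_rel {z w : FreeAlgebra k (R ⊕ Bool)} (h : Rel σ τ a z w) : mk σ τ a z = mk σ τ a w :=
  RingQuot.mkAlgHom_rel k h

/-- The homomorphism from the base ring. -/
def ofHom (σ τ : R →ₐ[k] R) (a : R) : R →ₐ[k] GGWA σ τ a :=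
  have hscalar (t : k) : of σ τ a (algebraMap k R t) = algebraMap k _ t :=
    (mk_rel (.of_scalar t)).trans ((mk σ τ a).commutes t)
  { toFun := of σ τ a
    map_one' := by simpa only [map_one] using hscalar 1
    map_zero' := by simpa only [map_zero] using hscalar 0
    map_mul' := fun r s => (mk_rel (.of_mul r s)).trans (map_mul (mk σ τ a) _ _)
    map_add' := fun r s => (mk_rel (.of_add r s)).trans (map_add (mk σ τ a) _ _)
    commutes' := hscalar }

theorem isRealization : IsRealization σ τ a (ofHom σ τ a) (x σ τ a) (y σ τ a) where
  x_mul r := by have := mk_rel (.x_mul (σ := σ) (τ := τ) (a := a) r); rwa [map_mul, map_mul] at this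
  y_mul r := by have := mk_rel (.y_mul (σ := σ) (τ := τ) (a := a) r); rwa [map_mul, map_mul] at this
  y_mul_x := by have := mk_rel (.y_mul_x (σ := σ) (τ := τ) (a := a)); rwa [map_mul] at this
  x_mul_y := by have := mk_rel (.x_mul_y (σ := σ) (τ := τ) (a := a)); rwa [map_mul] at this

@[elab_as_elim]
theorem induction {p : GGWA σ τ a → Prop} (z : GGWA σ τ a) (of : ∀ r, p (ofHom σ τ a r))
    (x : p (x σ τ a)) (y : p (y σ τ a)) (add : ∀ z w, p z → p w → p (z + w))
    (mul : ∀ z w, p z → p w → p (z * w)) : p z := by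
  obtain ⟨z, rfl⟩ : ∃ w, mk σ τ a w = z := RingQuot.mkAlgHom_surjective k (Rel σ τ a) z
  induction z using FreeAlgebra.induction with
  | grade0 t => rw [AlgHom.commutes, ← (ofHom σ τ a).commutes]; exact of _
  | grade1 i =>
    rcases i with r | _ | _
    · exact of r
    · exact x
    · exact y
  | mul z w hz hw => rw [map_mul]; exact mul _ _ hz hw
  | add z w hz hw => rw [map_add]; exact add _ _ hz hw

/-- The power `x ^ d` for `0 ≤ d` and the power `y ^ (-d)` for `d < 0`. -/
def monomial (σ τ : R →ₐ[k] R) (a : R) : ℤ → GGWA σ τ a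
  | .ofNat n => x σ τ a ^ n
  | .negSucc n => y σ τ a ^ (n + 1)

theorem exists_x_mul_monomial (d : ℤ) :
    ∃ r, x σ τ a * monomial σ τ a d = ofHom σ τ a r * monomial σ τ a (d + 1) := by
  rcases d with n | _ | n
  · exact ⟨1, by rw [map_one, one_mul]; exact (pow_succ' _ n).symm⟩
  · exact ⟨σ a, by simp [monomial, isRealization.x_mul_y]⟩
  · refine ⟨σ a, ?_⟩
    rw [← isRealization.x_mul_y, mul_assoc]
    exact congrArg (x σ τ a * ·) (pow_succ' _ (n + 1))

theorem exists_y_mul_monomial (d : ℤ) :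
    ∃ r, y σ τ a * monomial σ τ a d = ofHom σ τ a r * monomial σ τ a (d - 1) := by
  rcases d with (_ | n) | n
  · exact ⟨1, by rw [show Int.ofNat 0 - 1 = Int.negSucc 0 from rfl]; simp [monomial]⟩
  · refine ⟨a, ?_⟩
    rw [← isRealization.y_mul_x, mul_assoc, show Int.ofNat (n + 1) - 1 = Int.ofNat n by simp]
    exact congrArg (y σ τ a * ·) (pow_succ' _ n)
  · exact ⟨1, by rw [map_one, one_mul]; exact (pow_succ' _ (n + 1)).symm⟩

/-- The left multiples of `monomial σ τ a d` by elements of the base ring. -/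
def component (σ τ : R →ₐ[k] R) (a : R) (d : ℤ) : Submodule k (GGWA σ τ a) :=
  LinearMap.range (LinearMap.mulRight k (monomial σ τ a d) ∘ₗ (ofHom σ τ a).toLinearMap)

theorem of_mul_monomial_mem_iSup_component (r : R) (d : ℤ) :
    ofHom σ τ a r * monomial σ τ a d ∈ ⨆ e, component σ τ a e :=
  Submodule.mem_iSup_of_mem d ⟨r, rfl⟩

theorem mul_mem_iSup_component (z : GGWA σ τ a) :
    ∀ w ∈ ⨆ d, component σ τ a d, z * w ∈ ⨆ d, component σ τ a d := by
  have hgen (z : GGWA σ τ a)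
      (h : ∀ r d, z * (ofHom σ τ a r * monomial σ τ a d) ∈ ⨆ d, component σ τ a d) :
      ∀ w ∈ ⨆ d, component σ τ a d, z * w ∈ ⨆ d, component σ τ a d := by
    intro w hw
    refine Submodule.iSup_induction (component σ τ a)
      (motive := fun w => z * w ∈ ⨆ d, component σ τ a d) hw ?_ ?_ fun w w' hw hw' => ?_
    · rintro d _ ⟨r, rfl⟩
      exact h r d
    · rw [mul_zero]
      exact zero_mem _
    · rw [mul_add]
      exact add_mem hw hw'
  induction z using induction with
  | of s =>
    refine hgen _ fun r d => ?_
    rw [← mul_assoc, ← map_mul]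
    exact of_mul_monomial_mem_iSup_component _ d
  | x =>
    refine hgen _ fun r d => ?_
    obtain ⟨s, hs⟩ := exists_x_mul_monomial (σ := σ) (τ := τ) (a := a) d
    rw [← mul_assoc, isRealization.x_mul, mul_assoc, hs, ← mul_assoc, ← map_mul]
    exact of_mul_monomial_mem_iSup_component _ _
  | y =>
    refine hgen _ fun r d => ?_
    obtain ⟨s, hs⟩ := exists_y_mul_monomial (σ := σ) (τ := τ) (a := a) d
    rw [← mul_assoc, isRealization.y_mul, mul_assoc, hs, ← mul_assoc, ← map_mul]
    exact of_mul_monomial_mem_iSup_component _ _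
  | add z z' hz hz' =>
    intro w hw
    rw [add_mul]
    exact add_mem (hz w hw) (hz' w hw)
  | mul z z' hz hz' =>
    intro w hw
    rw [mul_assoc]
    exact hz _ (hz' w hw)

theorem iSup_component_eq_top : ⨆ d, component σ τ a d = ⊤ := by
  refine eq_top_iff.2 fun z _ => ?_
  rw [← mul_one z]
  exact mul_mem_iSup_component z 1
    (by simpa [monomial] using of_mul_monomial_mem_iSup_component (σ := σ) (τ := τ) (a := a) 1 0)

theorem injective_of_graded [NoZeroDivisors S] {𝒜 : ℤ → Submodule k S} [SetLike.GradedMonoid 𝒜]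
    (h𝒜 : iSupIndep 𝒜) {f : GGWA σ τ a →ₐ[k] S}
    (hf : Function.Injective (f.comp (ofHom σ τ a))) (hof : ∀ r, f (ofHom σ τ a r) ∈ 𝒜 0)
    (hx : f (x σ τ a) ∈ 𝒜 1) (hx0 : f (x σ τ a) ≠ 0)
    (hy : f (y σ τ a) ∈ 𝒜 (-1)) (hy0 : f (y σ τ a) ≠ 0) : Function.Injective f := by
  have hmono (d : ℤ) : f (monomial σ τ a d) ∈ 𝒜 d ∧ f (monomial σ τ a d) ≠ 0 := by
    have : Nontrivial S := ⟨_, 0, hx0⟩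
    rcases d with n | n
    · refine ⟨?_, ?_⟩ <;> rw [monomial, map_pow]
      · simpa using SetLike.pow_mem_graded n hx
      · exact pow_ne_zero n hx0
    · refine ⟨?_, ?_⟩ <;> rw [monomial, map_pow]
      · simpa [Int.negSucc_eq] using SetLike.pow_mem_graded (n + 1) hy
      · exact pow_ne_zero (n + 1) hy0
  refine injective_of_iSup_eq_top_of_iSupIndep iSup_component_eq_top h𝒜 f.toLinearMap ?_ ?_
  · rintro d _ ⟨r, rfl⟩
    simpa using SetLike.mul_mem_graded (hof r) (hmono d).1
  · rintro d _ ⟨r, rfl⟩ h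
    have hr : f (ofHom σ τ a r) * f (monomial σ τ a d) = 0 := by simpa using h
    have hr0 : r = 0 :=
      hf (by simpa using (mul_eq_zero.1 hr).resolve_right (hmono d).2)
    simp [hr0]

namespace IsRealization

variable {g : R →ₐ[k] A} {X Y : A} (h : IsRealization σ τ a g X Y)

/-- The universal property of a GGWA. -/
def lift : GGWA σ τ a →ₐ[k] A :=
  RingQuot.liftAlgHom k ⟨FreeAlgebra.lift k (Sum.elim g fun i => bif i then Y else X), by
    intro z w hzw
    cases hzw with
    | of_scalar t => simp
    | of_add r s => simp
    | of_mul r s => simp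
    | x_mul r => simpa using h.x_mul r
    | y_mul r => simpa using h.y_mul r
    | y_mul_x => simpa using h.y_mul_x
    | x_mul_y => simpa using h.x_mul_y⟩

theorem lift_of (r : R) : h.lift (ofHom σ τ a r) = g r :=
  (RingQuot.liftAlgHom_mkAlgHom_apply k _ _ _).trans (FreeAlgebra.lift_ι_apply _ _)

theorem lift_x : h.lift (x σ τ a) = X :=
  (RingQuot.liftAlgHom_mkAlgHom_apply k _ _ _).trans (FreeAlgebra.lift_ι_apply _ _)

theorem lift_y : h.lift (y σ τ a) = Y :=
  (RingQuot.liftAlgHom_mkAlgHom_apply k _ _ _).trans (FreeAlgebra.lift_ι_apply _ _)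

theorem lift_surjective (hA : Algebra.adjoin k (Set.range g ∪ {X, Y}) = ⊤) :
    Function.Surjective h.lift := by
  rw [← AlgHom.range_eq_top, eq_top_iff, ← hA, Algebra.adjoin_le_iff]
  rintro _ (⟨r, rfl⟩ | rfl | rfl)
  · exact ⟨_, h.lift_of r⟩
  · exact ⟨_, h.lift_x⟩
  · exact ⟨_, h.lift_y⟩

theorem injective_of_graded [NoZeroDivisors S] {𝒜 : ℤ → Submodule k S} [SetLike.GradedMonoid 𝒜]
    (h𝒜 : iSupIndep 𝒜) {f : A →ₐ[k] S} (hA : Algebra.adjoin k (Set.range g ∪ {X, Y}) = ⊤)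
    (hf : Function.Injective (f.comp g)) (hg : ∀ r, f (g r) ∈ 𝒜 0) (hX : f X ∈ 𝒜 1)
    (hX0 : f X ≠ 0) (hY : f Y ∈ 𝒜 (-1)) (hY0 : f Y ≠ 0) :
    Function.Injective f ∧ Function.Injective h.lift := by
  have hcomp : Function.Injective (f.comp h.lift) := by
    refine GGWA.injective_of_graded h𝒜 ?_ ?_ ?_ ?_ ?_ ?_
    · rwa [AlgHom.comp_assoc, show h.lift.comp (ofHom σ τ a) = g from AlgHom.ext h.lift_of]
    all_goals simpa only [AlgHom.comp_apply, lift_of, lift_x, lift_y]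
  rw [AlgHom.coe_comp] at hcomp
  exact ⟨hcomp.of_comp_right (h.lift_surjective hA), hcomp.of_comp⟩

theorem exists_algEquiv (hinj : Function.Injective h.lift)
    (hA : Algebra.adjoin k (Set.range g ∪ {X, Y}) = ⊤) :
    ∃ e : A ≃ₐ[k] GGWA σ τ a, (∀ r, e (g r) = of σ τ a r) ∧ e X = x σ τ a ∧ e Y = y σ τ a := by
  refine ⟨(AlgEquiv.ofBijective h.lift ⟨hinj, h.lift_surjective hA⟩).symm, fun r => ?_, ?_, ?_⟩
  · exact (AlgEquiv.symm_apply_eq _).2 (h.lift_of r).symm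
  · exact (AlgEquiv.symm_apply_eq _).2 h.lift_x.symm
  · exact (AlgEquiv.symm_apply_eq _).2 h.lift_y.symm

end IsRealization

end GGWA

/-! ### Simplicity and centres of subalgebras of quantum tori -/

theorem qWeyl_mul_pow_succ {k A : Type*} [CommRing k] [Ring A] [Algebra k A] {s t : k} {x y u : A}
    (hxy : x * y = s • (y * x) + u) (huy : u * y = t • (y * u)) (n : ℕ) :
    x * y ^ (n + 1) = s ^ (n + 1) • (y ^ (n + 1) * x) +
      (∑ i ∈ Finset.range (n + 1), s ^ i * t ^ (n - i)) • (y ^ n * u) := by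
  induction n with
  | zero => simpa using hxy
  | succ n ih =>
    have hsum := geom_sum₂_succ_eq s t (n := n + 1)
    rw [add_tsub_cancel_right] at hsum
    have hleft : y ^ (n + 1) * x * y = s • (y ^ (n + 2) * x) + y ^ (n + 1) * u := by
      rw [mul_assoc, hxy, mul_add, mul_smul_comm, ← mul_assoc, ← pow_succ]
    have hright : y ^ n * u * y = t • (y ^ (n + 1) * u) := by
      rw [mul_assoc, huy, mul_smul_comm, ← mul_assoc, ← pow_succ]
    rw [pow_succ y (n + 1), ← mul_assoc, ih, add_mul, smul_mul_assoc, smul_mul_assoc, hleft,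
      hright, hsum, ← pow_succ]
    module

theorem one_mem_of_pow_mem {k A : Type*} [Field k] [Ring A] [Algebra k A] {s t : k} {x y u : A}
    (hxy : x * y = s • (y * x) + u) (huy : u * y = t • (y * u)) (hu : IsUnit u)
    (hst : ∀ n : ℕ, 0 < n → s ^ n ≠ t ^ n) {I : TwoSidedIdeal A} {n : ℕ} (hn : y ^ n ∈ I) :
    (1 : A) ∈ I := by
  have hsmul (r : k) {z : A} (hz : z ∈ I) : r • z ∈ I := by
    rw [Algebra.smul_def]
    exact I.mul_mem_left _ _ hz
  induction n with
  | zero => rwa [pow_zero] at hn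
  | succ n ih =>
    have hsum : ∑ i ∈ Finset.range (n + 1), s ^ i * t ^ (n - i) ≠ 0 := fun h0 =>
      hst (n + 1) n.succ_pos <| sub_eq_zero.1 <| by
        simpa only [add_tsub_cancel_right, h0, zero_mul, eq_comm] using geom_sum₂_mul s t (n + 1)
    have hyu : y ^ n * u ∈ I := by
      have := hsmul (∑ i ∈ Finset.range (n + 1), s ^ i * t ^ (n - i))⁻¹
        (I.sub_mem (I.mul_mem_left x _ hn) (hsmul (s ^ (n + 1)) (I.mul_mem_right _ x hn)))
      rwa [qWeyl_mul_pow_succ hxy huy, add_sub_cancel_left, inv_smul_smul₀ hsum] at this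
    obtain ⟨u, rfl⟩ := hu
    exact ih (by simpa [mul_assoc] using I.mul_mem_right _ ((u⁻¹ : Aˣ) : A) hyu)

namespace TwistedMonoidAlgebra

section Comap

variable {k G H : Type*} [Field k] [AddCommMonoid G] [AddCommMonoid H]

/-- The pullback of a bicharacter along a homomorphism. The twisted monoid algebra of its pullback
to `H × ℕ` is a polynomial algebra in one central variable. -/
def comap (χ : H →+ H →+ Additive kˣ) (p : G →+ H) : G →+ G →+ Additive kˣ := (χ.compl₂ p).comp p

@[simp]
theorem comap_apply (χ : H →+ H →+ Additive kˣ) (p : G →+ H) (g h : G) :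
    comap χ p g h = χ (p g) (p h) := rfl

end Comap

section Exponents

variable {k G : Type*} [Field k] [AddCommMonoid G] {χ : G →+ G →+ Additive kˣ}

theorem smul_single_mem {p : Submodule k (TwistedMonoidAlgebra χ)} {g : G} {t : k} (ht : t ≠ 0) :
    single g t ∈ p ↔ single g 1 ∈ p := by
  rw [← p.smul_mem_iff ht (x := single g 1), smul_single, mul_one]

/-- The exponents of the monomials in a subalgebra. -/
def exponents (B : Subalgebra k (TwistedMonoidAlgebra χ)) : AddSubmonoid G where
  carrier := {g | single g 1 ∈ B}
  zero_mem' := B.one_mem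
  add_mem' {g h} hg hh := by
    have := B.mul_mem hg hh
    rw [single_mul_single, ← Subalgebra.mem_toSubmodule] at this
    exact (smul_single_mem (by simp)).1 this

theorem exists_single_pow (g : G) (n : ℕ) :
    ∃ t : kˣ, (single g 1 ^ n : TwistedMonoidAlgebra χ) = single (n • g) (t : k) := by
  induction n with
  | zero => exact ⟨1, by simp [one_def]⟩
  | succ n ih =>
    obtain ⟨t, ht⟩ := ih
    exact ⟨t * (χ (n • g) g).toMul, by simp [pow_succ, ht, single_mul_single, succ_nsmul]⟩

end Exponents

section Simple

variable {k G A : Type*} [Field k] [AddCommGroup G] {χ : G →+ G →+ Additive kˣ} [Ring A]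
  [Algebra k A] {f : A →ₐ[k] TwistedMonoidAlgebra χ}

/-- A nonzero ideal contains an element mapped to a monomial, hence a power of `y`. The relation
`x * y = s • (y * x) + u` reduces that power to `1`. -/
theorem isSimpleRing_of_injective (hf : Function.Injective f)
    (hnondeg : ∀ g, (∀ v ∈ exponents f.range, χ v g = χ g v) → g = 0)
    {s t : k} {x y u : A} {v : G} (hy : f y = single v 1)
    (hv : ∀ g, ∃ n : ℕ, n • v - g ∈ exponents f.range)
    (hxy : x * y = s • (y * x) + u) (huy : u * y = t • (y * u)) (hu : IsUnit u)
    (hst : ∀ n : ℕ, 0 < n → s ^ n ≠ t ^ n) : IsSimpleRing A := by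
  have : Nontrivial A := f.toRingHom.domain_nontrivial
  refine ⟨⟨fun I => or_iff_not_imp_left.2 fun hI => ?_⟩⟩
  obtain ⟨w, hw, hw0⟩ : ∃ w ∈ I, w ≠ 0 := by
    by_contra! hcon
    exact hI (eq_bot_iff.2 fun w hw => (TwoSidedIdeal.mem_bot A).2 (hcon w hw))
  let J : Submodule k (TwistedMonoidAlgebra χ) :=
    (I.asIdeal.restrictScalars k).map f.toLinearMap
  have hleft (z : A) (b) (hb : b ∈ J) : f z * b ∈ J := by
    obtain ⟨b, hb, rfl⟩ := hb
    exact ⟨z * b, I.mul_mem_left _ _ hb, map_mul f z b⟩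
  have hright (z : A) (b) (hb : b ∈ J) : b * f z ∈ J := by
    obtain ⟨b, hb, rfl⟩ := hb
    exact ⟨b * z, I.mul_mem_right _ _ hb, map_mul f b z⟩
  obtain ⟨g, hg⟩ := exists_single_mem (J := J) (V := exponents f.range)
    (by rintro v ⟨z, hz⟩; exact hz ▸ hleft z) (by rintro v ⟨z, hz⟩; exact hz ▸ hright z)
    hnondeg ⟨w, hw, rfl⟩ ((map_ne_zero_iff f hf).2 hw0)
  obtain ⟨n, z, hz⟩ := hv g
  replace hz : f z = single (n • v - g) 1 := hz
  obtain ⟨t', ht'⟩ := exists_single_pow (χ := χ) v n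
  have hpow : f (y ^ n) ∈ J := by
    have := hleft z _ hg
    rw [hz, single_mul_single, sub_add_cancel, smul_single_mem (by simp)] at this
    rwa [map_pow, hy, ht', smul_single_mem t'.ne_zero]
  obtain ⟨w', hw', hww'⟩ := hpow
  have hone := one_mem_of_pow_mem hxy huy hu hst (n := n) (hf hww' ▸ hw' : y ^ n ∈ I)
  exact I.one_mem_iff.1 hone

end Simple

section Centre

variable {k H A : Type*} [Field k] [AddCommGroup H] {χ : H →+ H →+ Additive kˣ} [Ring A]
  [Algebra k A]

theorem single_zero_one_pow (n : ℕ) :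
    (single (0, 1) 1 ^ n : TwistedMonoidAlgebra (comap χ (.fst H ℕ))) = single (0, n) 1 := by
  induction n with
  | zero => rfl
  | succ n ih => simp [pow_succ, ih, single_mul_single]

variable {f : A →ₐ[k] TwistedMonoidAlgebra (comap χ (.fst H ℕ))} {θ : A}

theorem transcendental_of_map_eq_single (hθ : f θ = single (0, 1) 1) : Transcendental k θ := by
  refine transcendental_iff.2 fun p hp => Polynomial.ext fun n => ?_
  have hcoeff : coeff (f (Polynomial.aeval θ p)) (0, n) = p.coeff n := by
    classical
    simpa [Polynomial.aeval_eq_sum_range, hθ, single_zero_one_pow, smul_single,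
      Finsupp.single_apply] using fun h => (Polynomial.coeff_eq_zero_of_natDegree_lt h).symm
  rw [← hcoeff, hp, map_zero, map_zero, Finsupp.zero_apply, Polynomial.coeff_zero]

theorem center_eq_adjoin_of_injective (hf : Function.Injective f)
    (hnondeg : ∀ g, (∀ v : H, (v, 0) ∈ exponents f.range → χ v g = χ g v) → g = 0)
    (hθ : f θ = single (0, 1) 1) : Subalgebra.center k A = Algebra.adjoin k {θ} := by
  refine le_antisymm (fun z hz => ?_) ?_
  · have hsupp (g : H × ℕ) (hg : coeff (f z) g ≠ 0) : g.1 = 0 := by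
      refine hnondeg _ ?_
      rintro v ⟨w, hw⟩
      refine bicharacter_comm_of_commute_single (χ := comap χ (.fst H ℕ)) (v := (v, 0)) (x := f z)
        ?_ hg
      rw [← hw]
      exact (show Commute w z from Subalgebra.mem_center_iff.1 hz w).map f
    suffices z = ∑ g ∈ (coeff (f z)).support, coeff (f z) g • θ ^ g.2 by
      rw [this]
      exact sum_mem fun g _ => Subalgebra.smul_mem _
        (pow_mem (Algebra.self_mem_adjoin_singleton k θ) _) _
    refine hf ?_
    conv_lhs => rw [eq_sum_single (f z)]
    rw [map_sum]
    refine Finset.sum_congr rfl fun g hg => ?_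
    rw [map_smul, map_pow, hθ, single_zero_one_pow, smul_single, mul_one,
      ← hsupp g (Finsupp.mem_support_iff.1 hg)]
  · refine Algebra.adjoin_le (Set.singleton_subset_iff.2 (Subalgebra.mem_center_iff.2 fun w => ?_))
    refine hf ?_
    rw [map_mul, map_mul, hθ]
    induction f w using TwistedMonoidAlgebra.induction with
    | zero => simp only [zero_mul, mul_zero]
    | add x y hx hy => simp only [add_mul, mul_add, hx, hy]
    | single g t => simp [single_mul_single, add_comm]

end Centre

end TwistedMonoidAlgebra

/-! ### Quantum tori -/

section QuantumTorus

variable {k : Type*} [Field k] {n : ℕ}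

theorem zpow_injective_of_pow_ne_one {q : kˣ} (hq : ∀ n : ℕ, 0 < n → (q : k) ^ n ≠ 1) :
    Function.Injective fun n : ℤ => q ^ n := by
  refine injective_zpow_iff_not_isOfFinOrder.2 fun h => ?_
  obtain ⟨n, hn, hqn⟩ := isOfFinOrder_iff_pow_eq_one.1 h
  exact hq n hn (by rw [← Units.val_pow_eq_pow_val, hqn, Units.val_one])

/-- The bicharacter `(g, h) ↦ q ^ (gᵀ B h)`, whose twisted monoid algebra is the quantum torus with
parameters `q ^ (B i j - B j i)`. -/
def powBicharacter (q : kˣ) (B : Matrix (Fin n) (Fin n) ℤ) :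
    (Fin n → ℤ) →+ (Fin n → ℤ) →+ Additive kˣ :=
  .mk' (fun g => .mk' (fun h => .ofMul (q ^ (g ⬝ᵥ B.mulVec h)))
    fun h h' => by rw [B.mulVec_add, dotProduct_add, zpow_add, ofMul_mul])
    fun g g' => by ext h; simp [add_dotProduct, zpow_add]

@[simp]
theorem powBicharacter_apply (q : kˣ) (B : Matrix (Fin n) (Fin n) ℤ) (g h : Fin n → ℤ) :
    powBicharacter q B g h = .ofMul (q ^ (g ⬝ᵥ B.mulVec h)) := rfl

theorem exists_nsmul_single_sub_mem {S : AddSubmonoid (Fin n → ℤ)} {s : Fin n}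
    (hS : ∀ i, Pi.single i 1 ∈ S) (hneg : ∀ i ≠ s, -Pi.single i 1 ∈ S) (g : Fin n → ℤ) :
    ∃ m : ℕ, m • Pi.single s 1 - g ∈ S := by
  have hmem (i : Fin n) {d : ℤ} (hd : i = s → 0 ≤ d) : Pi.single i d ∈ S := by
    obtain ⟨m, rfl | rfl⟩ := d.eq_nat_or_neg
    · simpa [← Pi.single_smul] using nsmul_mem (hS i) m
    · obtain rfl | hi := eq_or_ne i s
      · obtain rfl : m = 0 := by simpa using hd rfl
        simp
      · simpa [← Pi.single_smul, ← Pi.single_neg] using nsmul_mem (hneg i hi) m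
  refine ⟨(g s).toNat, ?_⟩
  rw [← Finset.univ_sum_single ((g s).toNat • Pi.single s 1 - g)]
  refine sum_mem fun i _ => hmem i ?_
  rintro rfl
  simp

end QuantumTorus

/-! ### Normal elements -/

section Normal

variable {R : Type*} [Ring R]

theorem mem_twoSidedIdeal_span_iff_mem_ideal_span {s : Set R}
    (hs : ∀ x ∈ s, ∀ z, ∃ d, x * z = d * x) {z : R} :
    z ∈ TwoSidedIdeal.span s ↔ z ∈ Ideal.span s := by
  have htwo : (Ideal.span s).IsTwoSided := by
    refine ⟨fun {x} w hx => ?_⟩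
    induction hx using Submodule.span_induction with
    | mem x hx =>
      obtain ⟨d, hd⟩ := hs x hx w
      rw [hd]
      exact Ideal.mul_mem_left _ d (Ideal.subset_span hx)
    | zero => rw [zero_mul]; exact zero_mem _
    | add x y _ _ hx hy => rw [add_mul]; exact add_mem hx hy
    | smul r x _ hx => rw [smul_eq_mul, mul_assoc]; exact Ideal.mul_mem_left _ r hx
  refine ⟨fun hz => ?_, fun hz => ?_⟩
  · exact Ideal.mem_toTwoSided.1
      (TwoSidedIdeal.mem_span_iff.1 hz _ fun x hx => Ideal.mem_toTwoSided.2 (Ideal.subset_span hx))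
  · exact TwoSidedIdeal.mem_asIdeal.1
      (Ideal.span_le (I := (TwoSidedIdeal.span s).asIdeal).2 TwoSidedIdeal.subset_span hz)

end Normal

/-! ### The Heisenberg double -/

namespace Dq

section Relations

variable {k : Type*} [Field k] {q : k}

/-- The projection from the free algebra. -/
def mk (q : k) : FreeAlgebra k Gen →ₐ[k] Dq q := RingQuot.mkAlgHom k (Rel q)

theorem mk_rel {x y : FreeAlgebra k Gen} (h : Rel q x y) : mk q x = mk q y :=
  RingQuot.mkAlgHom_rel k h

theorem a_mul_ainv : a q * ainv q = 1 := by
  have := mk_rel (Rel.a_ainv (q := q)); rwa [map_mul, map_one] at this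

theorem ainv_mul_a : ainv q * a q = 1 := by
  have := mk_rel (Rel.ainv_a (q := q)); rwa [map_mul, map_one] at this

theorem K_mul_Kinv : K q * Kinv q = 1 := by
  have := mk_rel (Rel.K_Kinv (q := q)); rwa [map_mul, map_one] at this

theorem Kinv_mul_K : Kinv q * K q = 1 := by
  have := mk_rel (Rel.Kinv_K (q := q)); rwa [map_mul, map_one] at this

theorem qcomm_a_b : QComm q (a q) (b q) := by
  have := mk_rel (Rel.ab (q := q)); rwa [map_mul, map_smul, map_mul] at this

theorem qcomm_a_c : QComm q (a q) (c q) := by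
  have := mk_rel (Rel.ac (q := q)); rwa [map_mul, map_smul, map_mul] at this

theorem qcomm_b_c : QComm (1 : k) (b q) (c q) := by
  have := mk_rel (Rel.bc (q := q)); rw [map_mul, map_mul] at this; exact .of_commute this

theorem qcomm_K_E : QComm (q ^ 2) (K q) (E q) := by
  have := mk_rel (Rel.KE (q := q)); rwa [map_mul, map_smul, map_mul] at this

theorem qcomm_K_F : QComm (q ^ (-2 : ℤ)) (K q) (F q) := by
  have := mk_rel (Rel.KF (q := q)); rwa [map_mul, map_smul, map_mul] at this

theorem qcomm_E_F : QComm (1 : k) (E q) (F q) := by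
  have := mk_rel (Rel.EF (q := q)); rw [map_mul, map_mul] at this; exact .of_commute this

theorem qcomm_K_a : QComm q⁻¹ (K q) (a q) := by
  have := mk_rel (Rel.Ka (q := q)); rwa [map_mul, map_smul, map_mul] at this

theorem qcomm_K_b : QComm q (K q) (b q) := by
  have := mk_rel (Rel.Kb (q := q)); rwa [map_mul, map_smul, map_mul] at this

theorem qcomm_K_c : QComm q⁻¹ (K q) (c q) := by
  have := mk_rel (Rel.Kc (q := q)); rwa [map_mul, map_smul, map_mul] at this

theorem qcomm_E_a : QComm (1 : k) (E q) (a q) := by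
  have := mk_rel (Rel.Ea (q := q)); rw [map_mul, map_mul] at this; exact .of_commute this

theorem qcomm_E_b : QComm (1 : k) (E q) (b q) := by
  have := mk_rel (Rel.Eb (q := q)); rw [map_mul, map_mul] at this; exact .of_commute this

theorem E_mul_c : E q * c q = c q * E q + ainv q * K q := by
  have := mk_rel (Rel.Ec (q := q)); rwa [map_add, map_mul, map_mul, map_mul] at this

theorem qcomm_F_a : QComm q (F q) (a q) := by
  have := mk_rel (Rel.Fa (q := q)); rwa [map_mul, map_smul, map_mul] at this

theorem F_mul_b : F q * b q = q⁻¹ • (b q * F q) + a q := by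
  have := mk_rel (Rel.Fb (q := q)); rwa [map_add, map_mul, map_smul, map_mul] at this

theorem qcomm_F_c : QComm q (F q) (c q) := by
  have := mk_rel (Rel.Fc (q := q)); rwa [map_mul, map_smul, map_mul] at this

/-- The universal property of `D_q`. -/
def lift {A : Type*} [Ring A] [Algebra k A] (t : Gen → A)
    (ht : ∀ ⦃x y⦄, Rel q x y → FreeAlgebra.lift k t x = FreeAlgebra.lift k t y) : Dq q →ₐ[k] A :=
  RingQuot.liftAlgHom k ⟨FreeAlgebra.lift k t, ht⟩

theorem lift_of {A : Type*} [Ring A] [Algebra k A] (t : Gen → A)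
    (ht : ∀ ⦃x y⦄, Rel q x y → FreeAlgebra.lift k t x = FreeAlgebra.lift k t y) (g : Gen) :
    lift t ht (of q g) = t g :=
  (RingQuot.liftAlgHom_mkAlgHom_apply k _ _ _).trans (FreeAlgebra.lift_ι_apply _ _)

@[elab_as_elim]
theorem induction {p : Dq q → Prop} (z : Dq q) (algebraMap : ∀ s, p (algebraMap k _ s))
    (of : ∀ g, p (of q g)) (add : ∀ z w, p z → p w → p (z + w))
    (mul : ∀ z w, p z → p w → p (z * w)) : p z := by
  obtain ⟨z, rfl⟩ : ∃ w, mk q w = z := RingQuot.mkAlgHom_surjective k (Rel q) z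
  induction z using FreeAlgebra.induction with
  | grade0 t => rw [AlgHom.commutes]; exact algebraMap t
  | grade1 g => exact of g
  | mul z w hz hw => rw [map_mul]; exact mul _ _ hz hw
  | add z w hz hw => rw [map_add]; exact add _ _ hz hw

end Relations

section Normal

variable {k : Type*} [Field k] {q : k}

theorem psi_eq : psi q = (1 - q ^ (-2 : ℤ)) • (c q * E q) + ainv q * K q := by
  rw [psi, E_mul_c]
  module

theorem phi_eq : phi q = (q⁻¹ - q) • (b q * F q) + a q := by
  rw [phi, F_mul_b]
  match_scalars
  · field_simp
  · ring

theorem qcomm_K_phi : QComm q⁻¹ (K q) (phi q) := by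
  rw [phi]
  exact ((qcomm_K_F.mul_right qcomm_K_b).smul_right _ |>.congr
    (by rw [zpow_neg]; field_simp)).add_right (qcomm_K_a.smul_right _)

theorem qcomm_E_phi : QComm (1 : k) (E q) (phi q) := by
  rw [phi]
  exact ((qcomm_E_F.mul_right qcomm_E_b).smul_right _ |>.congr (mul_one 1)).add_right
    (qcomm_E_a.smul_right _)

theorem qcomm_F_phi : QComm q⁻¹ (F q) (phi q) := by
  rw [QComm]
  conv_lhs => rw [phi_eq, mul_add, qcomm_F_a.eq]
  simp only [phi, add_mul, mul_smul_comm, smul_mul_assoc, mul_assoc]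
  match_scalars <;> field_simp

theorem exists_mul_eq_mul {x : Dq q} (h : ∀ g, ∃ s ≠ 0, QComm (s : k) (of q g) x)
    (z : Dq q) : ∃ d, x * z = d * x := by
  induction z using induction with
  | algebraMap s => exact ⟨algebraMap k _ s, (Algebra.commutes s x).symm⟩
  | of g =>
    obtain ⟨s, hs0, hs⟩ := h g
    exact ⟨s⁻¹ • of q g, by rw [(hs.symm hs0).eq, smul_mul_assoc]⟩
  | add z w hz hw =>
    obtain ⟨d, hd⟩ := hz
    obtain ⟨d', hd'⟩ := hw
    exact ⟨d + d', by rw [mul_add, add_mul, hd, hd']⟩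
  | mul z w hz hw =>
    obtain ⟨d, hd⟩ := hz
    obtain ⟨d', hd'⟩ := hw
    exact ⟨d * d', by rw [← mul_assoc, hd, mul_assoc, hd', mul_assoc]⟩

variable [NeZero q]

theorem qcomm_ainv_K_c : QComm (q ^ (-2 : ℤ)) (ainv q * K q) (c q) :=
  ((qcomm_a_c.inv_left (NeZero.ne q) a_mul_ainv ainv_mul_a).mul_left qcomm_K_c).congr
    (by rw [zpow_neg, ← mul_inv]; norm_cast; rw [sq])

theorem qcomm_E_ainv_K : QComm (q ^ (-2 : ℤ)) (E q) (ainv q * K q) :=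
  ((qcomm_E_a.inv_right one_ne_zero a_mul_ainv ainv_mul_a).mul_right
    (qcomm_K_E.symm (pow_ne_zero 2 (NeZero.ne q)))).congr (by simp [zpow_neg])

theorem qcomm_a_psi : QComm q (a q) (psi q) := by
  rw [psi]
  exact (((qcomm_E_a.symm one_ne_zero).mul_right qcomm_a_c).smul_right _ |>.congr
    (by simp)).add_right
    ((((QComm.refl _).inv_right one_ne_zero a_mul_ainv ainv_mul_a).mul_right
      (qcomm_K_a.symm (inv_ne_zero (NeZero.ne q)))).smul_right _ |>.congr (by simp))

theorem qcomm_b_psi : QComm (1 : k) (b q) (psi q) := by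
  rw [psi]
  have hb_ainv : QComm (q⁻¹)⁻¹ (b q) (ainv q) :=
    (qcomm_a_b.symm (NeZero.ne q)).inv_right (inv_ne_zero (NeZero.ne q)) a_mul_ainv ainv_mul_a
  exact (((qcomm_E_b.symm one_ne_zero).mul_right qcomm_b_c).smul_right _ |>.congr
    (by simp)).add_right ((hb_ainv.mul_right (qcomm_K_b.symm (NeZero.ne q))).smul_right _ |>.congr
      (by simp [NeZero.ne q]))

theorem qcomm_K_psi : QComm q (K q) (psi q) := by
  rw [psi]
  exact ((qcomm_K_E.mul_right qcomm_K_c).smul_right _ |>.congr (by field_simp)).add_right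
    (((qcomm_K_a.inv_right (inv_ne_zero (NeZero.ne q)) a_mul_ainv ainv_mul_a).mul_right
      (QComm.refl _)).smul_right _ |>.congr (by simp))

theorem qcomm_F_psi : QComm q (F q) (psi q) := by
  rw [psi]
  exact (((qcomm_E_F.symm one_ne_zero).mul_right qcomm_F_c).smul_right _ |>.congr
    (by simp)).add_right (((qcomm_F_a.inv_right (NeZero.ne q) a_mul_ainv ainv_mul_a).mul_right
      (qcomm_K_F.symm (zpow_ne_zero _ (NeZero.ne q)))).smul_right _ |>.congr
        (by rw [zpow_neg]; field_simp))

theorem qcomm_c_psi : QComm (1 : k) (c q) (psi q) := by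
  refine (QComm.symm one_ne_zero ?_).congr inv_one
  rw [QComm, one_smul]
  conv_lhs => rw [psi_eq, add_mul, qcomm_ainv_K_c.eq]
  simp only [psi, mul_add, mul_smul_comm, smul_mul_assoc, mul_assoc]

theorem qcomm_E_psi : QComm (1 : k) (E q) (psi q) := by
  rw [QComm, one_smul]
  conv_lhs => rw [psi_eq, mul_add, qcomm_E_ainv_K.eq]
  simp only [psi, add_mul, mul_smul_comm, smul_mul_assoc, mul_assoc]

theorem qcomm_a_phi : QComm (1 : k) (a q) (phi q) := by
  rw [phi]
  exact (((qcomm_F_a.symm (NeZero.ne q)).mul_right qcomm_a_b).smul_right _ |>.congr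
    (inv_mul_cancel₀ (NeZero.ne q))).add_right ((QComm.refl _).smul_right _)

theorem qcomm_c_phi : QComm q⁻¹ (c q) (phi q) := by
  rw [phi]
  exact (((qcomm_F_c.symm (NeZero.ne q)).mul_right (qcomm_b_c.symm one_ne_zero)).smul_right _
    |>.congr (by simp)).add_right ((qcomm_a_c.symm (NeZero.ne q)).smul_right _)

theorem qcomm_b_phi : QComm q (b q) (phi q) := by
  refine (QComm.symm (inv_ne_zero (NeZero.ne q)) ?_).congr (inv_inv _)
  rw [QComm]
  conv_lhs => rw [phi_eq, add_mul, qcomm_a_b.eq]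
  simp only [phi, mul_add, mul_smul_comm, smul_mul_assoc, mul_assoc]
  match_scalars <;> field_simp

theorem qcomm_psi_phi : QComm q⁻¹ (psi q) (phi q) := by
  rw [psi]
  exact ((qcomm_E_phi.mul_left qcomm_c_phi).smul_left _ |>.congr (one_mul _)).add_left
    (((qcomm_a_phi.inv_left one_ne_zero a_mul_ainv ainv_mul_a).mul_left qcomm_K_phi).smul_left _
      |>.congr (by simp))

theorem exists_phi_mul_eq (z : Dq q) : ∃ d, phi q * z = d * phi q := by
  have hq := NeZero.ne q
  refine exists_mul_eq_mul (fun g => ?_) z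
  cases g with
  | a => exact ⟨1, one_ne_zero, qcomm_a_phi⟩
  | ainv => exact ⟨_, by simp, qcomm_a_phi.inv_left one_ne_zero a_mul_ainv ainv_mul_a⟩
  | b => exact ⟨q, hq, qcomm_b_phi⟩
  | c => exact ⟨q⁻¹, inv_ne_zero hq, qcomm_c_phi⟩
  | K => exact ⟨q⁻¹, inv_ne_zero hq, qcomm_K_phi⟩
  | Kinv => exact ⟨_, by simpa, qcomm_K_phi.inv_left (inv_ne_zero hq) K_mul_Kinv Kinv_mul_K⟩
  | E => exact ⟨1, one_ne_zero, qcomm_E_phi⟩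
  | F => exact ⟨q⁻¹, inv_ne_zero hq, qcomm_F_phi⟩

theorem exists_psi_mul_eq (z : Dq q) : ∃ d, psi q * z = d * psi q := by
  have hq := NeZero.ne q
  refine exists_mul_eq_mul (fun g => ?_) z
  cases g with
  | a => exact ⟨q, hq, qcomm_a_psi⟩
  | ainv => exact ⟨_, by simpa, qcomm_a_psi.inv_left hq a_mul_ainv ainv_mul_a⟩
  | b => exact ⟨1, one_ne_zero, qcomm_b_psi⟩
  | c => exact ⟨1, one_ne_zero, qcomm_c_psi⟩
  | K => exact ⟨q, hq, qcomm_K_psi⟩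
  | Kinv => exact ⟨_, by simpa, qcomm_K_psi.inv_left hq K_mul_Kinv Kinv_mul_K⟩
  | E => exact ⟨1, one_ne_zero, qcomm_E_psi⟩
  | F => exact ⟨q, hq, qcomm_F_psi⟩

end Normal

end Dq

namespace Dq

/-! ### Embedding into a quantum polynomial algebra -/

section Laurent

open QuantumPolynomial

variable {k : Type*} [Field k]

theorem inv_smul_mul_sub_mul {A : Type*} [Ring A] [Algebra k A] {s t : k} {y y' p w : A}
    (h : y * y' = 1) (h' : y' * y = 1) (hst : s - t ≠ 0) (hp : QComm s p y) (hw : QComm t w y) :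
    (s - t)⁻¹ • (y' * (p - w)) * y = s • (y * (s - t)⁻¹ • (y' * (p - w))) + w := by
  have hcomm : (p - w) * y = y * (s • p - t • w) := by
    rw [sub_mul, mul_sub, hp.eq, hw.eq, mul_smul_comm, mul_smul_comm]
  rw [smul_mul_assoc, mul_assoc, hcomm, ← mul_assoc, h', one_mul, mul_smul_comm, ← mul_assoc, h,
    one_mul]
  match_scalars
  · ring
  · field_simp
    ring

theorem one_sub_zpow_neg_two_ne_zero {q : k} (hq : q ^ 2 ≠ 1) : 1 - q ^ (-2 : ℤ) ≠ 0 := by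
  rw [sub_ne_zero, zpow_neg, ne_comm, inv_ne_one]
  exact_mod_cast hq

theorem inv_sub_self_ne_zero {q : k} [NeZero q] (hq : q ^ 2 ≠ 1) : q⁻¹ - q ≠ 0 := by
  rw [sub_ne_zero]
  intro h
  exact hq (by rw [sq, ← inv_mul_cancel₀ (NeZero.ne q), h])

/-- The algebra on the variables `a, b, c, K, ψ, φ`, with the first four inverted; as a localization
of `D_q` it contains `E` and `F`, because `ψ` and `φ` determine `c E` and `b F`. -/
abbrev Laurent (q : k) := QuantumPolynomial (qMatrix q) 4

variable (q : k)

/-- The images of the generators of `D_q` in the algebra of Laurent polynomials. -/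
def laurentGen : Gen → Laurent q
  | .a => X _ _ 0
  | .ainv => Xinv _ _ 0 (by decide)
  | .b => X _ _ 1
  | .c => X _ _ 2
  | .K => X _ _ 3
  | .Kinv => Xinv _ _ 3 (by decide)
  | .E => (1 - q ^ (-2 : ℤ))⁻¹ • (Xinv _ _ 2 (by decide) *
      (X _ _ 4 - Xinv _ _ 0 (by decide) * X _ _ 3))
  | .F => (q⁻¹ - q)⁻¹ • (Xinv _ _ 1 (by decide) * (X _ _ 5 - X _ _ 0))

variable {q}

theorem qcomm_laurent {i j : Fin 6} {d : ℤ} (h : expMatrix i j = d) :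
    QComm (q ^ d) (X (qMatrix q) 4 i) (X (qMatrix q) 4 j) :=
  h ▸ qcomm_X i j

theorem smul_c_mul_laurentGen_E (hq : q ^ 2 ≠ 1) :
    (1 - q ^ (-2 : ℤ)) • (laurentGen q .c * laurentGen q .E) +
      laurentGen q .ainv * laurentGen q .K = X _ _ 4 := by
  simp only [laurentGen]
  rw [mul_smul_comm, smul_inv_smul₀ (one_sub_zpow_neg_two_ne_zero hq), ← mul_assoc, X_mul_Xinv,
    one_mul, sub_add_cancel]

variable [NeZero q]

theorem qcomm_laurent_inv {i j : Fin 6} (hi : i.val < 4) {d : ℤ} (h : -expMatrix i j = d) :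
    QComm (q ^ d) (Xinv (qMatrix q) 4 i hi) (X (qMatrix q) 4 j) :=
  ((qcomm_laurent rfl).inv_left (zpow_ne_zero _ (NeZero.ne q)) (X_mul_Xinv i hi)
    (Xinv_mul_X i hi)).congr (by rw [← zpow_neg, h])

theorem qcomm_laurentGen_E {j : Fin 6} {d : ℤ} (h : expMatrix 4 j - expMatrix 2 j = d)
    (h' : expMatrix 3 j - expMatrix 0 j - expMatrix 2 j = d) :
    QComm (q ^ d) (laurentGen q .E) (X _ _ j) := by
  have hq := NeZero.ne q
  rw [laurentGen, mul_sub]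
  refine (QComm.sub_left ?_ ?_).smul_left _
  · exact ((qcomm_laurent_inv _ rfl).mul_left (qcomm_laurent rfl)).congr
      (by rw [← zpow_add₀ hq, ← h]; ring_nf)
  · exact ((qcomm_laurent_inv _ rfl).mul_left
      ((qcomm_laurent_inv _ rfl).mul_left (qcomm_laurent rfl))).congr
        (by rw [← zpow_add₀ hq, ← zpow_add₀ hq, ← h']; ring_nf)

theorem qcomm_laurentGen_F {j : Fin 6} {d : ℤ} (h : expMatrix 5 j - expMatrix 1 j = d)
    (h' : expMatrix 0 j - expMatrix 1 j = d) :
    QComm (q ^ d) (laurentGen q .F) (X _ _ j) := by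
  have hq := NeZero.ne q
  rw [laurentGen, mul_sub]
  refine (QComm.sub_left ?_ ?_).smul_left _
  · exact ((qcomm_laurent_inv _ rfl).mul_left (qcomm_laurent rfl)).congr
      (by rw [← zpow_add₀ hq, ← h]; ring_nf)
  · exact ((qcomm_laurent_inv _ rfl).mul_left (qcomm_laurent rfl)).congr
      (by rw [← zpow_add₀ hq, ← h']; ring_nf)

theorem commute_laurentGen_E_F : Commute (laurentGen q .E) (laurentGen q .F) := by
  have hE {j : Fin 6} (h : expMatrix 4 j - expMatrix 2 j = 0)
      (h' : expMatrix 3 j - expMatrix 0 j - expMatrix 2 j = 0) :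
      Commute (laurentGen q .E) (X _ _ j) := by
    have := (qcomm_laurentGen_E (q := q) h h').eq
    rwa [zpow_zero, one_smul] at this
  have hb : Commute (laurentGen q .E) (Xinv _ _ 1 (by decide)) := by
    have := (qcomm_laurentGen_E (q := q) (j := 1) (d := 0) (by decide) (by decide)).inv_right
      (by simp) (X_mul_Xinv 1 (by decide)) (Xinv_mul_X 1 (by decide)) |>.eq
    rwa [zpow_zero, inv_one, one_smul] at this
  exact (hb.mul_right ((hE (by decide) (by decide)).sub_right
    (hE (by decide) (by decide)))).smul_right _

theorem smul_b_mul_laurentGen_F (hq : q ^ 2 ≠ 1) :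
    (q⁻¹ - q) • (laurentGen q .b * laurentGen q .F) + laurentGen q .a = X _ _ 5 := by
  simp only [laurentGen]
  rw [mul_smul_comm, smul_inv_smul₀ (inv_sub_self_ne_zero hq), ← mul_assoc, X_mul_Xinv, one_mul,
    sub_add_cancel]

theorem laurentGen_E_mul_c (hq : q ^ 2 ≠ 1) : laurentGen q .E * laurentGen q .c =
    laurentGen q .c * laurentGen q .E + laurentGen q .ainv * laurentGen q .K := by
  have hw : QComm (q ^ (-2 : ℤ)) (Xinv (qMatrix q) 4 0 (by decide) * X _ _ 3) (X _ _ 2) :=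
    ((qcomm_laurent_inv (d := -1) _ (by decide)).mul_left
      (qcomm_laurent (d := -1) (by decide))).congr (by rw [← zpow_add₀ (NeZero.ne q)]; norm_num)
  have hpsi : QComm (1 : k) (X (qMatrix q) 4 4) (X _ _ 2) :=
    (qcomm_laurent (d := 0) (by decide)).congr (zpow_zero q)
  have := inv_smul_mul_sub_mul (X_mul_Xinv 2 (by decide)) (Xinv_mul_X 2 (by decide))
    (one_sub_zpow_neg_two_ne_zero hq) hpsi hw
  rw [one_smul] at this
  exact this

theorem laurentGen_F_mul_b (hq : q ^ 2 ≠ 1) : laurentGen q .F * laurentGen q .b =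
    q⁻¹ • (laurentGen q .b * laurentGen q .F) + laurentGen q .a :=
  inv_smul_mul_sub_mul (X_mul_Xinv 1 (by decide)) (Xinv_mul_X 1 (by decide))
    (inv_sub_self_ne_zero hq)
    ((qcomm_laurent (d := -1) (by decide)).congr (zpow_neg_one q))
    ((qcomm_laurent (d := 1) (by decide)).congr (zpow_one q))

/-- The homomorphism that sends `a, b, c, K, ψ, φ` to the variables of the same name. -/
def toLaurent (hq : q ^ 2 ≠ 1) : Dq q →ₐ[k] Laurent q :=
  lift (laurentGen q) <| by
    have hX {i j : Fin 6} (d : ℤ) {s : k} (hs : q ^ d = s) (h : expMatrix i j = d) :=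
      (qcomm_laurent (q := q) h).congr hs
    have hE {j : Fin 6} (d : ℤ) {s : k} (hs : q ^ d = s) (h : expMatrix 4 j - expMatrix 2 j = d)
        (h' : expMatrix 3 j - expMatrix 0 j - expMatrix 2 j = d) :=
      (qcomm_laurentGen_E (q := q) h h').congr hs
    have hF {j : Fin 6} (d : ℤ) {s : k} (hs : q ^ d = s) (h : expMatrix 5 j - expMatrix 1 j = d)
        (h' : expMatrix 0 j - expMatrix 1 j = d) :=
      (qcomm_laurentGen_F (q := q) h h').congr hs
    intro x y h
    cases h <;> simp only [map_add, map_mul, map_smul, map_one, FreeAlgebra.lift_ι_apply]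
    case EF => exact commute_laurentGen_E_F
    case Ec => exact laurentGen_E_mul_c hq
    case Fb => exact laurentGen_F_mul_b hq
    case a_ainv | K_Kinv => exact X_mul_Xinv _ _
    case ainv_a | Kinv_K => exact Xinv_mul_X _ _
    case ab | ac | Kb => exact hX 1 (zpow_one q) (by decide)
    case Ka | Kc => exact hX (-1) (zpow_neg_one q) (by decide)
    case bc => exact (hX 0 (zpow_zero q) (by decide)).eq.trans (one_smul _ _)
    case KE =>
      exact ((hE (-2) rfl (by decide) (by decide)).symm (zpow_ne_zero _ (NeZero.ne q))).congr
        (by rw [zpow_neg, inv_inv, zpow_ofNat])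
    case KF =>
      exact ((hF 2 rfl (by decide) (by decide)).symm (zpow_ne_zero _ (NeZero.ne q))).congr
        (zpow_neg q 2).symm
    case Ea | Eb => exact (hE 0 (zpow_zero q) (by decide) (by decide)).eq.trans (one_smul _ _)
    case Fa | Fc => exact hF 1 (zpow_one q) (by decide) (by decide)

variable (hq : q ^ 2 ≠ 1)

theorem toLaurent_of (g : Gen) : toLaurent hq (of q g) = laurentGen q g := lift_of _ _ g

theorem toLaurent_psi : toLaurent hq (psi q) = X _ _ 4 := by
  rw [psi_eq, map_add, map_smul, map_mul, map_mul]
  simp only [toLaurent_of]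
  exact smul_c_mul_laurentGen_E hq

theorem toLaurent_phi : toLaurent hq (phi q) = X _ _ 5 := by
  rw [phi_eq, map_add, map_smul, map_mul]
  simp only [toLaurent_of]
  exact smul_b_mul_laurentGen_F hq

/-- The elements `a, b, c, K, ψ, φ` of `D_q`, in the order of `expMatrix`. -/
def var (q : k) : Fin 6 → Dq q := ![a q, b q, c q, K q, psi q, phi q]

theorem toLaurent_var (i : Fin 6) : toLaurent hq (var q i) = X _ _ i := by
  fin_cases i
  · exact toLaurent_of hq .a
  · exact toLaurent_of hq .b
  · exact toLaurent_of hq .c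
  · exact toLaurent_of hq .K
  · exact toLaurent_psi hq
  · exact toLaurent_phi hq

theorem expMatrix_transpose : expMatrix.transpose = -expMatrix := by decide

theorem qMatrix_ne_zero (i j : Fin 6) : qMatrix q i j ≠ 0 := zpow_ne_zero _ (NeZero.ne q)

theorem qcomm_var (i j : Fin 6) : QComm (qMatrix q i j) (var q i) (var q j) := by
  have hq := NeZero.ne q
  wlog hij : i ≤ j generalizing i j
  · refine ((this j i (le_of_not_ge hij)).symm (qMatrix_ne_zero j i)).congr ?_
    rw [qMatrix, Matrix.of_apply, Matrix.of_apply, ← zpow_neg, ← Matrix.neg_apply,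
      ← expMatrix_transpose, Matrix.transpose_apply]
  have hcongr {s : k} {i j : Fin 6} (h : QComm s (var q i) (var q j)) (e : s = q ^ expMatrix i j) :
      QComm (qMatrix q i j) (var q i) (var q j) := h.congr e
  obtain rfl | hij := hij.eq_or_lt
  · refine (QComm.refl _).congr ?_
    fin_cases i <;> simp [qMatrix, expMatrix]
  · fin_cases i <;> fin_cases j <;> first | exact absurd hij (by decide) | skip
    · exact hcongr qcomm_a_b (by simp [expMatrix])
    · exact hcongr qcomm_a_c (by simp [expMatrix])
    · exact hcongr (qcomm_K_a.symm (inv_ne_zero hq)) (by simp [expMatrix])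
    · exact hcongr qcomm_a_psi (by simp [expMatrix])
    · exact hcongr qcomm_a_phi (by simp [expMatrix])
    · exact hcongr qcomm_b_c (by simp [expMatrix])
    · exact hcongr (qcomm_K_b.symm hq) (by simp [expMatrix])
    · exact hcongr qcomm_b_psi (by simp [expMatrix])
    · exact hcongr qcomm_b_phi (by simp [expMatrix])
    · exact hcongr (qcomm_K_c.symm (inv_ne_zero hq)) (by simp [expMatrix])
    · exact hcongr qcomm_c_psi (by simp [expMatrix])
    · exact hcongr qcomm_c_phi (by simp [expMatrix])
    · exact hcongr qcomm_K_psi (by simp [expMatrix])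
    · exact hcongr qcomm_K_phi (by simp [expMatrix])
    · exact hcongr qcomm_psi_phi (by simp [expMatrix])

end Laurent

end Dq

namespace TwistedMonoidAlgebra

variable {k G : Type*} [Field k] [AddCommMonoid G] {χ : G →+ G →+ Additive kˣ}

theorem isUnit_single {g : G} (hg : IsAddUnit g) : IsUnit (single (χ := χ) g 1) := by
  obtain ⟨h, hgh⟩ := isAddUnit_iff_exists_neg.1 hg
  have hgh' : h + g = 0 := add_comm h g ▸ hgh
  refine isUnit_iff_exists_and_exists.2 ⟨⟨single h ↑(χ g h).toMul⁻¹, ?_⟩,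
    single h ↑(χ h g).toMul⁻¹, ?_⟩
  · rw [single_mul_single, hgh, one_mul, Units.inv_mul, one_def]
  · rw [single_mul_single, hgh', mul_one, Units.inv_mul, one_def]

end TwistedMonoidAlgebra

namespace Dq

/-! ### Quantum tori to which the factor algebras map -/

section Torus

open TwistedMonoidAlgebra QuantumPolynomial

variable {k : Type*} [Field k] (q : k) [NeZero q]

/-- The quantum torus on `a, b, c, K` has the parameters `q ^ (B i j - B j i)` for this matrix
`B`. -/
def torusMatrix : Matrix (Fin 4) (Fin 4) ℤ :=
  !![0, 0, 0, 0;
    -1, 0, 0, 0;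
    -1, 0, 0, 0;
    -1, 1, -1, 0]

/-- The bicharacter of the quantum torus on `a, b, c, K`. -/
def torusChar : (Fin 4 → ℤ) →+ (Fin 4 → ℤ) →+ Additive kˣ :=
  powBicharacter (Units.mk0 q (NeZero.ne q)) torusMatrix

/-- The exponents of `a, b, c, K, b, c K⁻¹`; the latter two are proportional to `ψ` and `φ` modulo
the ideals of `D_q` under consideration. -/
def torusVec : Fin 6 → Fin 4 → ℤ :=
  ![Pi.single 0 1, Pi.single 1 1, Pi.single 2 1, Pi.single 3 1, Pi.single 1 1,
    Pi.single 2 1 - Pi.single 3 1]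

theorem expMatrix_eq_sub {i j : Fin 6} (hij : s(i, j) ≠ s(4, 5)) :
    expMatrix i j = torusVec i ⬝ᵥ torusMatrix.mulVec (torusVec j) -
      torusVec j ⬝ᵥ torusMatrix.mulVec (torusVec i) := by
  fin_cases i <;> fin_cases j <;> first | rfl | exact absurd (by decide) hij

variable {q}

theorem eq_zero_of_forall_torusChar_comm (hq : ∀ n : ℕ, 0 < n → q ^ n ≠ 1) {g : Fin 4 → ℤ}
    (h : ∀ i, torusChar q (Pi.single i 1) g = torusChar q g (Pi.single i 1)) : g = 0 := by
  have hexp (i : Fin 4) : torusMatrix.mulVec g i = g ⬝ᵥ torusMatrix.mulVec (Pi.single i 1) := by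
    simpa using zpow_injective_of_pow_ne_one (q := Units.mk0 q (NeZero.ne q)) hq
      (Additive.ofMul.injective (h i))
  have h0 : 0 = -g 1 + -g 2 + -g 3 := by
    simpa [torusMatrix, Matrix.mulVec, dotProduct, Fin.sum_univ_four] using hexp 0
  have h1 : -g 0 = g 3 := by
    simpa [torusMatrix, Matrix.mulVec, dotProduct, Fin.sum_univ_four] using hexp 1
  have h2 : g 0 = g 3 := by
    simpa [torusMatrix, Matrix.mulVec, dotProduct, Fin.sum_univ_four] using hexp 2
  have h3 : -g 0 + g 1 + -g 2 = 0 := by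
    simpa [torusMatrix, Matrix.mulVec, dotProduct, Fin.sum_univ_four] using hexp 3
  have hg : g 0 = 0 ∧ g 1 = 0 ∧ g 2 = 0 ∧ g 3 = 0 := by omega
  ext i
  fin_cases i <;> simp [hg]

variable {G : Type*} [AddCommMonoid G] {p : G →+ Fin 4 → ℤ} {v : Fin 6 → G}

theorem qcomm_single (hp : ∀ i, p (v i) = torusVec i) {i j : Fin 6}
    (hij : s(i, j) ≠ s(4, 5)) (s t : k) : QComm (qMatrix q i j)
      (single (χ := comap (torusChar q) p) (v i) s) (single (v j) t) := by
  rw [QComm, single_mul_single, single_mul_single, smul_single, add_comm (v j)]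
  congr 1
  simp only [comap_apply, hp, torusChar, powBicharacter_apply, toMul_ofMul,
    Units.val_zpow_eq_zpow_val, Units.val_mk0]
  rw [qMatrix, Matrix.of_apply, expMatrix_eq_sub hij, mul_left_comm,
    ← zpow_add₀ (NeZero.ne q), sub_add_cancel, mul_comm t]

variable (p v) in
/-- The homomorphism to a twisted monoid algebra over the quantum torus on `a, b, c, K` that sends
`a, b, c, K` to monomials, and `ψ` and `φ` to multiples of monomials one of which vanishes. -/
noncomputable def toTorus (hq : q ^ 2 ≠ 1) (hp : ∀ i, p (v i) = torusVec i)
    (hv : ∀ i : Fin 6, i.val < 4 → IsAddUnit (v i)) {α β : k} (hαβ : α * β = 0) :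
    Dq q →ₐ[k] TwistedMonoidAlgebra (comap (torusChar q) p) :=
  (QuantumPolynomial.lift (fun i => single (v i) (![1, 1, 1, 1, α, β] i))
    (fun i j => by
      by_cases hij : s(i, j) = s(4, 5)
      · obtain ⟨rfl, rfl⟩ | ⟨rfl, rfl⟩ := Sym2.eq_iff.1 hij <;>
          simp [QComm, single_mul_single, smul_single, hαβ, mul_comm β, add_comm (v 5)]
      · exact qcomm_single hp hij _ _)
    (fun i hi => by
      have : ![1, 1, 1, 1, α, β] i = 1 := by fin_cases i <;> simp at hi ⊢
      rw [this]
      exact isUnit_single (hv i hi))).comp (toLaurent hq)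

theorem toTorus_var (hq : q ^ 2 ≠ 1) (hp : ∀ i, p (v i) = torusVec i)
    (hv : ∀ i : Fin 6, i.val < 4 → IsAddUnit (v i)) {α β : k} (hαβ : α * β = 0) (i : Fin 6) :
    toTorus p v hq hp hv hαβ (var q i) = single (v i) (![1, 1, 1, 1, α, β] i) := by
  rw [toTorus, AlgHom.comp_apply, toLaurent_var, QuantumPolynomial.lift_X]

end Torus

end Dq

namespace GGWA

/-! ### Recognizing generalized generalized Weyl algebras inside twisted monoid algebras -/

section QWeyl

variable {k R A : Type*} [Field k] [Ring R] [Algebra k R] [Ring A] [Algebra k A]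
  {σ τ : R →ₐ[k] R} {g : R →ₐ[k] A} {X Y : A} {s t : k} {p w : R}

theorem IsRealization.of_qWeyl (hst : s ≠ t) (hσp : σ p = s • p) (hσw : σ w = t • w)
    (hX : ∀ r, X * g r = g (σ r) * X) (hY : ∀ r, Y * g r = g (τ r) * Y)
    (hXY : X * Y = s • (Y * X) + g w) (hp : g p = (s - t) • (Y * X) + g w) :
    IsRealization σ τ ((s - t)⁻¹ • (p - w)) g X Y where
  x_mul := hX
  y_mul := hY
  y_mul_x := by
    rw [map_smul, map_sub, hp, add_sub_cancel_right, inv_smul_smul₀ (sub_ne_zero.2 hst)]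
  x_mul_y := by
    have := sub_ne_zero.2 hst
    rw [map_smul, map_sub, hσp, hσw, map_smul, map_sub, map_smul, map_smul, hp, hXY]
    match_scalars <;> field_simp

theorem inv_smul_sub_ne_zero [Nontrivial R] (hst : s ≠ t) (hσp : σ p = s • p) (hσw : σ w = t • w)
    (hw : IsUnit w) : (s - t)⁻¹ • (p - w) ≠ 0 := by
  intro h
  have hpw : p = w :=
    sub_eq_zero.1 ((smul_eq_zero_iff_right (inv_ne_zero (sub_ne_zero.2 hst))).1 h)
  have : (s - t) • w = 0 := by rw [sub_smul, ← hσw, ← hpw, hσp, sub_self]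
  exact hw.ne_zero ((smul_eq_zero_iff_right (sub_ne_zero.2 hst)).1 this)

end QWeyl

section TwistedMonoidAlgebra

open TwistedMonoidAlgebra QuantumPolynomial

variable {k A G : Type*} [Field k] [Ring A] [Algebra k A] [AddCommMonoid G] [UniqueSums G]
  {χ : G →+ G →+ Additive kˣ} {n r : ℕ} {Q : Matrix (Fin n) (Fin n) k}
  {σ τ : QuantumPolynomial Q r →ₐ[k] QuantumPolynomial Q r} {a : QuantumPolynomial Q r}
  {g : QuantumPolynomial Q r →ₐ[k] A} {x y : A}

theorem IsRealization.injective_of_map_eq_single (h : IsRealization σ τ a g x y)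
    (hA : Algebra.adjoin k (Set.range g ∪ {x, y}) = ⊤) (hQ : ∀ i j, Q i j ≠ 0) (ha : a ≠ 0)
    {f : A →ₐ[k] TwistedMonoidAlgebra χ} {v : Fin n → G} {u : G}
    (hf : ∀ i, f (g (X Q r i)) = single (v i) 1) (hv : ∀ i : Fin n, i.val < r → IsAddUnit (v i))
    (hy : f y = single u 1) (hu : IsAddUnit u) {D : G →+ Fin n → ℤ}
    (hD : ∀ i, D (v i) = Pi.single i 1) {δ : G →+ ℤ} (hδ : ∀ i, δ (v i) = 0) (hδu : δ u = -1) :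
    Function.Injective f ∧ Function.Injective g ∧ Function.Injective h.lift := by
  have hinj : Function.Injective (f.comp g) := injective_of_map_X_eq_single hQ hf hv hD
  have hdeg (z) : f (g z) ∈ homogeneousSubmodule χ δ 0 :=
    map_mem_homogeneousSubmodule_zero (f := f.comp g) hf hv hδ z
  have hyx : f y * f x = f (g a) := by rw [← map_mul, h.y_mul_x]
  have hfa : f (g a) ≠ 0 := (map_ne_zero_iff (f.comp g) hinj).2 ha
  obtain ⟨u', hu'⟩ := isAddUnit_iff_exists_neg.1 hu
  have hδu' : δ u' = 1 := by
    have : δ u + δ u' = 0 := by rw [← map_add, hu', map_zero]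
    omega
  have hx : f x ∈ homogeneousSubmodule χ δ 1 := by
    have hinv : (single u' ↑(χ u' u).toMul⁻¹ : TwistedMonoidAlgebra χ) * f y = 1 := by
      rw [hy, single_mul_single, add_comm, hu', mul_one, Units.inv_mul, one_def]
    rw [← one_mul (f x), ← hinv, mul_assoc, hyx, ← hδu', ← add_zero (δ u')]
    exact SetLike.mul_mem_graded (single_mem_homogeneousSubmodule δ u' _) (hdeg a)
  obtain ⟨hf, hlift⟩ := h.injective_of_graded (iSupIndep_homogeneousSubmodule δ) hA hinj hdeg hx
    (right_ne_zero_of_mul (hyx ▸ hfa)) (by rw [hy, ← hδu]; exact single_mem_homogeneousSubmodule ..)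
    (hy ▸ single_ne_zero one_ne_zero)
  exact ⟨hf, .of_comp (f := f) hinj, hlift⟩

theorem exists_algEquiv_of_qWeyl {p w : QuantumPolynomial Q r} {s t : k} (hst : s ≠ t)
    (hσp : σ p = s • p) (hσw : σ w = t • w) (hw : IsUnit w)
    (hx : ∀ i, x * g (X Q r i) = g (σ (X Q r i)) * x)
    (hτ : ∀ i, y * g (X Q r i) = g (τ (X Q r i)) * y)
    (hxy : x * y = s • (y * x) + g w) (hp : g p = (s - t) • (y * x) + g w)
    (hA : Algebra.adjoin k (Set.range g ∪ {x, y}) = ⊤) (hQ : ∀ i j, Q i j ≠ 0)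
    {f : A →ₐ[k] TwistedMonoidAlgebra χ} {v : Fin n → G} {u : G}
    (hf : ∀ i, f (g (X Q r i)) = single (v i) 1) (hv : ∀ i : Fin n, i.val < r → IsAddUnit (v i))
    (hy : f y = single u 1) (hu : IsAddUnit u) {D : G →+ Fin n → ℤ}
    (hD : ∀ i, D (v i) = Pi.single i 1) {δ : G →+ ℤ} (hδ : ∀ i, δ (v i) = 0) (hδu : δ u = -1) :
    Function.Injective f ∧ IsGGWADatum σ τ ((s - t)⁻¹ • (p - w)) ∧
      ∃ e : A ≃ₐ[k] GGWA σ τ ((s - t)⁻¹ • (p - w)),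
        (∀ i, e (g (X Q r i)) = of _ _ _ (X Q r i)) ∧ e x = GGWA.x _ _ _ ∧ e y = GGWA.y _ _ _ := by
  have h := IsRealization.of_qWeyl hst hσp hσw (semiconj_of_X (g := g.comp σ) hx)
    (semiconj_of_X (g := g.comp τ) hτ) hxy hp
  have : Nontrivial A := f.toRingHom.domain_nontrivial
  have : Nontrivial (QuantumPolynomial Q r) := g.toRingHom.domain_nontrivial
  obtain ⟨hfi, hgi, hli⟩ := h.injective_of_map_eq_single hA hQ
    (inv_smul_sub_ne_zero hst hσp hσw hw) hf hv hy hu hD hδ hδu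
  have : NoZeroDivisors A := hfi.noZeroDivisors f (map_zero f) (map_mul f)
  obtain ⟨e, he, hex, hey⟩ := h.exists_algEquiv hli hA
  have hy0 : y ≠ 0 := (map_ne_zero_iff f hfi).1 (hy ▸ single_ne_zero one_ne_zero)
  exact ⟨hfi, h.isGGWADatum hgi hy0, e, fun i => he _, hex, hey⟩

end TwistedMonoidAlgebra

end GGWA

namespace Dq

/-! ### Factor algebras of `D_q` as generalized generalized Weyl algebras -/

section Units

variable {k A : Type*} [Field k] [Ring A] [Algebra k A] {s s' t : k} {x y u : A}

theorem isUnit_of_smul_mul_add_eq_zero (h : s • (y * x) + u = 0) (h' : s' • (x * y) + t • u = 0)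
    (ht : t ≠ 0) (hu : IsUnit u) : IsUnit y := by
  refine isUnit_iff_exists_and_exists.2 ⟨⟨-(s • x) * ↑hu.unit⁻¹, ?_⟩,
    ↑hu.unit⁻¹ * -((t⁻¹ * s') • x), ?_⟩
  · rw [← mul_assoc, mul_neg, mul_smul_comm, ← eq_neg_of_add_eq_zero_right h, hu.mul_val_inv]
  · rw [mul_assoc, neg_mul, smul_mul_assoc, mul_smul, ← smul_neg, ← eq_neg_of_add_eq_zero_right h',
      inv_smul_smul₀ ht, hu.val_inv_mul]

theorem mem_of_smul_mul_add_eq_zero {B : Subalgebra k A} (hs : s ≠ 0) (h : s • (y * x) + u = 0)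
    (hy : ∃ z ∈ B, z * y = 1) (hu : u ∈ B) : x ∈ B := by
  obtain ⟨z, hz, hzy⟩ := hy
  have hx : x = -(s⁻¹ • (z * u)) := by
    rw [eq_neg_of_add_eq_zero_right h, mul_neg, mul_smul_comm, ← mul_assoc, hzy, one_mul, smul_neg,
      neg_neg, inv_smul_smul₀ hs]
  exact hx ▸ neg_mem (B.smul_mem (mul_mem hz hu) _)

end Units

section Factor

open QuantumPolynomial

variable {k A : Type*} [Field k] {q : k} [Ring A] [Algebra k A] {π : Dq q →ₐ[k] A}

theorem isUnit_map_a : IsUnit (π (a q)) :=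
  IsUnit.map π (isUnit_iff_exists.2 ⟨ainv q, a_mul_ainv, ainv_mul_a⟩)

theorem isUnit_map_K : IsUnit (π (K q)) :=
  IsUnit.map π (isUnit_iff_exists.2 ⟨Kinv q, K_mul_Kinv, Kinv_mul_K⟩)

theorem isUnit_map_ainv_K : IsUnit (π (ainv q * K q)) :=
  IsUnit.map π (.mul (isUnit_iff_exists.2 ⟨a q, ainv_mul_a, a_mul_ainv⟩)
    (isUnit_iff_exists.2 ⟨Kinv q, K_mul_Kinv, Kinv_mul_K⟩))

variable {n r : ℕ} {idx : Fin n → Fin 6} {g : QPoly q idx r →ₐ[k] A}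

theorem var_mem_of_range_subset (hg : ∀ i, g (X _ _ i) = π (var q (idx i))) {B : Subalgebra k A}
    (hB : Set.range g ⊆ B) {j : Fin 6} (hj : ∃ i : Fin n, i.val < r ∧ idx i = j) :
    π (var q j) ∈ B ∧ ∃ z ∈ B, z * π (var q j) = 1 := by
  obtain ⟨i, hi, rfl⟩ := hj
  exact ⟨hg i ▸ hB ⟨_, rfl⟩, g (Xinv _ _ i hi), hB ⟨_, rfl⟩,
    by rw [← hg, ← map_mul, Xinv_mul_X, map_one]⟩

theorem map_mem_of_mul_eq_one {B : Subalgebra k A} {x x' : Dq q} (h : x * x' = 1)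
    (hx : ∃ z ∈ B, z * π x = 1) : π x' ∈ B := by
  obtain ⟨z, hz, hzx⟩ := hx
  exact left_inv_eq_right_inv hzx (by rw [← map_mul, h, map_one]) ▸ hz

theorem subalgebra_eq_top (hπ : Function.Surjective π)
    (hg : ∀ i, g (X _ _ i) = π (var q (idx i))) {B : Subalgebra k A} (hB : Set.range g ⊆ B)
    (ha : ∃ i : Fin n, i.val < r ∧ idx i = 0) (hK : ∃ i : Fin n, i.val < r ∧ idx i = 3)
    (hb : π (b q) ∈ B) (hc : π (c q) ∈ B) (hE : π (E q) ∈ B) (hF : π (F q) ∈ B) : B = ⊤ := by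
  obtain ⟨ha, ha'⟩ := var_mem_of_range_subset hg hB ha
  obtain ⟨hK, hK'⟩ := var_mem_of_range_subset hg hB hK
  have hof (z : Gen) : π (of q z) ∈ B := by
    cases z with
    | a => exact ha
    | ainv => exact map_mem_of_mul_eq_one a_mul_ainv ha'
    | b => exact hb
    | c => exact hc
    | K => exact hK
    | Kinv => exact map_mem_of_mul_eq_one K_mul_Kinv hK'
    | E => exact hE
    | F => exact hF
  refine eq_top_iff.2 ?_
  rintro z -
  obtain ⟨z, rfl⟩ := hπ z
  induction z using induction with
  | algebraMap t => rw [AlgHom.commutes]; exact B.algebraMap_mem t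
  | of z => exact hof z
  | add z w hz hw => rw [map_add]; exact add_mem hz hw
  | mul z w hz hw => rw [map_mul]; exact mul_mem hz hw

theorem map_E_mem_of_psi (hq : q ^ 2 ≠ 1) (hψ : π (psi q) = 0)
    (hg : ∀ i, g (X _ _ i) = π (var q (idx i))) {B : Subalgebra k A} (hB : Set.range g ⊆ B)
    (hidx : ∀ j : Fin 6, j = 0 ∨ j = 2 ∨ j = 3 → ∃ i : Fin n, i.val < r ∧ idx i = j) :
    π (E q) ∈ B := by
  have h : (1 - q ^ (-2 : ℤ)) • (π (c q) * π (E q)) + π (ainv q) * π (K q) = 0 := by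
    rw [← hψ, psi_eq, map_add, map_smul, map_mul, map_mul]
  exact mem_of_smul_mul_add_eq_zero (one_sub_zpow_neg_two_ne_zero hq) h
    (var_mem_of_range_subset hg hB (hidx 2 (by decide))).2
    (mul_mem (map_mem_of_mul_eq_one a_mul_ainv
      (var_mem_of_range_subset hg hB (hidx 0 (by decide))).2)
      (var_mem_of_range_subset hg hB (hidx 3 (by decide))).1)

theorem adjoin_eq_top_of_psi (hq : q ^ 2 ≠ 1) (hπ : Function.Surjective π) (hψ : π (psi q) = 0)
    (hg : ∀ i, g (X _ _ i) = π (var q (idx i)))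
    (hidx : ∀ j : Fin 6, j = 0 ∨ j = 2 ∨ j = 3 → ∃ i : Fin n, i.val < r ∧ idx i = j) :
    Algebra.adjoin k (Set.range g ∪ {π (F q), π (b q)}) = ⊤ := by
  have hB := Set.union_subset_iff.1 <|
    Algebra.subset_adjoin (R := k) (s := Set.range g ∪ {π (F q), π (b q)})
  exact subalgebra_eq_top hπ hg hB.1 (hidx 0 (by decide)) (hidx 3 (by decide)) (hB.2 (.inr rfl))
    (var_mem_of_range_subset hg hB.1 (hidx 2 (by decide))).1 (map_E_mem_of_psi hq hψ hg hB.1 hidx)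
    (hB.2 (.inl rfl))

variable [NeZero q]

theorem isUnit_map_b (hφ : π (phi q) = 0) : IsUnit (π (b q)) := by
  have h := hφ
  rw [phi_eq, map_add, map_smul, map_mul] at h
  rw [phi, map_add, map_smul, map_smul, map_mul] at hφ
  exact isUnit_of_smul_mul_add_eq_zero h hφ (pow_ne_zero 2 (NeZero.ne q)) isUnit_map_a

theorem isUnit_map_c (hψ : π (psi q) = 0) : IsUnit (π (c q)) := by
  have h := hψ
  rw [psi_eq, map_add, map_smul, map_mul] at h
  rw [psi, map_add, map_smul, map_smul, map_mul] at hψ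
  exact isUnit_of_smul_mul_add_eq_zero h hψ (zpow_ne_zero _ (NeZero.ne q)) isUnit_map_ainv_K

theorem map_F_mem_of_phi (hq : q ^ 2 ≠ 1) (hφ : π (phi q) = 0)
    (hg : ∀ i, g (X _ _ i) = π (var q (idx i))) {B : Subalgebra k A} (hB : Set.range g ⊆ B)
    (hidx : ∀ j : Fin 6, j = 0 ∨ j = 1 → ∃ i : Fin n, i.val < r ∧ idx i = j) :
    π (F q) ∈ B := by
  have h : (q⁻¹ - q) • (π (b q) * π (F q)) + π (a q) = 0 := by
    rw [← hφ, phi_eq, map_add, map_smul, map_mul]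
  exact mem_of_smul_mul_add_eq_zero (inv_sub_self_ne_zero hq) h
    (var_mem_of_range_subset hg hB (hidx 1 (by decide))).2
    (var_mem_of_range_subset hg hB (hidx 0 (by decide))).1

theorem adjoin_eq_top_of_phi (hq : q ^ 2 ≠ 1) (hπ : Function.Surjective π) (hφ : π (phi q) = 0)
    (hg : ∀ i, g (X _ _ i) = π (var q (idx i)))
    (hidx : ∀ j : Fin 6, j = 0 ∨ j = 1 ∨ j = 3 → ∃ i : Fin n, i.val < r ∧ idx i = j) :
    Algebra.adjoin k (Set.range g ∪ {π (E q), π (c q)}) = ⊤ := by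
  have hB := Set.union_subset_iff.1 <|
    Algebra.subset_adjoin (R := k) (s := Set.range g ∪ {π (E q), π (c q)})
  exact subalgebra_eq_top hπ hg hB.1 (hidx 0 (by decide)) (hidx 3 (by decide))
    (var_mem_of_range_subset hg hB.1 (hidx 1 (by decide))).1 (hB.2 (.inr rfl)) (hB.2 (.inl rfl))
    (map_F_mem_of_phi hq hφ hg hB.1 fun j hj => hidx j (hj.imp_right .inl))

/-- The exponents `d` with `E z = q ^ d z E` for `z` one of `a, b, c, K, ψ, φ` other than `c`. -/
def expE : Fin 6 → ℤ := ![0, 0, 0, -2, 0, 0]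

/-- The exponents `d` with `F z = q ^ d z F` for `z` one of `a, b, c, K, ψ, φ` other than `b`. -/
def expF : Fin 6 → ℤ := ![1, 0, 1, 2, 1, -1]

theorem qcomm_E_var {i : Fin 6} (hi : i ≠ 2) : QComm (q ^ expE i) (E q) (var q i) := by
  have hcongr {s : k} {i : Fin 6} (h : QComm s (E q) (var q i)) (e : s = q ^ expE i) :
      QComm (q ^ expE i) (E q) (var q i) := h.congr e
  fin_cases i
  · exact hcongr qcomm_E_a (by simp [expE])
  · exact hcongr qcomm_E_b (by simp [expE])
  · exact absurd rfl hi
  · exact hcongr (qcomm_K_E.symm (pow_ne_zero 2 (NeZero.ne q))) (by simp [expE, zpow_neg])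
  · exact hcongr qcomm_E_psi (by simp [expE])
  · exact hcongr qcomm_E_phi (by simp [expE])

theorem qcomm_F_var {i : Fin 6} (hi : i ≠ 1) : QComm (q ^ expF i) (F q) (var q i) := by
  have hcongr {s : k} {i : Fin 6} (h : QComm s (F q) (var q i)) (e : s = q ^ expF i) :
      QComm (q ^ expF i) (F q) (var q i) := h.congr e
  fin_cases i
  · exact hcongr qcomm_F_a (by simp [expF])
  · exact absurd rfl hi
  · exact hcongr qcomm_F_c (by simp [expF])
  · exact hcongr (qcomm_K_F.symm (zpow_ne_zero _ (NeZero.ne q))) (by simp [expF, zpow_neg])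
  · exact hcongr qcomm_F_psi (by simp [expF])
  · exact hcongr qcomm_F_phi (by simp [expF])

variable (q idx r) in
/-- The automorphism that multiplies the variable with number `i` among `a, b, c, K, ψ, φ` by
`q ^ d i`. -/
noncomputable def scaleExp (d : Fin 6 → ℤ) : QPoly q idx r ≃ₐ[k] QPoly q idx r :=
  scale fun i => Units.mk0 q (NeZero.ne q) ^ d (idx i)

theorem scaleExp_X (d : Fin 6 → ℤ) (i : Fin n) :
    scaleExp q r idx d (X _ _ i) = q ^ d (idx i) • X _ _ i := by
  rw [scaleExp, scale_X, Units.val_zpow_eq_zpow_val, Units.val_mk0]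

theorem scaleExp_Xinv (d : Fin 6 → ℤ) {i : Fin n} (hi : i.val < r) :
    scaleExp q r idx d (Xinv _ _ i hi) = q ^ (-d (idx i)) • Xinv _ _ i hi := by
  rw [scaleExp, scale_Xinv, Units.val_zpow_eq_zpow_val, Units.val_mk0, zpow_neg]

theorem map_mul_map_var {d : Fin 6 → ℤ} {z : Dq q} (hg : ∀ i, g (X _ _ i) = π (var q (idx i)))
    {i : Fin n} (h : QComm (q ^ d (idx i)) z (var q (idx i))) :
    π z * g (X _ _ i) = g (scaleExp q r idx d (X _ _ i)) * π z := by
  rw [scaleExp_X, map_smul, hg, smul_mul_assoc]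
  exact (h.map π).eq

variable {G : Type*} [AddCommMonoid G] [UniqueSums G] {χ : G →+ G →+ Additive kˣ}
  {f : A →ₐ[k] TwistedMonoidAlgebra χ} {v : Fin 6 → G} {D : G →+ Fin n → ℤ} {δ : G →+ ℤ}
  {p : QPoly q idx r}

theorem exists_algEquiv_of_phi (hq : q ^ 2 ≠ 1) (hπ : Function.Surjective π)
    (hφ : π (phi q) = 0) (hg : ∀ i, g (X _ _ i) = π (var q (idx i)))
    {i₀ i₁ i₃ : Fin n} (hi₀ : i₀.val < r) (hi₁ : i₁.val < r) (hi₃ : i₃.val < r)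
    (h₀ : idx i₀ = 0) (h₁ : idx i₁ = 1) (h₃ : idx i₃ = 3) (hc : ∀ i, idx i ≠ 2)
    (hp : g p = π (psi q)) (hσp : scaleExp q r idx expE p = p)
    (hf : ∀ i, f (g (X _ _ i)) = .single (v (idx i)) 1)
    (hfc : f (π (c q)) = .single (v 2) 1) (hv : ∀ i : Fin 6, i.val < 4 → IsAddUnit (v i))
    (hr : ∀ i : Fin n, i.val < r → (idx i).val < 4)
    (hD : ∀ i, D (v (idx i)) = Pi.single i 1) (hδ : ∀ i, δ (v (idx i)) = 0) (hδc : δ (v 2) = -1) :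
    Function.Injective f ∧
      IsGGWADatum (scaleExp q r idx expE : QPoly q idx r →ₐ[k] _) (scaleExp q r idx (expMatrix 2))
        ((1 - q ^ (-2 : ℤ))⁻¹ • (p - Xinv _ _ i₀ hi₀ * X _ _ i₃)) ∧
      ∃ e : A ≃ₐ[k] GGWA (scaleExp q r idx expE : QPoly q idx r →ₐ[k] _)
          (scaleExp q r idx (expMatrix 2))
          ((1 - q ^ (-2 : ℤ))⁻¹ • (p - Xinv _ _ i₀ hi₀ * X _ _ i₃)),
        (∀ i, e (π (var q (idx i))) = .of _ _ _ (X _ _ i)) ∧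
          e (π (E q)) = .x _ _ _ ∧ e (π (c q)) = .y _ _ _ := by
  have hw : g (Xinv _ _ i₀ hi₀ * X _ _ i₃) = π (ainv q * K q) := by
    rw [map_mul, map_mul, hg, h₃, map_Xinv g hi₀]
    · rfl
    · rw [hg, h₀, ← map_mul]
      exact (congrArg π ainv_mul_a).trans (map_one π)
  have hσw : scaleExp q r idx expE (Xinv _ _ i₀ hi₀ * X _ _ i₃) =
      q ^ (-2 : ℤ) • (Xinv _ _ i₀ hi₀ * X _ _ i₃) := by
    rw [map_mul, scaleExp_Xinv, scaleExp_X, h₀, h₃]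
    simp [expE]
  simp only [← hg]
  refine GGWA.exists_algEquiv_of_qWeyl (y := π (c q))
    (sub_ne_zero.1 (one_sub_zpow_neg_two_ne_zero hq))
    (hσp.trans (one_smul k p).symm) hσw (.mul (isUnit_Xinv _ _) (isUnit_X _ hi₃))
    (fun i => map_mul_map_var hg (qcomm_E_var (hc i)))
    (fun i => map_mul_map_var hg (qcomm_var 2 _)) ?_ ?_ (adjoin_eq_top_of_phi hq hπ hφ hg
      (by rintro j (rfl | rfl | rfl); exacts [⟨i₀, hi₀, h₀⟩, ⟨i₁, hi₁, h₁⟩, ⟨i₃, hi₃, h₃⟩]))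
    (fun i j => qMatrix_ne_zero _ _) hf (fun i hi => hv _ (hr i hi)) hfc (hv 2 (by decide)) hD hδ
    hδc
  · rw [one_smul, hw, ← map_mul, E_mul_c, map_add, map_mul]
  · rw [hp, hw, psi_eq, map_add, map_smul, map_mul π (c q)]

theorem exists_algEquiv_of_psi (hq : q ^ 2 ≠ 1) (hπ : Function.Surjective π)
    (hψ : π (psi q) = 0) (hg : ∀ i, g (X _ _ i) = π (var q (idx i)))
    {i₀ i₂ i₃ : Fin n} (hi₀ : i₀.val < r) (hi₂ : i₂.val < r) (hi₃ : i₃.val < r)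
    (h₀ : idx i₀ = 0) (h₂ : idx i₂ = 2) (h₃ : idx i₃ = 3) (hb : ∀ i, idx i ≠ 1)
    (hp : g p = π (phi q)) (hσp : scaleExp q r idx expF p = q⁻¹ • p)
    (hf : ∀ i, f (g (X _ _ i)) = .single (v (idx i)) 1)
    (hfb : f (π (b q)) = .single (v 1) 1) (hv : ∀ i : Fin 6, i.val < 4 → IsAddUnit (v i))
    (hr : ∀ i : Fin n, i.val < r → (idx i).val < 4)
    (hD : ∀ i, D (v (idx i)) = Pi.single i 1) (hδ : ∀ i, δ (v (idx i)) = 0) (hδb : δ (v 1) = -1) :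
    Function.Injective f ∧
      IsGGWADatum (scaleExp q r idx expF : QPoly q idx r →ₐ[k] _) (scaleExp q r idx (expMatrix 1))
        ((q⁻¹ - q)⁻¹ • (p - X _ _ i₀)) ∧
      ∃ e : A ≃ₐ[k] GGWA (scaleExp q r idx expF : QPoly q idx r →ₐ[k] _)
          (scaleExp q r idx (expMatrix 1)) ((q⁻¹ - q)⁻¹ • (p - X _ _ i₀)),
        (∀ i, e (π (var q (idx i))) = .of _ _ _ (X _ _ i)) ∧
          e (π (F q)) = .x _ _ _ ∧ e (π (b q)) = .y _ _ _ := by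
  have hw : g (X _ _ i₀) = π (a q) := by rw [hg, h₀]; rfl
  have hσw : scaleExp q r idx expF (X _ _ i₀) = q • X _ _ i₀ := by
    rw [scaleExp_X, h₀]
    simp [expF]
  simp only [← hg]
  refine GGWA.exists_algEquiv_of_qWeyl (y := π (b q)) (sub_ne_zero.1 (inv_sub_self_ne_zero hq))
    hσp hσw (isUnit_X _ hi₀) (fun i => map_mul_map_var hg (qcomm_F_var (hb i)))
    (fun i => map_mul_map_var hg (qcomm_var 1 _)) ?_ ?_ (adjoin_eq_top_of_psi hq hπ hψ hg
      (by rintro j (rfl | rfl | rfl); exacts [⟨i₀, hi₀, h₀⟩, ⟨i₂, hi₂, h₂⟩, ⟨i₃, hi₃, h₃⟩]))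
    (fun i j => qMatrix_ne_zero _ _) hf (fun i hi => hv _ (hr i hi)) hfb (hv 1 (by decide)) hD hδ
    hδb
  · rw [hw, ← map_mul, F_mul_b, map_add, map_smul, map_mul]
  · rw [hp, hw, phi_eq, map_add, map_smul, map_mul π (b q)]

end Factor

end Dq

namespace TwistedMonoidAlgebra

variable {k G A : Type*} [Field k] [AddCommGroup G] {χ : G →+ G →+ Additive kˣ} [Ring A]
  [Algebra k A] {f : A →ₐ[k] TwistedMonoidAlgebra χ}

theorem neg_mem_exponents_of_isUnit {y : A} {g : G} (hy : IsUnit y) (hfy : f y = single g 1) :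
    -g ∈ exponents f.range := by
  obtain ⟨y, rfl⟩ := hy
  have hinv : f ↑y⁻¹ = single (-g) ↑(χ g (-g)).toMul⁻¹ := by
    refine left_inv_eq_right_inv (a := f y) (by rw [← map_mul, y.inv_mul, map_one]) ?_
    rw [hfy, single_mul_single, add_neg_cancel, one_mul, Units.inv_mul, one_def]
  exact (smul_single_mem (p := Subalgebra.toSubmodule f.range) (Units.ne_zero _)).1
    ⟨_, hinv⟩

end TwistedMonoidAlgebra

namespace Dq

/-! ### Factor algebras and their maps to twisted monoid algebras -/

section Factor

open TwistedMonoidAlgebra QuantumPolynomial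

variable {k A : Type*} [Field k] {q : k} [Ring A] [Algebra k A]

/-- The projection of `D_q` onto a factor algebra, as a homomorphism of algebras. -/
def proj (s : Set (Dq q)) : Dq q →ₐ[k] Factor s := (TwoSidedIdeal.span s).ringCon.mkₐ k

theorem proj_surjective (s : Set (Dq q)) : Function.Surjective (proj s) :=
  RingCon.mk'_surjective _

theorem proj_eq_zero {s : Set (Dq q)} {z : Dq q} (hz : z ∈ s) : proj s z = 0 :=
  (RingCon.eq _).2 <| (TwoSidedIdeal.mem_iff _ _).1 (TwoSidedIdeal.subset_span hz)

theorem exists_algHom_factor {s : Set (Dq q)} {g : Dq q →ₐ[k] A} (hg : ∀ z ∈ s, g z = 0) :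
    ∃ f : Factor s →ₐ[k] A, ∀ z, f (proj s z) = g z := by
  have hle : TwoSidedIdeal.span s ≤ TwoSidedIdeal.ker (g : Dq q →+* A) :=
    TwoSidedIdeal.span_le.2 fun z hz => (TwoSidedIdeal.mem_ker _).2 (hg z hz)
  exact ⟨RingCon.liftₐ _ g (TwoSidedIdeal.ringCon_le_iff.1 hle), fun _ => rfl⟩

variable [NeZero q]

section Base

variable {n r : ℕ} (π : Dq q →ₐ[k] A) (idx : Fin n → Fin 6)

/-- The homomorphism from a quantum polynomial algebra on some of `a, b, c, K, ψ, φ` to an algebra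
under `D_q` in which the variables to be inverted are units. -/
noncomputable def ofQPoly (h : ∀ i : Fin n, i.val < r → IsUnit (π (var q (idx i)))) :
    QPoly q idx r →ₐ[k] A :=
  QuantumPolynomial.lift (fun i => π (var q (idx i))) (fun _ _ => (qcomm_var _ _).map π) h

variable {π idx}

theorem ofQPoly_X (h : ∀ i : Fin n, i.val < r → IsUnit (π (var q (idx i)))) (i : Fin n) :
    ofQPoly π idx h (X _ _ i) = π (var q (idx i)) := lift_X ..

end Base

theorem exists_toTorus_factor {G : Type*} [AddCommMonoid G] {p : G →+ Fin 4 → ℤ} {v : Fin 6 → G}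
    (hq : q ^ 2 ≠ 1) (hp : ∀ i, p (v i) = torusVec i)
    (hv : ∀ i : Fin 6, i.val < 4 → IsAddUnit (v i)) {α β : k} (hαβ : α * β = 0) {s : Set (Dq q)}
    (hs : ∀ z ∈ s, toTorus p v hq hp hv hαβ z = 0) :
    ∃ f : Factor s →ₐ[k] TwistedMonoidAlgebra (comap (torusChar q) p),
      ∀ i, f (proj s (var q i)) = single (v i) (![1, 1, 1, 1, α, β] i) := by
  obtain ⟨f, hf⟩ := exists_algHom_factor hs
  exact ⟨f, fun i => (hf _).trans (toTorus_var hq hp hv hαβ i)⟩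

theorem exists_center_eq_adjoin (hq : ∀ n : ℕ, 0 < n → q ^ n ≠ 1)
    {f : A →ₐ[k] TwistedMonoidAlgebra (comap (torusChar q) (.fst (Fin 4 → ℤ) ℕ))}
    (hf : Function.Injective f) (hvar : ∀ i : Fin 4, ∃ x, f x = single (Pi.single i 1, 0) 1)
    {y z : A} {g : Fin 4 → ℤ} (hy : IsUnit y) (hfy : f y = single (g, 0) 1)
    (hfz : f z = single (g, 1) 1) :
    ∃ (u : Aˣ) (θ : A), (u : A) = y ∧ θ = z * ↑u⁻¹ ∧
      Subalgebra.center k A = Algebra.adjoin k {θ} ∧ Transcendental k θ := by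
  obtain ⟨u, rfl⟩ := hy
  have hθ : f (z * ↑u⁻¹) = single (0, 1) 1 := by
    refine mul_right_cancel₀ (b := f u) (by rw [hfy]; exact single_ne_zero one_ne_zero) ?_
    rw [← map_mul, Units.inv_mul_cancel_right, hfz, hfy, single_mul_single]
    simp
  refine ⟨u, _, rfl, rfl, center_eq_adjoin_of_injective hf (fun g hg => ?_) hθ,
    transcendental_of_map_eq_single hθ⟩
  exact eq_zero_of_forall_torusChar_comm hq fun i => hg _ (hvar i)

theorem isSimpleRing_of_injective_torus (hq : ∀ n : ℕ, 0 < n → q ^ n ≠ 1)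
    {f : A →ₐ[k] TwistedMonoidAlgebra (comap (torusChar q) (.id (Fin 4 → ℤ)))}
    (hf : Function.Injective f) {z : Fin 4 → A} (hz : ∀ i, f (z i) = single (Pi.single i 1) 1)
    {j : Fin 4} (hunit : ∀ i ≠ j, IsUnit (z i)) {s t : k} {x u : A}
    (hxz : x * z j = s • (z j * x) + u) (huz : u * z j = t • (z j * u)) (hu : IsUnit u)
    (hst : ∀ n : ℕ, 0 < n → s ^ n ≠ t ^ n) : IsSimpleRing A := by
  have hmem (i : Fin 4) : Pi.single i 1 ∈ exponents f.range := ⟨z i, hz i⟩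
  refine TwistedMonoidAlgebra.isSimpleRing_of_injective hf
    (fun g hg => eq_zero_of_forall_torusChar_comm hq fun i => hg _ (hmem i)) (hz j)
    (exists_nsmul_single_sub_mem hmem fun i hi => neg_mem_exponents_of_isUnit (hunit i hi) (hz i))
    hxz huz hu hst

end Factor

end Dq

namespace Dq

open TwistedMonoidAlgebra QuantumPolynomial

variable {k : Type*} [Field k] {q : k} [NeZero q]

/-! ### The factor algebras by `φ` and by `ψ` -/

section One

/-- The exponents of `a, b, c, K, ψ, φ` in the twisted monoid algebra in which the one with number
`j` has a factor that is a further indeterminate. -/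
def polyVec (j i : Fin 6) : (Fin 4 → ℤ) × ℕ := (torusVec i, if i = j then 1 else 0)

theorem isAddUnit_polyVec {j : Fin 6} (hj : 4 ≤ j.val) {i : Fin 6} (hi : i.val < 4) :
    IsAddUnit (polyVec j i) := by
  have hij : i ≠ j := by rintro rfl; omega
  exact Prod.isAddUnit_iff.2 ⟨AddGroup.isAddUnit _, by simp [polyVec, hij]⟩

theorem mem_span_phi {z : Dq q} : z ∈ TwoSidedIdeal.span {phi q} ↔ ∃ d, z = d * phi q := by
  rw [mem_twoSidedIdeal_span_iff_mem_ideal_span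
    (by rintro _ rfl; exact exists_phi_mul_eq), Ideal.mem_span_singleton']
  simp only [eq_comm]

theorem mem_span_psi {z : Dq q} : z ∈ TwoSidedIdeal.span {psi q} ↔ ∃ d, z = d * psi q := by
  rw [mem_twoSidedIdeal_span_iff_mem_ideal_span
    (by rintro _ rfl; exact exists_psi_mul_eq), Ideal.mem_span_singleton']
  simp only [eq_comm]

theorem exists_injective_and_ggwa_phi (hq : q ^ 2 ≠ 1) :
    (∃ f : Factor {phi q} →ₐ[k] TwistedMonoidAlgebra (comap (torusChar q) (.fst _ ℕ)),
      Function.Injective f ∧ ∀ i ≠ 5, f (proj _ (var q i)) = single (polyVec 4 i) 1) ∧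
    ∃ σ τ : R36 q ≃ₐ[k] R36 q,
      (σ (R36.a q) = R36.a q ∧ σ (R36.b q) = R36.b q ∧
        σ (R36.K q) = q ^ (-2 : ℤ) • R36.K q ∧ σ (R36.psi q) = R36.psi q) ∧
      (τ (R36.a q) = q⁻¹ • R36.a q ∧ τ (R36.b q) = R36.b q ∧
        τ (R36.K q) = q • R36.K q ∧ τ (R36.psi q) = R36.psi q) ∧
      IsGGWADatum (σ : R36 q →ₐ[k] R36 q) τ (R36.elt q) ∧
      ∃ e : Factor {phi q} ≃ₐ[k] GGWA (σ : R36 q →ₐ[k] R36 q) τ (R36.elt q),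
        e (cl _ (a q)) = .of _ _ _ (R36.a q) ∧ e (cl _ (b q)) = .of _ _ _ (R36.b q) ∧
        e (cl _ (K q)) = .of _ _ _ (R36.K q) ∧ e (cl _ (psi q)) = .of _ _ _ (R36.psi q) ∧
        e (cl _ (E q)) = .x _ _ _ ∧ e (cl _ (c q)) = .y _ _ _ := by
  have hv (i : Fin 6) (hi : i.val < 4) := isAddUnit_polyVec (j := 4) le_rfl hi
  obtain ⟨f, hf⟩ := exists_toTorus_factor (p := .fst _ ℕ) (v := polyVec 4) hq (fun _ => rfl) hv
    (mul_zero 1) (s := {phi q})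
    (by rintro _ rfl; exact (toTorus_var hq _ hv _ 5).trans (Finsupp.single_zero _))
  have hf1 (i : Fin 6) (hi : i ≠ 5) : f (proj _ (var q i)) = single (polyVec 4 i) 1 := by
    rw [hf]; fin_cases i <;> first | rfl | exact absurd rfl hi
  have hφ : proj {phi q} (phi q) = 0 := proj_eq_zero rfl
  have hunit (i : Fin 4) (hi : i.val < 3) :
      IsUnit (proj {phi q} (var q (![0, 1, 3, 4] i))) := by
    fin_cases i
    exacts [isUnit_map_a, isUnit_map_b hφ, isUnit_map_K, absurd hi (by decide)]
  obtain ⟨hinj, hdatum, e, he, hE, hc⟩ := exists_algEquiv_of_phi (p := X _ _ 3) (v := polyVec 4)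
    (i₀ := 0) (i₁ := 1) (i₃ := 2) (f := f)
    (D := .mk' (fun g => ![g.1 0, g.1 1 - g.2, g.1 3, g.2])
      (fun g h => by ext i; fin_cases i <;> simp; ring))
    (δ := -(Pi.evalAddMonoidHom _ 2).comp (.fst _ _)) hq (proj_surjective _)
    hφ (ofQPoly_X hunit) (by decide) (by decide) (by decide) rfl rfl rfl (by decide)
    (ofQPoly_X hunit 3) (by simp [scaleExp_X, expE])
    (fun i => by rw [ofQPoly_X, hf1 _ (by revert i; decide)]) (hf1 2 (by decide)) hv (by decide)
    (fun i => by fin_cases i <;> decide) (by decide) (by decide)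
  exact ⟨⟨f, hinj, hf1⟩, _, _, by simp [scaleExp_X, expE], by simp [scaleExp_X, expMatrix], hdatum,
    e, he 0, he 1, he 2, he 3, hE, hc⟩

theorem exists_injective_and_ggwa_psi (hq : q ^ 2 ≠ 1) :
    (∃ f : Factor {psi q} →ₐ[k] TwistedMonoidAlgebra (comap (torusChar q) (.fst _ ℕ)),
      Function.Injective f ∧ ∀ i ≠ 4, f (proj _ (var q i)) = single (polyVec 5 i) 1) ∧
    ∃ σ τ : R25 q ≃ₐ[k] R25 q,
      (σ (R25.a q) = q • R25.a q ∧ σ (R25.c q) = q • R25.c q ∧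
        σ (R25.K q) = q ^ 2 • R25.K q ∧ σ (R25.phi q) = q⁻¹ • R25.phi q) ∧
      (τ (R25.a q) = q⁻¹ • R25.a q ∧ τ (R25.c q) = R25.c q ∧
        τ (R25.K q) = q⁻¹ • R25.K q ∧ τ (R25.phi q) = q • R25.phi q) ∧
      IsGGWADatum (σ : R25 q →ₐ[k] R25 q) τ (R25.elt q) ∧
      ∃ e : Factor {psi q} ≃ₐ[k] GGWA (σ : R25 q →ₐ[k] R25 q) τ (R25.elt q),
        e (cl _ (a q)) = .of _ _ _ (R25.a q) ∧ e (cl _ (c q)) = .of _ _ _ (R25.c q) ∧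
        e (cl _ (K q)) = .of _ _ _ (R25.K q) ∧ e (cl _ (phi q)) = .of _ _ _ (R25.phi q) ∧
        e (cl _ (F q)) = .x _ _ _ ∧ e (cl _ (b q)) = .y _ _ _ := by
  have hv (i : Fin 6) (hi : i.val < 4) := isAddUnit_polyVec (j := 5) (by decide) hi
  obtain ⟨f, hf⟩ := exists_toTorus_factor (p := .fst _ ℕ) (v := polyVec 5) hq (fun _ => rfl) hv
    (zero_mul 1) (s := {psi q})
    (by rintro _ rfl; exact (toTorus_var hq _ hv _ 4).trans (Finsupp.single_zero _))
  have hf1 (i : Fin 6) (hi : i ≠ 4) : f (proj _ (var q i)) = single (polyVec 5 i) 1 := by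
    rw [hf]; fin_cases i <;> first | rfl | exact absurd rfl hi
  have hψ : proj {psi q} (psi q) = 0 := proj_eq_zero rfl
  have hunit (i : Fin 4) (hi : i.val < 3) :
      IsUnit (proj {psi q} (var q (![0, 2, 3, 5] i))) := by
    fin_cases i
    exacts [isUnit_map_a, isUnit_map_c hψ, isUnit_map_K, absurd hi (by decide)]
  obtain ⟨hinj, hdatum, e, he, hF, hb⟩ := exists_algEquiv_of_psi (p := X _ _ 3) (v := polyVec 5)
    (i₀ := 0) (i₂ := 1) (i₃ := 2) (f := f)
    (D := .mk' (fun g => ![g.1 0, g.1 2 - g.2, g.1 3 + g.2, g.2])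
      (fun g h => by ext i; fin_cases i <;> simp <;> ring))
    (δ := -(Pi.evalAddMonoidHom _ 1).comp (.fst _ _)) hq (proj_surjective _)
    hψ (ofQPoly_X hunit) (by decide) (by decide) (by decide) rfl rfl rfl (by decide)
    (ofQPoly_X hunit 3) (by simp [scaleExp_X, expF])
    (fun i => by rw [ofQPoly_X, hf1 _ (by revert i; decide)]) (hf1 1 (by decide)) hv (by decide)
    (fun i => by fin_cases i <;> decide) (by decide) (by decide)
  exact ⟨⟨f, hinj, hf1⟩, _, _, by simp [scaleExp_X, expF], by simp [scaleExp_X, expMatrix],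
    hdatum, e, he 0, he 1, he 2, he 3, hF, hb⟩

theorem isDomain_factor_phi (hq : q ^ 2 ≠ 1) : IsDomain (Factor {phi q}) :=
  have ⟨⟨f, hf, _⟩, _⟩ := exists_injective_and_ggwa_phi hq
  hf.isDomain f.toRingHom

theorem isDomain_factor_psi (hq : q ^ 2 ≠ 1) : IsDomain (Factor {psi q}) :=
  have ⟨⟨f, hf, _⟩, _⟩ := exists_injective_and_ggwa_psi hq
  hf.isDomain f.toRingHom

theorem exists_center_factor_phi_eq_adjoin (hq : ∀ n : ℕ, 0 < n → q ^ n ≠ 1) :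
    ∃ (u : (Factor {phi q})ˣ) (Θ : Factor {phi q}), (u : Factor {phi q}) = cl _ (b q) ∧
      Θ = cl {phi q} (psi q) * ↑u⁻¹ ∧
      Subalgebra.center k (Factor {phi q}) = Algebra.adjoin k {Θ} ∧ Transcendental k Θ := by
  obtain ⟨⟨f, hf, hvar⟩, -⟩ := exists_injective_and_ggwa_phi (hq 2 two_pos)
  refine exists_center_eq_adjoin hq hf (fun i => ?_)
    (isUnit_map_b (π := proj {phi q}) (proj_eq_zero rfl)) (hvar 1 (by decide)) (hvar 4 (by decide))
  fin_cases i
  exacts [⟨_, hvar 0 (by decide)⟩, ⟨_, hvar 1 (by decide)⟩, ⟨_, hvar 2 (by decide)⟩,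
    ⟨_, hvar 3 (by decide)⟩]

theorem exists_center_factor_psi_eq_adjoin (hq : ∀ n : ℕ, 0 < n → q ^ n ≠ 1) :
    ∃ (u : (Factor {psi q})ˣ) (Ω : Factor {psi q}), (u : Factor {psi q}) = cl _ (c q) ∧
      Ω = cl {psi q} (phi q * K q) * ↑u⁻¹ ∧
      Subalgebra.center k (Factor {psi q}) = Algebra.adjoin k {Ω} ∧ Transcendental k Ω := by
  obtain ⟨⟨f, hf, hvar⟩, -⟩ := exists_injective_and_ggwa_psi (hq 2 two_pos)
  have hφK : f (proj _ (phi q * K q)) = single (Pi.single 2 1, 1) 1 := by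
    rw [map_mul, map_mul]
    refine (congrArg₂ _ (hvar 5 (by decide)) (hvar 3 (by decide))).trans ?_
    rw [single_mul_single]
    simp [polyVec, torusVec, torusChar, torusMatrix]
  refine exists_center_eq_adjoin hq hf (fun i => ?_)
    (isUnit_map_c (π := proj {psi q}) (proj_eq_zero rfl)) (hvar 2 (by decide)) hφK
  fin_cases i
  exacts [⟨_, hvar 0 (by decide)⟩, ⟨_, hvar 1 (by decide)⟩, ⟨_, hvar 2 (by decide)⟩,
    ⟨_, hvar 3 (by decide)⟩]

end One

end Dq

namespace Dq

/-! ### The simple factor algebras -/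

section Simple

open TwistedMonoidAlgebra QuantumPolynomial

variable {k : Type*} [Field k] {q : k}

theorem mem_span_phi_psi [NeZero q] {z : Dq q} :
    z ∈ TwoSidedIdeal.span {phi q, psi q} ↔ ∃ d d', z = d * phi q + d' * psi q := by
  rw [mem_twoSidedIdeal_span_iff_mem_ideal_span
    (by rintro _ (rfl | rfl); exacts [exists_phi_mul_eq, exists_psi_mul_eq]), Ideal.mem_span_pair]
  simp only [eq_comm]

theorem proj_psi (α : k) :
    proj {phi q, psi q - α • b q} (psi q) = α • proj {phi q, psi q - α • b q} (b q) := by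
  rw [← sub_eq_zero, ← map_smul, ← map_sub]
  exact proj_eq_zero (.inr rfl)

theorem proj_phi (β : k) :
    proj {phi q - β • (c q * Kinv q), psi q} (phi q) =
      β • proj {phi q - β • (c q * Kinv q), psi q} (c q * Kinv q) := by
  rw [← sub_eq_zero, ← map_smul, ← map_sub]
  exact proj_eq_zero (.inl rfl)

variable [NeZero q]

theorem exists_injective_and_ggwa_phi_psi_sub (hq : q ^ 2 ≠ 1) (α : k) :
    (∃ f : Factor {phi q, psi q - α • b q} →ₐ[k] TwistedMonoidAlgebra (comap (torusChar q) (.id _)),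
      Function.Injective f ∧
        ∀ i : Fin 6, i.val < 4 → f (proj _ (var q i)) = single (torusVec i) 1) ∧
    ∃ σ τ : R356 q ≃ₐ[k] R356 q,
      (σ (R356.a q) = R356.a q ∧ σ (R356.b q) = R356.b q ∧
        σ (R356.K q) = q ^ (-2 : ℤ) • R356.K q) ∧
      (τ (R356.a q) = q⁻¹ • R356.a q ∧ τ (R356.b q) = R356.b q ∧
        τ (R356.K q) = q • R356.K q) ∧
      IsGGWADatum (σ : R356 q →ₐ[k] R356 q) τ (R356.elt q α) ∧
      ∃ e : Factor {phi q, psi q - α • b q} ≃ₐ[k]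
          GGWA (σ : R356 q →ₐ[k] R356 q) τ (R356.elt q α),
        e (cl _ (a q)) = .of _ _ _ (R356.a q) ∧ e (cl _ (b q)) = .of _ _ _ (R356.b q) ∧
        e (cl _ (K q)) = .of _ _ _ (R356.K q) ∧
        e (cl _ (E q)) = .x _ _ _ ∧ e (cl _ (c q)) = .y _ _ _ := by
  have hv (i : Fin 6) (_ : i.val < 4) : IsAddUnit (torusVec i) := AddGroup.isAddUnit _
  have hvar := toTorus_var (p := .id _) hq (fun _ => rfl) hv (mul_zero α)
  obtain ⟨f, hf⟩ := exists_toTorus_factor (p := .id _) hq (fun _ => rfl) hv (mul_zero α)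
    (s := {phi q, psi q - α • b q}) <| by
      rintro _ (rfl | rfl)
      · exact (hvar 5).trans (Finsupp.single_zero _)
      · rw [map_sub, map_smul, sub_eq_zero]
        refine (hvar 4).trans <| .trans ?_ (congrArg (α • ·) (hvar 1).symm)
        exact ((smul_single α _ 1).trans (congrArg _ (mul_one α))).symm
  have hf1 (i : Fin 6) (hi : i.val < 4) : f (proj _ (var q i)) = single (torusVec i) 1 := by
    rw [hf]; fin_cases i <;> first | rfl | exact absurd hi (by decide)
  set π := proj {phi q, psi q - α • b q}
  have hφ : π (phi q) = 0 := proj_eq_zero (.inl rfl)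
  have hunit (i : Fin 3) (_ : i.val < 3) : IsUnit (π (var q (![0, 1, 3] i))) := by
    fin_cases i
    exacts [isUnit_map_a, isUnit_map_b hφ, isUnit_map_K]
  have hψ : ofQPoly π _ hunit (α • X _ _ 1) = π (psi q) := by
    rw [map_smul, ofQPoly_X]; exact (proj_psi α).symm
  obtain ⟨hinj, hdatum, e, he, hE, hc⟩ := exists_algEquiv_of_phi (v := torusVec)
    (i₀ := 0) (i₁ := 1) (i₃ := 2) (f := f)
    (D := .mk' (fun g => ![g 0, g 1, g 3]) (fun g h => by ext i; fin_cases i <;> rfl))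
    (δ := -Pi.evalAddMonoidHom _ 2) hq (proj_surjective _)
    hφ (ofQPoly_X hunit) (by decide) (by decide) (by decide) rfl rfl rfl (by decide)
    hψ (by simp [scaleExp_X, expE])
    (fun i => by rw [ofQPoly_X, hf1 _ (by revert i; decide)]) (hf1 2 (by decide)) hv (by decide)
    (fun i => by fin_cases i <;> decide) (by decide) (by decide)
  exact ⟨⟨f, hinj, hf1⟩, _, _, by simp [scaleExp_X, expE], by simp [scaleExp_X, expMatrix], hdatum,
    e, he 0, he 1, he 2, hE, hc⟩

theorem isDomain_factor_phi_psi_sub (hq : q ^ 2 ≠ 1) (α : k) :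
    IsDomain (Factor {phi q, psi q - α • b q}) :=
  have ⟨⟨f, hf, _⟩, _⟩ := exists_injective_and_ggwa_phi_psi_sub hq α
  hf.isDomain f.toRingHom

theorem isSimpleRing_factor_phi_psi_sub (hq : ∀ n : ℕ, 0 < n → q ^ n ≠ 1) (α : k) :
    IsSimpleRing (Factor {phi q, psi q - α • b q}) := by
  obtain ⟨⟨f, hf, hvar⟩, -⟩ := exists_injective_and_ggwa_phi_psi_sub (hq 2 two_pos) α
  set π := proj {phi q, psi q - α • b q}
  refine isSimpleRing_of_injective_torus hq hf (z := ![π (a q), π (b q), π (c q), π (K q)])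
    (x := π (E q)) (u := π (ainv q * K q)) (s := 1) (t := q ^ (-2 : ℤ)) (j := 2) ?_ ?_ ?_ ?_
    isUnit_map_ainv_K fun n hn => ?_
  · intro i
    fin_cases i
    exacts [hvar 0 (by decide), hvar 1 (by decide), hvar 2 (by decide), hvar 3 (by decide)]
  · intro i hi
    fin_cases i
    exacts [isUnit_map_a, isUnit_map_b (proj_eq_zero (.inl rfl)), absurd rfl hi, isUnit_map_K]
  · change π (E q) * π (c q) = (1 : k) • (π (c q) * π (E q)) + π (ainv q * K q)
    rw [one_smul, ← map_mul, E_mul_c, map_add, map_mul]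
  · exact (qcomm_ainv_K_c.map π).eq
  · rw [one_pow, zpow_neg, inv_pow, ne_comm, inv_ne_one]
    exact_mod_cast pow_mul q 2 n ▸ hq (2 * n) (by omega)

theorem toTorus_phi_sub (hq : q ^ 2 ≠ 1) (β : k) :
    toTorus (.id _) torusVec hq (fun _ => rfl) (fun _ _ => AddGroup.isAddUnit _) (zero_mul β)
      (phi q - β • (c q * Kinv q)) = 0 := by
  set π := toTorus (.id _) torusVec hq (fun _ => rfl) (fun _ _ => AddGroup.isAddUnit _)
    (zero_mul β)
  have hvar : ∀ i, π (var q i) = _ := toTorus_var hq _ _ (zero_mul β)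
  have hφK : π (phi q) * π (K q) = β • π (c q) := by
    refine (congrArg₂ _ (hvar 5) (hvar 3)).trans <| .trans ?_ (congrArg (β • ·) (hvar 2).symm)
    rw [single_mul_single, smul_single]
    simp [torusVec, torusChar, torusMatrix]
  refine isUnit_map_K (π := π).mul_left_eq_zero.1 ?_
  rw [map_sub, map_smul, sub_mul, hφK, smul_mul_assoc, ← map_mul, mul_assoc, Kinv_mul_K, mul_one,
    sub_self]

theorem exists_injective_and_ggwa_phi_sub_psi (hq : q ^ 2 ≠ 1) (β : k) :
    (∃ f : Factor {phi q - β • (c q * Kinv q), psi q} →ₐ[k]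
        TwistedMonoidAlgebra (comap (torusChar q) (.id _)),
      Function.Injective f ∧
        ∀ i : Fin 6, i.val < 4 → f (proj _ (var q i)) = single (torusVec i) 1) ∧
    ∃ σ τ : R256 q ≃ₐ[k] R256 q,
      (σ (R256.a q) = q • R256.a q ∧ σ (R256.c q) = q • R256.c q ∧
        σ (R256.K q) = q ^ 2 • R256.K q) ∧
      (τ (R256.a q) = q⁻¹ • R256.a q ∧ τ (R256.c q) = R256.c q ∧
        τ (R256.K q) = q⁻¹ • R256.K q) ∧
      IsGGWADatum (σ : R256 q →ₐ[k] R256 q) τ (R256.elt q β) ∧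
      ∃ e : Factor {phi q - β • (c q * Kinv q), psi q} ≃ₐ[k]
          GGWA (σ : R256 q →ₐ[k] R256 q) τ (R256.elt q β),
        e (cl _ (a q)) = .of _ _ _ (R256.a q) ∧ e (cl _ (c q)) = .of _ _ _ (R256.c q) ∧
        e (cl _ (K q)) = .of _ _ _ (R256.K q) ∧
        e (cl _ (F q)) = .x _ _ _ ∧ e (cl _ (b q)) = .y _ _ _ := by
  have hv (i : Fin 6) (_ : i.val < 4) : IsAddUnit (torusVec i) := AddGroup.isAddUnit _
  have hvar := toTorus_var (p := .id _) hq (fun _ => rfl) hv (zero_mul β)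
  obtain ⟨f, hf⟩ := exists_toTorus_factor (p := .id _) hq (fun _ => rfl) hv (zero_mul β)
    (s := {phi q - β • (c q * Kinv q), psi q}) <| by
      rintro _ (rfl | rfl)
      · exact toTorus_phi_sub hq β
      · exact (hvar 4).trans (Finsupp.single_zero _)
  have hf1 (i : Fin 6) (hi : i.val < 4) : f (proj _ (var q i)) = single (torusVec i) 1 := by
    rw [hf]; fin_cases i <;> first | rfl | exact absurd hi (by decide)
  set π := proj {phi q - β • (c q * Kinv q), psi q}
  have hψ : π (psi q) = 0 := proj_eq_zero (.inr rfl)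
  have hunit (i : Fin 3) (_ : i.val < 3) : IsUnit (π (var q (![0, 2, 3] i))) := by
    fin_cases i
    exacts [isUnit_map_a, isUnit_map_c hψ, isUnit_map_K]
  have hφ : ofQPoly π _ hunit (β • (X _ _ 1 * Xinv _ _ 2 (by decide))) = π (phi q) := by
    rw [proj_phi β, map_smul, map_mul, map_mul, map_Xinv (z := π (Kinv q)), ofQPoly_X]
    · rfl
    · rw [ofQPoly_X, ← map_mul]
      exact (congrArg π Kinv_mul_K).trans (map_one π)
  have hσ : scaleExp q 3 ![0, 2, 3] expF (β • (X _ _ 1 * Xinv _ _ 2 (by decide))) =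
      q⁻¹ • β • (X _ _ 1 * Xinv _ _ 2 (by decide)) := by
    rw [map_smul, map_mul, scaleExp_X, scaleExp_Xinv, smul_mul_smul_comm, smul_comm,
      ← zpow_add₀ (NeZero.ne q), ← zpow_neg_one]
    rfl
  obtain ⟨hinj, hdatum, e, he, hF, hb⟩ := exists_algEquiv_of_psi (v := torusVec)
    (i₀ := 0) (i₂ := 1) (i₃ := 2) (f := f)
    (D := .mk' (fun g => ![g 0, g 2, g 3]) (fun g h => by ext i; fin_cases i <;> rfl))
    (δ := -Pi.evalAddMonoidHom _ 1) hq (proj_surjective _)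
    hψ (ofQPoly_X hunit) (by decide) (by decide) (by decide) rfl rfl rfl (by decide)
    hφ hσ (fun i => by rw [ofQPoly_X, hf1 _ (by revert i; decide)]) (hf1 1 (by decide)) hv
    (by decide) (fun i => by fin_cases i <;> decide) (by decide) (by decide)
  exact ⟨⟨f, hinj, hf1⟩, _, _, by simp [scaleExp_X, expF], by simp [scaleExp_X, expMatrix], hdatum,
    e, he 0, he 1, he 2, hF, hb⟩

theorem isDomain_factor_phi_sub_psi (hq : q ^ 2 ≠ 1) (β : k) :
    IsDomain (Factor {phi q - β • (c q * Kinv q), psi q}) :=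
  have ⟨⟨f, hf, _⟩, _⟩ := exists_injective_and_ggwa_phi_sub_psi hq β
  hf.isDomain f.toRingHom

theorem isSimpleRing_factor_phi_sub_psi (hq : ∀ n : ℕ, 0 < n → q ^ n ≠ 1) (β : k) :
    IsSimpleRing (Factor {phi q - β • (c q * Kinv q), psi q}) := by
  obtain ⟨⟨f, hf, hvar⟩, -⟩ := exists_injective_and_ggwa_phi_sub_psi (hq 2 two_pos) β
  set π := proj {phi q - β • (c q * Kinv q), psi q}
  refine isSimpleRing_of_injective_torus hq hf (z := ![π (a q), π (b q), π (c q), π (K q)])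
    (x := π (F q)) (u := π (a q)) (s := q⁻¹) (t := q) (j := 1) ?_ ?_ ?_ ?_
    isUnit_map_a fun n hn => ?_
  · intro i
    fin_cases i
    exacts [hvar 0 (by decide), hvar 1 (by decide), hvar 2 (by decide), hvar 3 (by decide)]
  · intro i hi
    fin_cases i
    exacts [isUnit_map_a, absurd rfl hi, isUnit_map_c (proj_eq_zero (.inr rfl)), isUnit_map_K]
  · change π (F q) * π (b q) = q⁻¹ • (π (b q) * π (F q)) + π (a q)
    rw [← map_mul, F_mul_b, map_add, map_smul, map_mul]
  · exact (qcomm_a_b.map π).eq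
  · rw [inv_pow, Ne, ← mul_eq_one_iff_inv_eq₀ (pow_ne_zero n (NeZero.ne q)), ← pow_add]
    exact hq (n + n) (by omega)

theorem exists_algEquiv_factor_phi_psi (hq : q ^ 2 ≠ 1) :
    ∃ e : Factor {phi q, psi q} ≃ₐ[k] T q, e (cl _ (a q)) = T.a q ∧ e (cl _ (b q)) = T.b q ∧
      e (cl _ (c q)) = T.c q ∧ e (cl _ (K q)) = T.K q := by
  have h := (exists_injective_and_ggwa_phi_psi_sub hq 0).1
  rw [zero_smul, sub_zero] at h
  obtain ⟨f, -, hf⟩ := h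
  set π := proj {phi q, psi q}
  have hφ : π (phi q) = 0 := proj_eq_zero (.inl rfl)
  have hψ : π (psi q) = 0 := proj_eq_zero (.inr rfl)
  have hunit (i : Fin 4) (_ : i.val < 4) : IsUnit (π (var q (![0, 1, 2, 3] i))) := by
    fin_cases i
    exacts [isUnit_map_a, isUnit_map_b hφ, isUnit_map_c hψ, isUnit_map_K]
  set g : T q →ₐ[k] Factor {phi q, psi q} := ofQPoly π _ hunit
  have hg (i : Fin 4) : g (X _ _ i) = π (var q (![0, 1, 2, 3] i)) := ofQPoly_X hunit i
  have hidx (j : Fin 6) (hj : j.val < 4) : ∃ i : Fin 4, i.val < 4 ∧ ![0, 1, 2, 3] i = j := by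
    revert j; decide
  have hinj : Function.Injective g := by
    refine .of_comp (f := f) (injective_of_map_X_eq_single (f := f.comp g) (D := .id _)
      (v := fun i => torusVec (![0, 1, 2, 3] i)) (fun _ _ => qMatrix_ne_zero _ _) (fun i => ?_)
      (fun _ _ => AddGroup.isAddUnit _) (by decide))
    rw [AlgHom.comp_apply, hg, hf _ (by revert i; decide)]
  have htop : g.range = ⊤ := subalgebra_eq_top (proj_surjective _) hg (B := g.range) subset_rfl
    (hidx 0 (by decide)) (hidx 3 (by decide))
    (var_mem_of_range_subset hg subset_rfl (hidx 1 (by decide))).1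
    (var_mem_of_range_subset hg subset_rfl (hidx 2 (by decide))).1
    (map_E_mem_of_psi hq hψ hg subset_rfl
      (by rintro j (rfl | rfl | rfl) <;> exact hidx _ (by decide)))
    (map_F_mem_of_phi hq hφ hg subset_rfl (by rintro j (rfl | rfl) <;> exact hidx _ (by decide)))
  have hX (i : Fin 4) : (AlgEquiv.ofBijective g ⟨hinj, AlgHom.range_eq_top g |>.1 htop⟩).symm
      (π (var q (![0, 1, 2, 3] i))) = X _ _ i :=
    (AlgEquiv.symm_apply_eq _).2 (hg i).symm
  exact ⟨_, hX 0, hX 1, hX 2, hX 3⟩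

theorem isSimpleRing_factor_phi_psi (hq : ∀ n : ℕ, 0 < n → q ^ n ≠ 1) :
    IsSimpleRing (Factor {phi q, psi q}) := by
  have h := isSimpleRing_factor_phi_psi_sub hq 0
  rwa [zero_smul, sub_zero] at h

end Simple

end Dq

theorem mainTheorem4_general {k : Type*} [Field k] (q : k) (hq0 : q ≠ 0)
    (hq : ∀ n : ℕ, 0 < n → q ^ n ≠ 1) :
    ((∀ z : Dq q, z ∈ TwoSidedIdeal.span {Dq.phi q} ↔ ∃ d : Dq q, z = d * Dq.phi q) ∧
      IsDomain (Dq.Factor {Dq.phi q}) ∧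
      (∃ σ τ : Dq.R36 q ≃ₐ[k] Dq.R36 q,
        (σ (Dq.R36.a q) = Dq.R36.a q ∧ σ (Dq.R36.b q) = Dq.R36.b q ∧
          σ (Dq.R36.K q) = q ^ (-2 : ℤ) • Dq.R36.K q ∧ σ (Dq.R36.psi q) = Dq.R36.psi q) ∧
        (τ (Dq.R36.a q) = q⁻¹ • Dq.R36.a q ∧ τ (Dq.R36.b q) = Dq.R36.b q ∧
          τ (Dq.R36.K q) = q • Dq.R36.K q ∧ τ (Dq.R36.psi q) = Dq.R36.psi q) ∧
        IsGGWADatum (σ : Dq.R36 q →ₐ[k] Dq.R36 q) τ (Dq.R36.elt q) ∧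
        ∃ e : Dq.Factor {Dq.phi q} ≃ₐ[k] GGWA (σ : Dq.R36 q →ₐ[k] Dq.R36 q) τ (Dq.R36.elt q),
          e (Dq.cl _ (Dq.a q)) = GGWA.of _ _ _ (Dq.R36.a q) ∧
          e (Dq.cl _ (Dq.b q)) = GGWA.of _ _ _ (Dq.R36.b q) ∧
          e (Dq.cl _ (Dq.K q)) = GGWA.of _ _ _ (Dq.R36.K q) ∧
          e (Dq.cl _ (Dq.psi q)) = GGWA.of _ _ _ (Dq.R36.psi q) ∧
          e (Dq.cl _ (Dq.E q)) = GGWA.x _ _ _ ∧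
          e (Dq.cl _ (Dq.c q)) = GGWA.y _ _ _) ∧
      (∃ (u : (Dq.Factor {Dq.phi q})ˣ) (Θ : Dq.Factor {Dq.phi q}),
        (u : Dq.Factor {Dq.phi q}) = Dq.cl {Dq.phi q} (Dq.b q) ∧
        Θ = Dq.cl {Dq.phi q} (Dq.psi q) * ↑u⁻¹ ∧
        Subalgebra.center k (Dq.Factor {Dq.phi q}) = Algebra.adjoin k {Θ} ∧
        Transcendental k Θ)) ∧
    ((∀ z : Dq q, z ∈ TwoSidedIdeal.span {Dq.psi q} ↔ ∃ d : Dq q, z = d * Dq.psi q) ∧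
      IsDomain (Dq.Factor {Dq.psi q}) ∧
      (∃ σ τ : Dq.R25 q ≃ₐ[k] Dq.R25 q,
        (σ (Dq.R25.a q) = q • Dq.R25.a q ∧ σ (Dq.R25.c q) = q • Dq.R25.c q ∧
          σ (Dq.R25.K q) = q ^ 2 • Dq.R25.K q ∧ σ (Dq.R25.phi q) = q⁻¹ • Dq.R25.phi q) ∧
        (τ (Dq.R25.a q) = q⁻¹ • Dq.R25.a q ∧ τ (Dq.R25.c q) = Dq.R25.c q ∧
          τ (Dq.R25.K q) = q⁻¹ • Dq.R25.K q ∧ τ (Dq.R25.phi q) = q • Dq.R25.phi q) ∧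
        IsGGWADatum (σ : Dq.R25 q →ₐ[k] Dq.R25 q) τ (Dq.R25.elt q) ∧
        ∃ e : Dq.Factor {Dq.psi q} ≃ₐ[k] GGWA (σ : Dq.R25 q →ₐ[k] Dq.R25 q) τ (Dq.R25.elt q),
          e (Dq.cl _ (Dq.a q)) = GGWA.of _ _ _ (Dq.R25.a q) ∧
          e (Dq.cl _ (Dq.c q)) = GGWA.of _ _ _ (Dq.R25.c q) ∧
          e (Dq.cl _ (Dq.K q)) = GGWA.of _ _ _ (Dq.R25.K q) ∧
          e (Dq.cl _ (Dq.phi q)) = GGWA.of _ _ _ (Dq.R25.phi q) ∧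
          e (Dq.cl _ (Dq.F q)) = GGWA.x _ _ _ ∧
          e (Dq.cl _ (Dq.b q)) = GGWA.y _ _ _) ∧
      (∃ (u : (Dq.Factor {Dq.psi q})ˣ) (Ω : Dq.Factor {Dq.psi q}),
        (u : Dq.Factor {Dq.psi q}) = Dq.cl {Dq.psi q} (Dq.c q) ∧
        Ω = Dq.cl {Dq.psi q} (Dq.phi q * Dq.K q) * ↑u⁻¹ ∧
        Subalgebra.center k (Dq.Factor {Dq.psi q}) = Algebra.adjoin k {Ω} ∧
        Transcendental k Ω)) ∧
    (∀ α : k,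
      IsDomain (Dq.Factor {Dq.phi q, Dq.psi q - α • Dq.b q}) ∧
      IsSimpleRing (Dq.Factor {Dq.phi q, Dq.psi q - α • Dq.b q}) ∧
      ∃ σ τ : Dq.R356 q ≃ₐ[k] Dq.R356 q,
        (σ (Dq.R356.a q) = Dq.R356.a q ∧ σ (Dq.R356.b q) = Dq.R356.b q ∧
          σ (Dq.R356.K q) = q ^ (-2 : ℤ) • Dq.R356.K q) ∧
        (τ (Dq.R356.a q) = q⁻¹ • Dq.R356.a q ∧ τ (Dq.R356.b q) = Dq.R356.b q ∧
          τ (Dq.R356.K q) = q • Dq.R356.K q) ∧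
        IsGGWADatum (σ : Dq.R356 q →ₐ[k] Dq.R356 q) τ (Dq.R356.elt q α) ∧
        ∃ e : Dq.Factor {Dq.phi q, Dq.psi q - α • Dq.b q} ≃ₐ[k]
            GGWA (σ : Dq.R356 q →ₐ[k] Dq.R356 q) τ (Dq.R356.elt q α),
          e (Dq.cl _ (Dq.a q)) = GGWA.of _ _ _ (Dq.R356.a q) ∧
          e (Dq.cl _ (Dq.b q)) = GGWA.of _ _ _ (Dq.R356.b q) ∧
          e (Dq.cl _ (Dq.K q)) = GGWA.of _ _ _ (Dq.R356.K q) ∧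
          e (Dq.cl _ (Dq.E q)) = GGWA.x _ _ _ ∧
          e (Dq.cl _ (Dq.c q)) = GGWA.y _ _ _) ∧
    ((∀ z : Dq q, z ∈ TwoSidedIdeal.span {Dq.phi q, Dq.psi q} ↔
        ∃ d d' : Dq q, z = d * Dq.phi q + d' * Dq.psi q) ∧
      IsSimpleRing (Dq.Factor {Dq.phi q, Dq.psi q}) ∧
      ∃ e : Dq.Factor {Dq.phi q, Dq.psi q} ≃ₐ[k] Dq.T q,
        e (Dq.cl _ (Dq.a q)) = Dq.T.a q ∧ e (Dq.cl _ (Dq.b q)) = Dq.T.b q ∧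
        e (Dq.cl _ (Dq.c q)) = Dq.T.c q ∧ e (Dq.cl _ (Dq.K q)) = Dq.T.K q) ∧
    (∀ β : k,
      IsDomain (Dq.Factor {Dq.phi q - β • (Dq.c q * Dq.Kinv q), Dq.psi q}) ∧
      IsSimpleRing (Dq.Factor {Dq.phi q - β • (Dq.c q * Dq.Kinv q), Dq.psi q}) ∧
      ∃ σ τ : Dq.R256 q ≃ₐ[k] Dq.R256 q,
        (σ (Dq.R256.a q) = q • Dq.R256.a q ∧ σ (Dq.R256.c q) = q • Dq.R256.c q ∧
          σ (Dq.R256.K q) = q ^ 2 • Dq.R256.K q) ∧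
        (τ (Dq.R256.a q) = q⁻¹ • Dq.R256.a q ∧ τ (Dq.R256.c q) = Dq.R256.c q ∧
          τ (Dq.R256.K q) = q⁻¹ • Dq.R256.K q) ∧
        IsGGWADatum (σ : Dq.R256 q →ₐ[k] Dq.R256 q) τ (Dq.R256.elt q β) ∧
        ∃ e : Dq.Factor {Dq.phi q - β • (Dq.c q * Dq.Kinv q), Dq.psi q} ≃ₐ[k]
            GGWA (σ : Dq.R256 q →ₐ[k] Dq.R256 q) τ (Dq.R256.elt q β),
          e (Dq.cl _ (Dq.a q)) = GGWA.of _ _ _ (Dq.R256.a q) ∧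
          e (Dq.cl _ (Dq.c q)) = GGWA.of _ _ _ (Dq.R256.c q) ∧
          e (Dq.cl _ (Dq.K q)) = GGWA.of _ _ _ (Dq.R256.K q) ∧
          e (Dq.cl _ (Dq.F q)) = GGWA.x _ _ _ ∧
          e (Dq.cl _ (Dq.b q)) = GGWA.y _ _ _) :=
  have : NeZero q := ⟨hq0⟩
  have hq2 := hq 2 two_pos
  ⟨⟨fun _ => Dq.mem_span_phi, Dq.isDomain_factor_phi hq2, (Dq.exists_injective_and_ggwa_phi hq2).2,
      Dq.exists_center_factor_phi_eq_adjoin hq⟩,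
    ⟨fun _ => Dq.mem_span_psi, Dq.isDomain_factor_psi hq2, (Dq.exists_injective_and_ggwa_psi hq2).2,
      Dq.exists_center_factor_psi_eq_adjoin hq⟩,
    fun α => ⟨Dq.isDomain_factor_phi_psi_sub hq2 α, Dq.isSimpleRing_factor_phi_psi_sub hq α,
      (Dq.exists_injective_and_ggwa_phi_psi_sub hq2 α).2⟩,
    ⟨fun _ => Dq.mem_span_phi_psi, Dq.isSimpleRing_factor_phi_psi hq,
      Dq.exists_algEquiv_factor_phi_psi hq2⟩,
    fun β => ⟨Dq.isDomain_factor_phi_sub_psi hq2 β, Dq.isSimpleRing_factor_phi_sub_psi hq β,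
      (Dq.exists_injective_and_ggwa_phi_sub_psi hq2 β).2⟩⟩

theorem mainTheorem4 {k : Type*} [Field k] [IsAlgClosed k] [CharZero k] (q : k) (hq0 : q ≠ 0)
    (hq : ∀ n : ℕ, 0 < n → q ^ n ≠ 1) :
    -- 1. the factor algebra by `φ`
    ((∀ z : Dq q, z ∈ TwoSidedIdeal.span {Dq.phi q} ↔ ∃ d : Dq q, z = d * Dq.phi q) ∧
      IsDomain (Dq.Factor {Dq.phi q}) ∧
      (∃ σ τ : Dq.R36 q ≃ₐ[k] Dq.R36 q,
        (σ (Dq.R36.a q) = Dq.R36.a q ∧ σ (Dq.R36.b q) = Dq.R36.b q ∧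
          σ (Dq.R36.K q) = q ^ (-2 : ℤ) • Dq.R36.K q ∧ σ (Dq.R36.psi q) = Dq.R36.psi q) ∧
        (τ (Dq.R36.a q) = q⁻¹ • Dq.R36.a q ∧ τ (Dq.R36.b q) = Dq.R36.b q ∧
          τ (Dq.R36.K q) = q • Dq.R36.K q ∧ τ (Dq.R36.psi q) = Dq.R36.psi q) ∧
        IsGGWADatum (σ : Dq.R36 q →ₐ[k] Dq.R36 q) τ (Dq.R36.elt q) ∧
        ∃ e : Dq.Factor {Dq.phi q} ≃ₐ[k] GGWA (σ : Dq.R36 q →ₐ[k] Dq.R36 q) τ (Dq.R36.elt q),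
          e (Dq.cl _ (Dq.a q)) = GGWA.of _ _ _ (Dq.R36.a q) ∧
          e (Dq.cl _ (Dq.b q)) = GGWA.of _ _ _ (Dq.R36.b q) ∧
          e (Dq.cl _ (Dq.K q)) = GGWA.of _ _ _ (Dq.R36.K q) ∧
          e (Dq.cl _ (Dq.psi q)) = GGWA.of _ _ _ (Dq.R36.psi q) ∧
          e (Dq.cl _ (Dq.E q)) = GGWA.x _ _ _ ∧
          e (Dq.cl _ (Dq.c q)) = GGWA.y _ _ _) ∧
      (∃ (u : (Dq.Factor {Dq.phi q})ˣ) (Θ : Dq.Factor {Dq.phi q}),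
        (u : Dq.Factor {Dq.phi q}) = Dq.cl {Dq.phi q} (Dq.b q) ∧
        Θ = Dq.cl {Dq.phi q} (Dq.psi q) * ↑u⁻¹ ∧
        Subalgebra.center k (Dq.Factor {Dq.phi q}) = Algebra.adjoin k {Θ} ∧
        Transcendental k Θ)) ∧
    -- 2. the factor algebra by `ψ`
    ((∀ z : Dq q, z ∈ TwoSidedIdeal.span {Dq.psi q} ↔ ∃ d : Dq q, z = d * Dq.psi q) ∧
      IsDomain (Dq.Factor {Dq.psi q}) ∧
      (∃ σ τ : Dq.R25 q ≃ₐ[k] Dq.R25 q,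
        (σ (Dq.R25.a q) = q • Dq.R25.a q ∧ σ (Dq.R25.c q) = q • Dq.R25.c q ∧
          σ (Dq.R25.K q) = q ^ 2 • Dq.R25.K q ∧ σ (Dq.R25.phi q) = q⁻¹ • Dq.R25.phi q) ∧
        (τ (Dq.R25.a q) = q⁻¹ • Dq.R25.a q ∧ τ (Dq.R25.c q) = Dq.R25.c q ∧
          τ (Dq.R25.K q) = q⁻¹ • Dq.R25.K q ∧ τ (Dq.R25.phi q) = q • Dq.R25.phi q) ∧
        IsGGWADatum (σ : Dq.R25 q →ₐ[k] Dq.R25 q) τ (Dq.R25.elt q) ∧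
        ∃ e : Dq.Factor {Dq.psi q} ≃ₐ[k] GGWA (σ : Dq.R25 q →ₐ[k] Dq.R25 q) τ (Dq.R25.elt q),
          e (Dq.cl _ (Dq.a q)) = GGWA.of _ _ _ (Dq.R25.a q) ∧
          e (Dq.cl _ (Dq.c q)) = GGWA.of _ _ _ (Dq.R25.c q) ∧
          e (Dq.cl _ (Dq.K q)) = GGWA.of _ _ _ (Dq.R25.K q) ∧
          e (Dq.cl _ (Dq.phi q)) = GGWA.of _ _ _ (Dq.R25.phi q) ∧
          e (Dq.cl _ (Dq.F q)) = GGWA.x _ _ _ ∧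
          e (Dq.cl _ (Dq.b q)) = GGWA.y _ _ _) ∧
      (∃ (u : (Dq.Factor {Dq.psi q})ˣ) (Ω : Dq.Factor {Dq.psi q}),
        (u : Dq.Factor {Dq.psi q}) = Dq.cl {Dq.psi q} (Dq.c q) ∧
        Ω = Dq.cl {Dq.psi q} (Dq.phi q * Dq.K q) * ↑u⁻¹ ∧
        Subalgebra.center k (Dq.Factor {Dq.psi q}) = Algebra.adjoin k {Ω} ∧
        Transcendental k Ω)) ∧
    -- 3. the factor algebras by `φ` and `ψ - α b`
    (∀ α : k,
      IsDomain (Dq.Factor {Dq.phi q, Dq.psi q - α • Dq.b q}) ∧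
      IsSimpleRing (Dq.Factor {Dq.phi q, Dq.psi q - α • Dq.b q}) ∧
      ∃ σ τ : Dq.R356 q ≃ₐ[k] Dq.R356 q,
        (σ (Dq.R356.a q) = Dq.R356.a q ∧ σ (Dq.R356.b q) = Dq.R356.b q ∧
          σ (Dq.R356.K q) = q ^ (-2 : ℤ) • Dq.R356.K q) ∧
        (τ (Dq.R356.a q) = q⁻¹ • Dq.R356.a q ∧ τ (Dq.R356.b q) = Dq.R356.b q ∧
          τ (Dq.R356.K q) = q • Dq.R356.K q) ∧
        IsGGWADatum (σ : Dq.R356 q →ₐ[k] Dq.R356 q) τ (Dq.R356.elt q α) ∧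
        ∃ e : Dq.Factor {Dq.phi q, Dq.psi q - α • Dq.b q} ≃ₐ[k]
            GGWA (σ : Dq.R356 q →ₐ[k] Dq.R356 q) τ (Dq.R356.elt q α),
          e (Dq.cl _ (Dq.a q)) = GGWA.of _ _ _ (Dq.R356.a q) ∧
          e (Dq.cl _ (Dq.b q)) = GGWA.of _ _ _ (Dq.R356.b q) ∧
          e (Dq.cl _ (Dq.K q)) = GGWA.of _ _ _ (Dq.R356.K q) ∧
          e (Dq.cl _ (Dq.E q)) = GGWA.x _ _ _ ∧
          e (Dq.cl _ (Dq.c q)) = GGWA.y _ _ _) ∧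
    -- in particular, the factor algebra by `φ` and `ψ` is a simple quantum torus
    ((∀ z : Dq q, z ∈ TwoSidedIdeal.span {Dq.phi q, Dq.psi q} ↔
        ∃ d d' : Dq q, z = d * Dq.phi q + d' * Dq.psi q) ∧
      IsSimpleRing (Dq.Factor {Dq.phi q, Dq.psi q}) ∧
      ∃ e : Dq.Factor {Dq.phi q, Dq.psi q} ≃ₐ[k] Dq.T q,
        e (Dq.cl _ (Dq.a q)) = Dq.T.a q ∧ e (Dq.cl _ (Dq.b q)) = Dq.T.b q ∧
        e (Dq.cl _ (Dq.c q)) = Dq.T.c q ∧ e (Dq.cl _ (Dq.K q)) = Dq.T.K q) ∧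
    -- 4. the factor algebras by `φ - β c K⁻¹` and `ψ`
    (∀ β : k,
      IsDomain (Dq.Factor {Dq.phi q - β • (Dq.c q * Dq.Kinv q), Dq.psi q}) ∧
      IsSimpleRing (Dq.Factor {Dq.phi q - β • (Dq.c q * Dq.Kinv q), Dq.psi q}) ∧
      ∃ σ τ : Dq.R256 q ≃ₐ[k] Dq.R256 q,
        (σ (Dq.R256.a q) = q • Dq.R256.a q ∧ σ (Dq.R256.c q) = q • Dq.R256.c q ∧
          σ (Dq.R256.K q) = q ^ 2 • Dq.R256.K q) ∧
        (τ (Dq.R256.a q) = q⁻¹ • Dq.R256.a q ∧ τ (Dq.R256.c q) = Dq.R256.c q ∧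
          τ (Dq.R256.K q) = q⁻¹ • Dq.R256.K q) ∧
        IsGGWADatum (σ : Dq.R256 q →ₐ[k] Dq.R256 q) τ (Dq.R256.elt q β) ∧
        ∃ e : Dq.Factor {Dq.phi q - β • (Dq.c q * Dq.Kinv q), Dq.psi q} ≃ₐ[k]
            GGWA (σ : Dq.R256 q →ₐ[k] Dq.R256 q) τ (Dq.R256.elt q β),
          e (Dq.cl _ (Dq.a q)) = GGWA.of _ _ _ (Dq.R256.a q) ∧
          e (Dq.cl _ (Dq.c q)) = GGWA.of _ _ _ (Dq.R256.c q) ∧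
          e (Dq.cl _ (Dq.K q)) = GGWA.of _ _ _ (Dq.R256.K q) ∧
          e (Dq.cl _ (Dq.F q)) = GGWA.x _ _ _ ∧
          e (Dq.cl _ (Dq.b q)) = GGWA.y _ _ _) :=
  mainTheorem4_general q hq0 hq
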